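/- Let $k$ be an algebraically closed field, $n\ge 2$ and $p\ge 0$ integers. Let $\Lambda_n$ be the Taft algebra: the path algebra over $k$ of the oriented cycle with vertices $j\in\mathbb Z/n$ and arrows $j\to j+1$, modulo all paths of length $\ge n$; let $e_j$ be its vertex idempotents and $P_j=\Lambda_n e_j$. Let $\Gamma_{\Lambda_n}$ be its Auslander algebra: the path algebra of the quiver with vertices $(i,u)\in(\mathbb Z/n)^2$, arrows $a_{i,u}:(i-1,u)\to(i,u)$ for $u\ne i-1$ and $b_{i,u}:(i,u-1)\to(i,u)$ for $u\neq i$, modulo the relations $a_{i,i-2}b_{i,i-1}=0$ for all $i$, and $a_{i,u-1}b_{i,u}+b_{i-1,u}a_{i,u}=0$ for $u\ne i,\,i-1$ (paths are written from left to right); let $e_{i,u}$ be its vertex idempotents and $P_{i,u}=\Gamma_{\Lambda_n}e_{i,u}$. For a $k$-algebra $A$, let $CC(A)$ be the cyclic bicomplex (even columns $(A^{\otimes q+1},b)$, odd columns $(A^{\otimes q+1},-b')$, horizontal maps $1-t$ and $N$), so that $HC_m(A)=H_m(\mathrm{Tot}\,CC(A))$. Put $y_i=(-1)^i(2i)!/i!$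 and $z_i=(-1)^{i-1}(2i)!/(2\,i!)$, and for an idempotent $e$ put $$\sigma^p(e,\dots,e)=(y_p e^{\otimes 2p+1},z_p e^{\otimes 2p},\dots,z_1e^{\otimes 2},y_0e)\in(\mathrm{Tot}\,CC(A))_{2p},$$ which is a cycle. Let $K_0(A)$ be the Grothendieck group of finitely generated projective left $A$-modules, and let $ch_{0,p}:K_0(A)\to HC_{2p}(A)$ be the Chern character, that is, the group homomorphism which sends the class of the image $A^m e$ of an idempotent matrix $e\in\mathcal M_m(A)$ to the image of the class of $\sigma^p(e,\dots,e)$ under the generalized trace $HC_{2p}(\mathcal M_m(A))\to HC_{2p}(A)$. Write $\sigma^p_j=\sigma^p(e_j,\dots,e_j)$ and $\sigma^p_{i,u}=\sigma^p(e_{i,u},\dots,e_{i,u})$. Then: 1. $ch_{0,p}([P_j])=\sigma^p_j$ in $HC_{2p}(\Lambda_n)$ for all $j$, and $ch_{0,p}([P_{i,u}])=\sigma^p_{i,u}$ in $HC_{2p}(\Gamma_{\Lambda_n})$ for all $i,u$. 2. If $p!\ne 0$ in $k$ (that is, $k$ has characteristic $0$ or characteristic $>p$), then the elements $\sigma^p_j$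 span the $k$-vector space $HC_{2p}(\Lambda_n)$, and the Chern character of $\Lambda_n$ is onto in the sense that its $k$-linear extension $k\otimes_{\mathbb Z}K_0(\Lambda_n)\to HC_{2p}(\Lambda_n)$ is surjective. 3. In every characteristic, the elements $\sigma^p_{i,u}$ span the $k$-vector space $HC_{2p}(\Gamma_{\Lambda_n})$, and the $k$-linear extension $k\otimes_{\mathbb Z}K_0(\Gamma_{\Lambda_n})\to HC_{2p}(\Gamma_{\Lambda_n})$ of the Chern character is surjective. -/

import Mathlib

open scoped TensorProduct Nat

noncomputable section

namespace CyclicHomology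

section Generic

variable (k : Type*) [CommRing k] {M : ℕ → Type*} [∀ n, AddCommGroup (M n)] [∀ n, Module k (M n)]
  (δ : ∀ n, M (n + 1) →ₗ[k] M n) (τ : ∀ n, M n ≃ₗ[k] M n)

/-- The `i`-th face `τ ^ i ∘ d₀ ∘ τ ^ (-i) : M (n + 1) → M n` (used for `0 ≤ i ≤ n + 1`) of a cyclic
module with zeroth faces `δ` and unsigned cyclic operators `τ`. -/
def face (n i : ℕ) : M (n + 1) →ₗ[k] M n :=
  ((τ n ^ i : M n ≃ₗ[k] M n) : M n →ₗ[k] M n) ∘ₗ δ n ∘ₗ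
    (((τ (n + 1) ^ i)⁻¹ : M (n + 1) ≃ₗ[k] M (n + 1)) : M (n + 1) →ₗ[k] M (n + 1))

/-- The Hochschild boundary `b = ∑_{i = 0}^{n + 1} (-1) ^ i dᵢ : M (n + 1) → M n`. -/
def bMap (n : ℕ) : M (n + 1) →ₗ[k] M n :=
  ∑ i ∈ Finset.range (n + 2), (-1 : k) ^ i • face k δ τ n i

/-- The bar boundary `b' = ∑_{i = 0}^{n} (-1) ^ i dᵢ : M (n + 1) → M n`. -/
def bMap' (n : ℕ) : M (n + 1) →ₗ[k] M n :=
  ∑ i ∈ Finset.range (n + 1), (-1 : k) ^ i • face k δ τ n i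

/-- The signed cyclic operator `t = (-1) ^ n τ` on `M n`. -/
def tMap (n : ℕ) : Module.End k (M n) := (-1 : k) ^ n • (τ n : M n →ₗ[k] M n)

/-- The norm operator `N = 1 + t + ⋯ + t ^ n` on `M n`. -/
def normMap (n : ℕ) : Module.End k (M n) := ∑ i ∈ Finset.range (n + 1), tMap k τ n ^ i

/-- The vertical differential from row `q + 1` to row `q` of the cyclic bicomplex, in column `c`:
it is `b` if `c` is even and `-b'` if `c` is odd. -/
def vert (c q : ℕ) : M (q + 1) →ₗ[k] M q := if Even c then bMap k δ τ q else -bMap' k δ τ q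

/-- The horizontal differential in row `q` of the cyclic bicomplex, from column `c + 1` to column
`c`: it is `1 - t` if `c` is even and `N` if `c` is odd. -/
def horiz (c q : ℕ) : Module.End k (M q) := if Even c then 1 - tMap k τ q else normMap k τ q

variable (M) in
/-- The degree `m` part of the total complex of the cyclic bicomplex (whose entry in column `c ≥ 0`
and row `q ≥ 0` is `M q`): the sum of the entries in row `q` and column `m - q`, `0 ≤ q ≤ m`. -/
abbrev Tot (m : ℕ) : Type _ := ∀ q : Fin (m + 1), M q

/-- The differential `Tot_{m + 1} → Tot_m`: the component of `d x` in row `q` and column `m - q` is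
the sum of the vertical differential of the component of `x` in row `q + 1` of the same column, and
of the horizontal differential of the component of `x` in row `q` of the next column. -/
def totD (m : ℕ) : Tot M (m + 1) →ₗ[k] Tot M m :=
  LinearMap.pi fun q : Fin (m + 1) =>
    vert k δ τ (m - q) q ∘ₗ (LinearMap.proj q.succ : Tot M (m + 1) →ₗ[k] M (q + 1)) +
      horiz k τ (m - q) q ∘ₗ (LinearMap.proj q.castSucc : Tot M (m + 1) →ₗ[k] M q)

/-- The cycles of degree `m` of the total complex. -/
def cycles : ∀ m : ℕ, Submodule k (Tot M m)
  | 0 => ⊤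
  | m + 1 => LinearMap.ker (totD k δ τ m)

/-- The homology of the total complex of the cyclic bicomplex in degree `m`: cycles modulo
boundaries. -/
abbrev TotHomology (m : ℕ) : Type _ :=
  cycles k δ τ m ⧸ (LinearMap.range (totD k δ τ m)).submoduleOf (cycles k δ τ m)

/-! ### Naturality -/

variable {M' : ℕ → Type*} [∀ n, AddCommGroup (M' n)] [∀ n, Module k (M' n)]
  (δ' : ∀ n, M' (n + 1) →ₗ[k] M' n) (τ' : ∀ n, M' n ≃ₗ[k] M' n)
  (f : ∀ n, M n →ₗ[k] M' n)

theorem pow_comm {f : ∀ n, M n →ₗ[k] M' n} (hτ : ∀ n x, f n (τ n x) = τ' n (f n x))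
    (n i : ℕ) (x : M n) :
    f n ((τ n ^ i : M n ≃ₗ[k] M n) x) = (τ' n ^ i : M' n ≃ₗ[k] M' n) (f n x) := by
  induction i generalizing x with
  | zero => rfl
  | succ i ih => rw [pow_succ, pow_succ, LinearEquiv.mul_apply, LinearEquiv.mul_apply, ih, hτ]

theorem inv_pow_comm {f : ∀ n, M n →ₗ[k] M' n} (hτ : ∀ n x, f n (τ n x) = τ' n (f n x))
    (n i : ℕ) (x : M n) :
    f n (((τ n ^ i)⁻¹ : M n ≃ₗ[k] M n) x) = ((τ' n ^ i)⁻¹ : M' n ≃ₗ[k] M' n) (f n x) := by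
  apply (τ' n ^ i : M' n ≃ₗ[k] M' n).injective
  rw [← pow_comm k τ τ' hτ, ← LinearEquiv.mul_apply, ← LinearEquiv.mul_apply]
  simp

theorem face_comm {f : ∀ n, M n →ₗ[k] M' n} (hδ : ∀ n x, f n (δ n x) = δ' n (f (n + 1) x))
    (hτ : ∀ n x, f n (τ n x) = τ' n (f n x)) (n i : ℕ) (x : M (n + 1)) :
    f n (face k δ τ n i x) = face k δ' τ' n i (f (n + 1) x) := by
  simp only [face, LinearMap.comp_apply, LinearEquiv.coe_coe]
  rw [pow_comm k τ τ' hτ, hδ, inv_pow_comm k τ τ' hτ]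

theorem tMap_comm {f : ∀ n, M n →ₗ[k] M' n}
    (hτ : ∀ n x, f n (τ n x) = τ' n (f n x)) (n : ℕ) (x : M n) :
    f n (tMap k τ n x) = tMap k τ' n (f n x) := by
  simp [tMap, hτ]

theorem tMap_pow_comm {f : ∀ n, M n →ₗ[k] M' n}
    (hτ : ∀ n x, f n (τ n x) = τ' n (f n x)) (n i : ℕ) (x : M n) :
    f n ((tMap k τ n ^ i) x) = (tMap k τ' n ^ i) (f n x) := by
  induction i generalizing x with
  | zero => rfl
  | succ i ih => rw [pow_succ, pow_succ, Module.End.mul_apply, Module.End.mul_apply, ih,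
      tMap_comm k τ τ' hτ]

theorem vert_comm {f : ∀ n, M n →ₗ[k] M' n} (hδ : ∀ n x, f n (δ n x) = δ' n (f (n + 1) x))
    (hτ : ∀ n x, f n (τ n x) = τ' n (f n x)) (c q : ℕ) (x : M (q + 1)) :
    f q (vert k δ τ c q x) = vert k δ' τ' c q (f (q + 1) x) := by
  unfold vert
  split_ifs <;> simp [bMap, bMap', face_comm k δ τ δ' τ' hδ hτ]

theorem horiz_comm {f : ∀ n, M n →ₗ[k] M' n}
    (hτ : ∀ n x, f n (τ n x) = τ' n (f n x)) (c q : ℕ) (x : M q) :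
    f q (horiz k τ c q x) = horiz k τ' c q (f q x) := by
  unfold horiz
  split_ifs <;> simp [normMap, tMap_comm k τ τ' hτ, tMap_pow_comm k τ τ' hτ]

/-- The map induced on total complexes by a family of maps. -/
def totMap (m : ℕ) : Tot M m →ₗ[k] Tot M' m :=
  LinearMap.pi fun q : Fin (m + 1) => f q ∘ₗ LinearMap.proj q

theorem totMap_totD {f : ∀ n, M n →ₗ[k] M' n} (hδ : ∀ n x, f n (δ n x) = δ' n (f (n + 1) x))
    (hτ : ∀ n x, f n (τ n x) = τ' n (f n x)) (m : ℕ) (x : Tot M (m + 1)) :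
    totMap k f m (totD k δ τ m x) = totD k δ' τ' m (totMap k f (m + 1) x) := by
  ext q
  have h1 := vert_comm k δ τ δ' τ' hδ hτ (m - q) q (x q.succ)
  have h2 := horiz_comm k τ τ' hτ (m - q) q (x q.castSucc)
  simp only [totMap, totD, LinearMap.pi_apply, LinearMap.comp_apply, LinearMap.add_apply,
    LinearMap.proj_apply, map_add]
  exact congrArg₂ (· + ·) h1 h2

theorem totMap_mem_cycles {f : ∀ n, M n →ₗ[k] M' n}
    (hδ : ∀ n x, f n (δ n x) = δ' n (f (n + 1) x))
    (hτ : ∀ n x, f n (τ n x) = τ' n (f n x)) (m : ℕ) {x : Tot M m} (hx : x ∈ cycles k δ τ m) :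
    totMap k f m x ∈ cycles k δ' τ' m := by
  cases m with
  | zero => trivial
  | succ m =>
    have hx' : totD k δ τ m x = 0 := hx
    change totD k δ' τ' m _ = 0
    rw [← totMap_totD k δ τ δ' τ' hδ hτ, hx', map_zero]

/-- The map induced in homology by a morphism of cyclic modules. -/
def homologyMap (hδ : ∀ n x, f n (δ n x) = δ' n (f (n + 1) x))
    (hτ : ∀ n x, f n (τ n x) = τ' n (f n x)) (m : ℕ) :
    TotHomology k δ τ m →ₗ[k] TotHomology k δ' τ' m :=
  Submodule.mapQ _ _
    ((totMap k f m).restrict fun _ hx => totMap_mem_cycles k δ τ δ' τ' hδ hτ m hx) (by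
      rintro ⟨x, hx⟩ ⟨y, hy⟩
      exact ⟨totMap k f (m + 1) y, by rw [← totMap_totD k δ τ δ' τ' hδ hτ, hy]; rfl⟩)

/-! ### The cycle with coefficients `y_i`, `z_i` -/

/-- `y_i = (-1) ^ i (2 i)! / i!`. -/
def yCoeff (i : ℕ) : ℤ := (-1) ^ i * (((2 * i)! / i ! : ℕ) : ℤ)

/-- `z_i = (-1) ^ (i - 1) (2 i)! / (2 (i!))`, for `i ≥ 1`. -/
def zCoeff (i : ℕ) : ℤ := (-1) ^ (i - 1) * (((2 * i)! / (2 * i !) : ℕ) : ℤ)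

/-- The coefficient in row `q` of the vector `(y_p, z_p, …, y_1, z_1, y_0)`: it is `y_i` in row
`q = 2 i` and `z_i` in row `q = 2 i - 1`. -/
def sigmaCoeff (q : ℕ) : ℤ := if Even q then yCoeff (q / 2) else zCoeff ((q + 1) / 2)

theorem fact_two_mul (i : ℕ) : (2 * i)! = i ! * ((2 * i)! / i !) :=
  (Nat.mul_div_cancel' (Nat.factorial_dvd_factorial (by omega))).symm

theorem fact_two_mul_succ (i : ℕ) :
    (2 * (i + 1))! = (2 * (i + 1)!) * ((2 * i + 1) * ((2 * i)! / i !)) := by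
  have h := fact_two_mul i
  have h1 : (2 * (i + 1))! = (2 * i + 2) * ((2 * i + 1) * (2 * i)!) := rfl
  have h2 : (i + 1)! = (i + 1) * i ! := rfl
  rw [h1, h2]
  conv_lhs => rw [h]
  ring

theorem zCoeff_succ (i : ℕ) : zCoeff (i + 1) = (2 * i + 1) * yCoeff i := by
  have h3 : (2 * (i + 1))! / (2 * (i + 1)!) = (2 * i + 1) * ((2 * i)! / i !) := by
    rw [fact_two_mul_succ, Nat.mul_div_cancel_left _ (by positivity)]
  simp only [zCoeff, yCoeff, h3, Nat.add_sub_cancel]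
  push_cast
  ring

theorem yCoeff_succ (i : ℕ) : yCoeff (i + 1) = -2 * zCoeff (i + 1) := by
  have h3 : (2 * (i + 1))! / (2 * (i + 1)!) = (2 * i + 1) * ((2 * i)! / i !) := by
    rw [fact_two_mul_succ, Nat.mul_div_cancel_left _ (by positivity)]
  have h4 : (2 * (i + 1))! / (i + 1)! = 2 * ((2 * i + 1) * ((2 * i)! / i !)) := by
    rw [fact_two_mul_succ, mul_assoc, mul_left_comm, Nat.mul_div_cancel_left _ (by positivity)]
  simp only [zCoeff, yCoeff, h3, h4, Nat.add_sub_cancel]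
  push_cast
  ring

/-- The element `(y_p x_{2p}, z_p x_{2p-1}, …, z_1 x_1, y_0 x_0)` of `Tot_{2p}` (and its analogue
in odd degrees). -/
def sigmaChain (x : ∀ q, M q) (m : ℕ) : Tot M m := fun q => sigmaCoeff q • x q

theorem sigmaChain_add (x y : ∀ q, M q) (m : ℕ) :
    sigmaChain (fun q => x q + y q) m = sigmaChain x m + sigmaChain y m :=
  funext fun _ => zsmul_add _ _ _

variable (M) in
theorem sigmaChain_zero (m : ℕ) : sigmaChain (fun q => (0 : M q)) m = 0 :=
  funext fun _ => zsmul_zero _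

theorem tau_pow_fixed {x : ∀ q, M q} (hτ : ∀ q, τ q (x q) = x q) (q i : ℕ) : (τ q ^ i : M q ≃ₗ[k] M q) (x q) = x q := by
  induction i with
  | zero => rfl
  | succ i ih => rw [pow_succ, LinearEquiv.mul_apply, hτ, ih]

theorem face_fixed {x : ∀ q, M q} (hδ : ∀ q, δ q (x (q + 1)) = x q)
    (hτ : ∀ q, τ q (x q) = x q)
    (q i : ℕ) : face k δ τ q i (x (q + 1)) = x q := by
  have h : ((τ (q + 1) ^ i)⁻¹ : M (q + 1) ≃ₗ[k] M (q + 1)) (x (q + 1)) = x (q + 1) := by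
    apply (τ (q + 1) ^ i : M (q + 1) ≃ₗ[k] M (q + 1)).injective
    rw [← LinearEquiv.mul_apply, tau_pow_fixed k τ hτ]
    simp
  simp only [face, LinearMap.comp_apply, LinearEquiv.coe_coe, h, hδ]
  exact tau_pow_fixed k τ hτ q i

theorem sum_alt (n : ℕ) : ∑ i ∈ Finset.range n, (-1 : k) ^ i = if Even n then 0 else 1 := by
  induction n with
  | zero => simp
  | succ n ih =>
    rw [Finset.sum_range_succ, ih]
    by_cases h : Even n
    · simp [h, Nat.even_add_one]
    · simp [h, Nat.even_add_one, (Nat.not_even_iff_odd.1 h).neg_one_pow]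

theorem bMap_fixed {x : ∀ q, M q} (hδ : ∀ q, δ q (x (q + 1)) = x q)
    (hτ : ∀ q, τ q (x q) = x q)
    (q : ℕ) : bMap k δ τ q (x (q + 1)) = if Even q then 0 else x q := by
  simp only [bMap, LinearMap.sum_apply, LinearMap.smul_apply, face_fixed k δ τ hδ hτ]
  rw [← Finset.sum_smul, sum_alt k]
  simp only [show Even (q + 2) ↔ Even q by simp [Nat.even_add]]
  split_ifs <;> simp

theorem bMap'_fixed {x : ∀ q, M q} (hδ : ∀ q, δ q (x (q + 1)) = x q)
    (hτ : ∀ q, τ q (x q) = x q)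
    (q : ℕ) : bMap' k δ τ q (x (q + 1)) = if Even q then x q else 0 := by
  simp only [bMap', LinearMap.sum_apply, LinearMap.smul_apply, face_fixed k δ τ hδ hτ]
  rw [← Finset.sum_smul, sum_alt k]
  simp only [Nat.even_add_one]
  split_ifs <;> simp_all

theorem tMap_pow_fixed {x : ∀ q, M q} (hτ : ∀ q, τ q (x q) = x q) (q i : ℕ) : (tMap k τ q ^ i) (x q) = ((-1 : k) ^ q) ^ i • x q := by
  induction i with
  | zero => simp
  | succ i ih =>
    rw [pow_succ', Module.End.mul_apply, ih, map_smul]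
    simp only [tMap, LinearMap.smul_apply, LinearEquiv.coe_coe, hτ, smul_smul, pow_succ]

theorem normMap_fixed {x : ∀ q, M q} (hτ : ∀ q, τ q (x q) = x q) (q : ℕ) :
    normMap k τ q (x q) = if Even q then (q + 1 : ℤ) • x q else 0 := by
  simp only [normMap, LinearMap.sum_apply, tMap_pow_fixed k τ hτ]
  rw [← Finset.sum_smul]
  split_ifs with h
  · simp only [h.neg_one_pow, one_pow, Finset.sum_const, Finset.card_range, nsmul_eq_mul, mul_one]
    rw [Nat.cast_smul_eq_nsmul, ← Nat.cast_smul_eq_nsmul ℤ]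
    push_cast
    rfl
  · have : (-1 : k) ^ q = -1 := (Nat.not_even_iff_odd.1 h).neg_one_pow
    rw [this, sum_alt k]
    simp [Nat.even_add_one, h]

theorem one_sub_tMap_fixed {x : ∀ q, M q} (hτ : ∀ q, τ q (x q) = x q) (q : ℕ) :
    (1 - tMap k τ q) (x q) = if Even q then 0 else (2 : ℤ) • x q := by
  have := tMap_pow_fixed k τ hτ q 1
  rw [pow_one, pow_one] at this
  rw [LinearMap.sub_apply, this]
  split_ifs with h
  · simp [h.neg_one_pow]
  · simp [(Nat.not_even_iff_odd.1 h).neg_one_pow, two_smul]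

theorem sigma_rel {x : ∀ q, M q} (hδ : ∀ q, δ q (x (q + 1)) = x q)
    (hτ : ∀ q, τ q (x q) = x q) {c q : ℕ} (hcq : Odd (c + q)) :
    vert k δ τ c q (sigmaCoeff (q + 1) • x (q + 1)) + horiz k τ c q (sigmaCoeff q • x q) = 0 := by
  rw [map_zsmul, map_zsmul]
  by_cases h : Even q
  · have h1 : ¬ Even c := by
      intro hc
      exact absurd (hc.add h) (by simpa using hcq)
    simp only [vert, horiz, h1, if_false, LinearMap.neg_apply, bMap'_fixed k δ τ hδ hτ,
      normMap_fixed k τ hτ, h, if_true]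
    obtain ⟨i, rfl⟩ := h
    have e1 : sigmaCoeff (i + i + 1) = zCoeff (i + 1) := by
      simp only [sigmaCoeff, show ¬ Even (i + i + 1) by simp [Nat.even_add_one], if_false]
      congr 1; omega
    have e2 : sigmaCoeff (i + i) = yCoeff i := by
      simp only [sigmaCoeff, show Even (i + i) by simp, if_true]
      congr 1; omega
    rw [e1, e2, zCoeff_succ, smul_neg, smul_smul, ← neg_smul, ← add_smul]
    convert zero_smul ℤ _ using 2
    push_cast
    ring
  · have h1 : Even c := by
      by_contra hc
      exact absurd ((Nat.not_even_iff_odd.1 hc).add_odd (Nat.not_even_iff_odd.1 h))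
        (by simpa using hcq)
    simp only [vert, horiz, h1, if_true, bMap_fixed k δ τ hδ hτ,
      one_sub_tMap_fixed k τ hτ, h, if_false]
    obtain ⟨i, rfl⟩ := Nat.not_even_iff_odd.1 h
    have e1 : sigmaCoeff (2 * i + 1) = zCoeff (i + 1) := by
      simp only [sigmaCoeff, h, if_false]
      congr 1; omega
    have e2 : sigmaCoeff (2 * i + 1 + 1) = yCoeff (i + 1) := by
      simp only [sigmaCoeff, show Even (2 * i + 1 + 1) by simp [Nat.even_add_one], if_true]
      congr 1; omega
    rw [e1, e2, yCoeff_succ, smul_smul, ← add_smul]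
    convert zero_smul ℤ _ using 2
    ring

theorem sigmaChain_mem_cycles {x : ∀ q, M q} (hδ : ∀ q, δ q (x (q + 1)) = x q)
    (hτ : ∀ q, τ q (x q) = x q)
    (p : ℕ) : sigmaChain x (2 * p) ∈ cycles k δ τ (2 * p) := by
  cases p with
  | zero => trivial
  | succ p =>
    change totD k δ τ (2 * p + 1) (sigmaChain x (2 * p + 2)) = 0
    ext q
    obtain ⟨q, hq⟩ := q
    exact sigma_rel k δ τ hδ hτ (c := 2 * p + 1 - q) (by rw [Nat.sub_add_cancel (by omega)]; simp)

/-! ### The differentials anticommute, and a criterion for a cycle to be a boundary -/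

theorem tMap_pow_period (hτ : ∀ n, τ n ^ (n + 1) = 1) (n : ℕ) : tMap k τ n ^ (n + 1) = 1 := by
  have h : ∀ i, tMap k τ n ^ i = ((-1 : k) ^ n) ^ i • ((τ n ^ i : M n ≃ₗ[k] M n) : M n →ₗ[k] M n) := by
    intro i
    induction i with
    | zero => ext; simp
    | succ i ih =>
      rw [pow_succ, ih]
      ext y
      simp [tMap, pow_succ, smul_smul, mul_comm]
  rw [h, hτ, ← pow_mul, (Nat.even_mul_succ_self n).neg_one_pow]
  ext; simp

theorem one_sub_tMap_mul_normMap (hτ : ∀ n, τ n ^ (n + 1) = 1) (n : ℕ) :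
    (1 - tMap k τ n) * normMap k τ n = 0 := by
  rw [normMap, mul_neg_geom_sum, tMap_pow_period k τ hτ, sub_self]

theorem normMap_mul_one_sub_tMap (hτ : ∀ n, τ n ^ (n + 1) = 1) (n : ℕ) :
    normMap k τ n * (1 - tMap k τ n) = 0 := by
  rw [normMap, geom_sum_mul_neg, tMap_pow_period k τ hτ, sub_self]

theorem horiz_horiz (hτ : ∀ n, τ n ^ (n + 1) = 1) (c q : ℕ) (x : M q) :
    horiz k τ c q (horiz k τ (c + 1) q x) = 0 := by
  rw [← Module.End.mul_apply]
  by_cases h : Even c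
  · simp [horiz, h, Nat.even_add_one, one_sub_tMap_mul_normMap k τ hτ]
  · simp only [horiz, h, Nat.even_add_one, not_false_eq_true, if_true, if_false,
      normMap_mul_one_sub_tMap k τ hτ, LinearMap.zero_apply]

/-- The inverse of `tMap`. -/
def tInv (n : ℕ) : Module.End k (M n) := (-1 : k) ^ n • ((τ n)⁻¹ : M n ≃ₗ[k] M n).toLinearMap

theorem tInv_mul_tMap (n : ℕ) : tInv k τ n * tMap k τ n = 1 := by
  ext x
  have : ((τ n)⁻¹ : M n ≃ₗ[k] M n) (τ n x) = x := by rw [← LinearEquiv.mul_apply]; simp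
  simp [tInv, tMap, smul_smul, ← mul_pow, this]

theorem tMap_mul_tInv (n : ℕ) : tMap k τ n * tInv k τ n = 1 := by
  ext x
  simp [tInv, tMap, smul_smul, ← mul_pow]

theorem signed_face (n i : ℕ) (x : M (n + 1)) :
    (-1 : k) ^ i • face k δ τ n i x = (tMap k τ n ^ i) (δ n ((tInv k τ (n + 1) ^ i) x)) := by
  have h1 : ∀ y, (tMap k τ n ^ i) y = ((-1 : k) ^ n) ^ i • (τ n ^ i : M n ≃ₗ[k] M n) y := by
    induction i with
    | zero => intro y; simp
    | succ i ih =>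
      intro y
      rw [pow_succ, Module.End.mul_apply, ih]
      simp [tMap, pow_succ, smul_smul, mul_comm]
  have h2 : ∀ y, (tInv k τ (n + 1) ^ i) y =
      ((-1 : k) ^ (n + 1)) ^ i • ((τ (n + 1) ^ i)⁻¹ : M (n + 1) ≃ₗ[k] M (n + 1)) y := by
    simp only [← inv_pow]
    clear h1
    induction i with
    | zero => intro y; simp
    | succ i ih =>
      intro y
      rw [pow_succ, Module.End.mul_apply, ih]
      simp [tInv, pow_succ, smul_smul, mul_comm]
  rw [h1, h2, map_smul, map_smul, smul_smul]
  congr 1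
  rw [← mul_pow, ← pow_add, show n + (n + 1) = 2 * n + 1 by ring, pow_succ, pow_mul]
  simp

theorem bMap_apply (n : ℕ) (x : M (n + 1)) : bMap k δ τ n x =
    ∑ i ∈ Finset.range (n + 2), (tMap k τ n ^ i) (δ n ((tInv k τ (n + 1) ^ i) x)) := by
  simp [bMap, signed_face]

theorem bMap'_apply (n : ℕ) (x : M (n + 1)) : bMap' k δ τ n x =
    ∑ i ∈ Finset.range (n + 1), (tMap k τ n ^ i) (δ n ((tInv k τ (n + 1) ^ i) x)) := by
  simp [bMap', signed_face]

theorem tMap_mul_normMap (hτ : ∀ n, τ n ^ (n + 1) = 1) (n : ℕ) :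
    tMap k τ n * normMap k τ n = normMap k τ n := by
  have := one_sub_tMap_mul_normMap k τ hτ n
  rw [sub_mul, one_mul, sub_eq_zero] at this
  exact this.symm

theorem normMap_mul_tMap (hτ : ∀ n, τ n ^ (n + 1) = 1) (n : ℕ) :
    normMap k τ n * tMap k τ n = normMap k τ n := by
  have := normMap_mul_one_sub_tMap k τ hτ n
  rw [mul_sub, mul_one, sub_eq_zero] at this
  exact this.symm

theorem normMap_mul_tMap_pow (hτ : ∀ n, τ n ^ (n + 1) = 1) (n i : ℕ) :
    normMap k τ n * tMap k τ n ^ i = normMap k τ n := by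
  induction i with
  | zero => simp
  | succ i ih => rw [pow_succ, ← mul_assoc, ih, normMap_mul_tMap k τ hτ]

theorem tInv_pow_mul_normMap (hτ : ∀ n, τ n ^ (n + 1) = 1) (n i : ℕ) :
    tInv k τ n ^ i * normMap k τ n = normMap k τ n := by
  have h : tInv k τ n * normMap k τ n = normMap k τ n := by
    conv_lhs => rw [← tMap_mul_normMap k τ hτ, ← mul_assoc, tInv_mul_tMap, one_mul]
  induction i with
  | zero => simp
  | succ i ih => rw [pow_succ, mul_assoc, h, ih]

theorem sum_tInv (hτ : ∀ n, τ n ^ (n + 1) = 1) (n : ℕ) :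
    ∑ i ∈ Finset.range (n + 1), tInv k τ n ^ i = normMap k τ n := by
  have h : ∀ i ∈ Finset.range (n + 1),
      tMap k τ n ^ n * tInv k τ n ^ i = tMap k τ n ^ (n + 1 - 1 - i) := by
    intro i hi
    have hi' : tMap k τ n ^ n = tMap k τ n ^ (n + 1 - 1 - i) * tMap k τ n ^ i := by
      rw [← pow_add]
      congr 1
      have := Finset.mem_range.1 hi
      omega
    rw [hi', mul_assoc]
    have : tMap k τ n ^ i * tInv k τ n ^ i = 1 := by
      rw [← (show Commute (tMap k τ n) (tInv k τ n) by
        rw [Commute, SemiconjBy, tMap_mul_tInv, tInv_mul_tMap]).mul_pow, tMap_mul_tInv, one_pow]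
    rw [this, mul_one]
  have h2 : tMap k τ n ^ n * ∑ i ∈ Finset.range (n + 1), tInv k τ n ^ i = normMap k τ n := by
    rw [Finset.mul_sum, Finset.sum_congr rfl h,
      Finset.sum_range_reflect (fun i => tMap k τ n ^ i) (n + 1)]
    rfl
  have h3 := congrArg (tMap k τ n * ·) h2
  simp only [← mul_assoc, ← pow_succ', tMap_pow_period k τ hτ, one_mul,
    tMap_mul_normMap k τ hτ] at h3
  exact h3

theorem bMap_one_sub (hτ : ∀ n, τ n ^ (n + 1) = 1) (n : ℕ) (x : M (n + 1)) :
    bMap k δ τ n ((1 - tMap k τ (n + 1)) x) = (1 - tMap k τ n) (bMap' k δ τ n x) := by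
  have hS : ∀ i, (tInv k τ (n + 1) ^ (i + 1)) (tMap k τ (n + 1) x) = (tInv k τ (n + 1) ^ i) x := by
    intro i
    rw [pow_succ, ← Module.End.mul_apply, mul_assoc, tInv_mul_tMap, mul_one]
  have hlast : (tMap k τ n ^ (n + 1)) (δ n ((tInv k τ (n + 1) ^ (n + 1)) x)) =
      δ n (tMap k τ (n + 1) x) := by
    rw [tMap_pow_period k τ hτ]
    have h1 : tInv k τ (n + 1) ^ (n + 1) * (tMap k τ (n + 1) ^ (n + 1)) = 1 := by
      rw [← (show Commute (tInv k τ (n + 1)) (tMap k τ (n + 1)) by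
        rw [Commute, SemiconjBy, tMap_mul_tInv, tInv_mul_tMap]).mul_pow, tInv_mul_tMap, one_pow]
    have h2 : tInv k τ (n + 1) ^ (n + 1) = tMap k τ (n + 1) := by
      rw [← mul_one (tInv k τ (n + 1) ^ (n + 1)), ← tMap_pow_period k τ hτ (n + 1),
        pow_succ (tMap k τ (n + 1)), ← mul_assoc, h1, one_mul]
    rw [h2]; rfl
  rw [LinearMap.sub_apply, map_sub, LinearMap.sub_apply, Module.End.one_apply,
    Module.End.one_apply, bMap_apply, bMap_apply, bMap'_apply,
    Finset.sum_range_succ, hlast, Finset.sum_range_succ' (fun i => (tMap k τ n ^ i)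
      (δ n ((tInv k τ (n + 1) ^ i) (tMap k τ (n + 1) x)))), map_sum]
  simp only [hS, pow_succ' (tMap k τ n), Module.End.mul_apply, pow_zero, Module.End.one_apply]
  abel

theorem bMap'_normMap (hτ : ∀ n, τ n ^ (n + 1) = 1) (n : ℕ) (x : M (n + 1)) :
    bMap' k δ τ n (normMap k τ (n + 1) x) = normMap k τ n (bMap k δ τ n x) := by
  have h1 : ∀ i, (tInv k τ (n + 1) ^ i) (normMap k τ (n + 1) x) = normMap k τ (n + 1) x := by
    intro i
    rw [← Module.End.mul_apply, tInv_pow_mul_normMap k τ hτ]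
  have h2 : ∀ i y, normMap k τ n ((tMap k τ n ^ i) y) = normMap k τ n y := by
    intro i y
    rw [← Module.End.mul_apply, normMap_mul_tMap_pow k τ hτ]
  rw [bMap'_apply, bMap_apply, map_sum]
  simp only [h1, h2]
  rw [← map_sum, ← map_sum, ← sum_tInv k τ hτ (n + 1), LinearMap.sum_apply, normMap,
    LinearMap.sum_apply]

theorem vert_horiz (hτ : ∀ n, τ n ^ (n + 1) = 1) (c q : ℕ) (x : M (q + 1)) :
    vert k δ τ c q (horiz k τ c (q + 1) x) = - horiz k τ c q (vert k δ τ (c + 1) q x) := by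
  by_cases h : Even c
  · simp only [vert, horiz, h, Nat.even_add_one, not_true_eq_false, if_true, if_false,
      bMap_one_sub k δ τ hτ, LinearMap.neg_apply, map_neg, neg_neg]
  · simp only [vert, horiz, h, Nat.even_add_one, not_false_eq_true, if_true, if_false,
      bMap'_normMap k δ τ hτ, LinearMap.neg_apply]

/-- A contracting homotopy of the columns makes a cycle with vanishing augmentation a boundary. -/
theorem mem_range_totD (hτ : ∀ n, τ n ^ (n + 1) = 1) (s : ∀ q, M q →ₗ[k] M (q + 1))
    (hb : ∀ q x, bMap k δ τ (q + 1) (s (q + 1) x) + s q (bMap k δ τ q x) = x)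
    (hb' : ∀ q x, bMap' k δ τ (q + 1) (s (q + 1) x) + s q (bMap' k δ τ q x) = x)
    (hb0 : ∀ x, bMap' k δ τ 0 (s 0 x) = x)
    (z : ∀ q, M q) (hz0 : bMap k δ τ 0 (s 0 (z 0)) = z 0) (m : ℕ)
    (hz : ∀ q c, c + q + 1 = m → vert k δ τ c q (z (q + 1)) + horiz k τ c q (z q) = 0) :
    (fun q : Fin (m + 1) => z q : Tot M m) ∈ LinearMap.range (totD k δ τ m) := by
  let sg : ℕ → k := fun c => if Even c then 1 else -1
  have key : ∀ c q x, vert k δ τ c q x = 0 → vert k δ τ c (q + 1) (sg c • s (q + 1) x) = x := by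
    intro c q x hx
    by_cases h : Even c
    · simp only [vert, h, if_true] at hx
      simpa [sg, vert, h, hx] using hb q x
    · simp only [vert, h, if_false, LinearMap.neg_apply, neg_eq_zero] at hx
      simpa [sg, vert, h, hx] using hb' q x
  have key0 : ∀ c, vert k δ τ c 0 (sg c • s 0 (z 0)) = z 0 := by
    intro c
    by_cases h : Even c
    · simpa [sg, vert, h] using hz0
    · simpa [sg, vert, h] using hb0 (z 0)
  let y : ∀ q, M q := fun q => Nat.rec (motive := fun q => M q) 0
    (fun q yq => sg (m - q) • s q (z q - horiz k τ (m - q) q yq)) q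
  have hy0 : y 0 = 0 := rfl
  have hy : ∀ q, y (q + 1) = sg (m - q) • s q (z q - horiz k τ (m - q) q (y q)) := fun _ => rfl
  have main : ∀ q c, c + q = m →
      vert k δ τ c q (y (q + 1)) + horiz k τ c q (y q) = z q := by
    intro q
    induction q with
    | zero =>
      intro c hc
      rw [hy, hy0, map_zero, map_zero, sub_zero, add_zero, show m - 0 = c by omega]
      exact key0 c
    | succ q ih =>
      intro c hc
      have ih' := ih (c + 1) (by omega)
      rw [hy (q + 1), show m - (q + 1) = c by omega, key, sub_add_cancel]
      rw [map_sub, vert_horiz k δ τ hτ, sub_neg_eq_add, eq_sub_of_add_eq ih', map_sub,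
        horiz_horiz k τ hτ, sub_zero]
      exact hz q c (by omega)
  refine ⟨fun q => y q, ?_⟩
  ext q
  exact main q (m - q) (by omega)

end Generic

/-! ### Cyclic homology of an algebra -/

section Algebra

variable (k : Type*) [CommRing k] (A : Type*) [Ring A] [Algebra k A]

/-- The module `A ⊗ ⋯ ⊗ A` (`n + 1` factors, over `k`) of Hochschild chains of degree `n`. -/
abbrev Chains (n : ℕ) : Type _ := ⨂[k] _ : Fin (n + 1), A

/-- `a₀ ⊗ ⋯ ⊗ aₙ`. -/
abbrev pure {n : ℕ} (a : Fin (n + 1) → A) : Chains k A n := PiTensorProduct.tprod k a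

/-- The zeroth face `a₀ ⊗ a₁ ⊗ ⋯ ⊗ aₙ₊₁ ↦ a₀ a₁ ⊗ a₂ ⊗ ⋯ ⊗ aₙ₊₁`. -/
def face0 (n : ℕ) : Chains k A (n + 1) →ₗ[k] Chains k A n :=
  PiTensorProduct.lift
    { toFun := fun a => pure k A (Fin.cons (a 0 * a 1) fun j : Fin n => a j.succ.succ)
      map_update_add' := by
        intro hdec a i x y
        obtain rfl := Subsingleton.elim hdec (instDecidableEqFin (n + 2))
        refine Fin.cases ?_ (fun i => Fin.cases ?_ (fun i => ?_) i) i
        · have h1 : (1 : Fin (n + 2)) ≠ 0 := by simp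
          simp only [Function.update_self, Function.update_of_ne h1, add_mul,
            Function.update_of_ne (Fin.succ_ne_zero _), MultilinearMap.cons_add]
        · have h1 : (0 : Fin (n + 2)) ≠ 1 := by simp
          have h2 : ∀ j : Fin n, j.succ.succ ≠ (1 : Fin (n + 2)) := fun j h =>
            Fin.succ_ne_zero j (Fin.succ_injective _ h)
          simp only [Fin.succ_zero_eq_one, Function.update_self, Function.update_of_ne h1, mul_add,
            Function.update_of_ne (h2 _), MultilinearMap.cons_add]
        · have h1 : (0 : Fin (n + 2)) ≠ i.succ.succ := (Fin.succ_ne_zero _).symm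
          have h2 : (1 : Fin (n + 2)) ≠ i.succ.succ := fun h =>
            Fin.succ_ne_zero i (Fin.succ_injective _ h.symm)
          have h3 : ∀ x : A, (fun j : Fin n => Function.update a i.succ.succ x j.succ.succ) =
              Function.update (fun j : Fin n => a j.succ.succ) i x := by
            intro x; ext j
            simp [Function.update_apply]
          simp only [Function.update_of_ne h1, Function.update_of_ne h2, h3, Fin.cons_update,
            MultilinearMap.map_update_add]
      map_update_smul' := by
        intro hdec a i c x
        obtain rfl := Subsingleton.elim hdec (instDecidableEqFin (n + 2))
        refine Fin.cases ?_ (fun i => Fin.cases ?_ (fun i => ?_) i) i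
        · have h1 : (1 : Fin (n + 2)) ≠ 0 := by simp
          simp only [Function.update_self, Function.update_of_ne h1, smul_mul_assoc,
            Function.update_of_ne (Fin.succ_ne_zero _), MultilinearMap.cons_smul]
        · have h1 : (0 : Fin (n + 2)) ≠ 1 := by simp
          have h2 : ∀ j : Fin n, j.succ.succ ≠ (1 : Fin (n + 2)) := fun j h =>
            Fin.succ_ne_zero j (Fin.succ_injective _ h)
          simp only [Fin.succ_zero_eq_one, Function.update_self, Function.update_of_ne h1,
            mul_smul_comm, Function.update_of_ne (h2 _), MultilinearMap.cons_smul]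
        · have h1 : (0 : Fin (n + 2)) ≠ i.succ.succ := (Fin.succ_ne_zero _).symm
          have h2 : (1 : Fin (n + 2)) ≠ i.succ.succ := fun h =>
            Fin.succ_ne_zero i (Fin.succ_injective _ h.symm)
          have h3 : ∀ x : A, (fun j : Fin n => Function.update a i.succ.succ x j.succ.succ) =
              Function.update (fun j : Fin n => a j.succ.succ) i x := by
            intro x; ext j
            simp [Function.update_apply]
          simp only [Function.update_of_ne h1, Function.update_of_ne h2, h3, Fin.cons_update,
            MultilinearMap.map_update_smul] }

/-- The unsigned cyclic operator `a₀ ⊗ ⋯ ⊗ aₙ ↦ aₙ ⊗ a₀ ⊗ ⋯ ⊗ aₙ₋₁`. -/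
def rot (n : ℕ) : Chains k A n ≃ₗ[k] Chains k A n :=
  PiTensorProduct.reindex k (fun _ => A) (Equiv.addRight (1 : Fin (n + 1)))

variable {A}

theorem face0_pure {n : ℕ} (a : Fin (n + 2) → A) : face0 k A n (pure k A a) =
    pure k A (Fin.cons (a 0 * a 1) fun j : Fin n => a j.succ.succ) := by
  rw [face0, pure, PiTensorProduct.lift.tprod]
  rfl

theorem rot_pure {n : ℕ} (a : Fin (n + 1) → A) :
    rot k A n (pure k A a) = pure k A fun j => a (j - 1) := by
  rw [rot, pure, PiTensorProduct.reindex_tprod]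
  simp [sub_eq_add_neg]

theorem rot_pow_pure {n : ℕ} (a : Fin (n + 1) → A) (i : ℕ) :
    (rot k A n ^ i : Chains k A n ≃ₗ[k] Chains k A n) (pure k A a) =
      pure k A fun j => a (j - Fin.ofNat (n + 1) i) := by
  induction i generalizing a with
  | zero =>
    simp
  | succ i ih =>
    rw [pow_succ, LinearEquiv.mul_apply, rot_pure, ih]
    have h : Fin.ofNat (n + 1) (i + 1) = Fin.ofNat (n + 1) i + 1 := by
      ext; simp [Fin.val_add]
    simp only [h, sub_sub]

theorem rot_inv_pow_pure {n : ℕ} (a : Fin (n + 1) → A) (i : ℕ) :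
    ((rot k A n ^ i)⁻¹ : Chains k A n ≃ₗ[k] Chains k A n) (pure k A a) =
      pure k A fun j => a (j + Fin.ofNat (n + 1) i) := by
  apply (rot k A n ^ i : Chains k A n ≃ₗ[k] Chains k A n).injective
  rw [← LinearEquiv.mul_apply, rot_pow_pure]
  simp

/-- The faces `d₀, …, dₙ` are `dᵢ (a₀ ⊗ ⋯ ⊗ aₙ₊₁) = a₀ ⊗ ⋯ ⊗ aᵢ aᵢ₊₁ ⊗ ⋯ ⊗ aₙ₊₁`. -/
theorem face_pure {n : ℕ} (a : Fin (n + 2) → A) (i : Fin (n + 1)) :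
    face k (face0 k A) (rot k A) n i (pure k A a) =
      pure k A fun j => if j < i then a j.castSucc else if j = i then a i.castSucc * a i.succ
        else a j.succ := by
  simp only [face, LinearMap.comp_apply, LinearEquiv.coe_coe, rot_inv_pow_pure, face0_pure,
    rot_pow_pure]
  congr 1; ext j
  have hsub : j - Fin.ofNat (n + 1) i = j - i := by simp
  rw [hsub]
  have hval : ((j - i : Fin (n + 1)) : ℕ) = if i ≤ j then (j : ℕ) - i else n + 1 + j - i := by
    split_ifs with h
    · exact Fin.sub_val_of_le h
    · rw [Fin.val_sub, Nat.mod_eq_of_lt] <;> omega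
  rcases Fin.eq_zero_or_eq_succ (j - i) with h0 | ⟨l, hl⟩
  · have hji : j = i := sub_eq_zero.1 h0
    subst hji
    rw [h0]
    simp only [Fin.cons_zero, lt_irrefl, if_false, if_true]
    congr 2
    · ext; simp
    · ext
      simp only [Fin.val_add, Fin.val_ofNat, Fin.val_succ, Fin.val_one]
      rw [Nat.add_mod_mod, Nat.mod_eq_of_lt (by omega)]
      omega
  · rw [hl, Fin.cons_succ]
    have hv : (l : ℕ) + 1 = if i ≤ j then (j : ℕ) - i else n + 1 + j - i := by
      rw [← hval, hl]; simp
    split_ifs with h1 h2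
    · congr 1; ext
      rw [if_neg (by simpa using h1)] at hv
      have h3 : (l : ℕ) + 1 + 1 + i = j + (n + 2) := by omega
      simp only [Fin.val_add, Fin.val_ofNat, Fin.val_succ, Fin.val_castSucc]
      rw [Nat.add_mod_mod, h3, Nat.add_mod_right, Nat.mod_eq_of_lt (by omega)]
    · subst h2
      simp at hl
      exact absurd hl.symm (Fin.succ_ne_zero l)
    · congr 1; ext
      rw [if_pos (by simpa using h1)] at hv
      have h4 : i ≤ j := by simpa using h1
      have h3 : (l : ℕ) + 1 + 1 + i = j + 1 := by omega
      simp only [Fin.val_add, Fin.val_ofNat, Fin.val_succ]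
      rw [Nat.add_mod_mod, h3, Nat.mod_eq_of_lt (by omega)]

/-- The last face is `dₙ₊₁ (a₀ ⊗ ⋯ ⊗ aₙ₊₁) = aₙ₊₁ a₀ ⊗ a₁ ⊗ ⋯ ⊗ aₙ`. -/
theorem face_last_pure {n : ℕ} (a : Fin (n + 2) → A) :
    face k (face0 k A) (rot k A) n (n + 1) (pure k A a) =
      pure k A (Fin.cons (a (Fin.last _) * a 0) fun j : Fin n => a j.succ.castSucc) := by
  simp only [face, LinearMap.comp_apply, LinearEquiv.coe_coe, rot_inv_pow_pure, face0_pure,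
    rot_pow_pure]
  congr 1; ext j
  have h0 : Fin.ofNat (n + 1) (n + 1) = 0 := by ext; simp
  have h1 : Fin.ofNat (n + 2) (n + 1) = Fin.last (n + 1) := by ext; simp
  have h2 : (1 : Fin (n + 2)) + Fin.last (n + 1) = 0 := by
    ext; simp [Fin.val_add, show 1 + (n + 1) = n + 2 by ring]
  have h3 : ∀ j : Fin n, j.succ.succ + Fin.last (n + 1) = j.succ.castSucc := by
    intro j
    ext
    simp only [Fin.val_add, Fin.val_succ, Fin.val_last, Fin.val_castSucc]
    rw [show (j : ℕ) + 1 + 1 + (n + 1) = (j + 1) + (n + 2) by ring, Nat.add_mod_right,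
      Nat.mod_eq_of_lt (by omega)]
  rw [h0, h1, sub_zero, zero_add, h2]
  simp only [h3]

variable (A)

/-- The cyclic homology `HC_m(A)` of the `k`-algebra `A`: the homology in degree `m` of the total
complex of the cyclic bicomplex `CC(A)`. -/
abbrev HC (m : ℕ) : Type _ := TotHomology k (face0 k A) (rot k A) m

/-- The cycles of degree `m` in `Tot CC(A)`. -/
abbrev HCCycles (m : ℕ) : Submodule k (Tot (Chains k A) m) := cycles k (face0 k A) (rot k A) m

variable {A}

/-- The chain `σ^p(e, …, e) = (y_p e ⊗ ⋯ ⊗ e, z_p e ⊗ ⋯ ⊗ e, …, z_1 e ⊗ e, y_0 e)` in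
`(Tot CC(A))_{2p}`. -/
def sigma (p : ℕ) (e : A) : Tot (Chains k A) (2 * p) :=
  sigmaChain (fun _ => pure k A fun _ => e) (2 * p)

theorem face0_const {e : A} (he : IsIdempotentElem e) (q : ℕ) :
    face0 k A q (pure k A fun _ => e) = pure k A fun _ => e := by
  rw [face0_pure, he.eq]
  congr 1; ext j
  exact Fin.cases rfl (fun _ => rfl) j

theorem rot_const (e : A) (q : ℕ) : rot k A q (pure k A fun _ => e) = pure k A fun _ => e :=
  rot_pure k _

theorem sigma_mem_cycles (p : ℕ) {e : A} (he : IsIdempotentElem e) :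
    sigma k p e ∈ HCCycles k A (2 * p) :=
  sigmaChain_mem_cycles k _ _ (face0_const k he) (rot_const k e) p

/-- The class of the cycle `σ^p(e, …, e)` in `HC_{2p}(A)`, for an idempotent `e` of `A`. -/
def sigmaClass (p : ℕ) (e : A) (he : IsIdempotentElem e) : HC k A (2 * p) :=
  Submodule.Quotient.mk ⟨sigma k p e, sigma_mem_cycles k p he⟩

theorem rot_period (n : ℕ) : rot k A n ^ (n + 1) = 1 := by
  apply LinearEquiv.toLinearMap_injective
  refine PiTensorProduct.ext (MultilinearMap.ext fun a => ?_)
  refine (rot_pow_pure k a (n + 1)).trans ?_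
  rw [show Fin.ofNat (n + 1) (n + 1) = 0 by ext; simp]
  simp only [sub_zero]
  rfl

end Algebra

/-! ### The generalized trace and the Chern character of an idempotent matrix -/

section Trace

variable (k : Type*) [CommRing k] {A : Type*} [Ring A] [Algebra k A]
  {ι : Type*} [Fintype ι] [DecidableEq ι]

/-- The generalized trace
`M₀ ⊗ ⋯ ⊗ Mₙ ↦ ∑ (M₀)_{sₙ s₀} ⊗ (M₁)_{s₀ s₁} ⊗ ⋯ ⊗ (Mₙ)_{sₙ₋₁ sₙ}`, where the sum is over all
families of indices `s₀, …, sₙ` (and `0 - 1 = n` in `Fin (n + 1)`). -/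
def trace (n : ℕ) : Chains k (Matrix ι ι A) n →ₗ[k] Chains k A n :=
  PiTensorProduct.lift <| ∑ s : Fin (n + 1) → ι,
    (PiTensorProduct.tprod k).compLinearMap fun j => Matrix.entryLinearMap k A (s (j - 1)) (s j)

theorem trace_pure {n : ℕ} (m : Fin (n + 1) → Matrix ι ι A) :
    trace k n (pure k _ m) = ∑ s : Fin (n + 1) → ι, pure k A fun j => m j (s (j - 1)) (s j) := by
  rw [trace, pure, PiTensorProduct.lift.tprod, sum_apply]
  rfl

theorem trace_rot (n : ℕ) (x : Chains k (Matrix ι ι A) n) :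
    trace k n (rot k _ n x) = rot k A n (trace k n x) := by
  have h : trace k n ∘ₗ (rot k (Matrix ι ι A) n).toLinearMap =
      (rot k A n).toLinearMap ∘ₗ trace k n := by
    refine PiTensorProduct.ext (MultilinearMap.ext fun m => ?_)
    change trace k n (rot k _ n (pure k _ m)) = rot k A n (trace k n (pure k _ m))
    rw [rot_pure, trace_pure, trace_pure, map_sum]
    refine Fintype.sum_equiv (Equiv.arrowCongr (Equiv.subRight (1 : Fin (n + 1))) (Equiv.refl ι))
      _ _ fun s => ?_
    rw [rot_pure]
    simp [Equiv.arrowCongr]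
  exact LinearMap.congr_fun h x

theorem pure_cons_sum {n : ℕ} {κ : Type*} (t : Finset κ) (g : κ → A) (v : Fin n → A) :
    pure k A (Fin.cons (∑ x ∈ t, g x) v) = ∑ x ∈ t, pure k A (Fin.cons (g x) v) := by
  have h : ∀ c : A, (Fin.cons c v : Fin (n + 1) → A) =
      Function.update (Fin.cons 0 v : Fin (n + 1) → A) 0 c := by simp
  rw [h, pure, MultilinearMap.map_update_sum]
  exact Finset.sum_congr rfl fun x _ => by rw [← h]

theorem trace_face0 (n : ℕ) (x : Chains k (Matrix ι ι A) (n + 1)) :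
    trace k n (face0 k _ n x) = face0 k A n (trace k (n + 1) x) := by
  have h : trace k n ∘ₗ face0 k (Matrix ι ι A) n = face0 k A n ∘ₗ trace k (n + 1) := by
    refine PiTensorProduct.ext (MultilinearMap.ext fun m => ?_)
    change trace k n (face0 k _ n (pure k _ m)) = face0 k A n (trace k (n + 1) (pure k _ m))
    rw [face0_pure, trace_pure, trace_pure, map_sum,
      ← (Fin.consEquiv fun _ : Fin (n + 2) => ι).sum_comp, Fintype.sum_prod_type, Finset.sum_comm]
    refine Finset.sum_congr rfl fun r _ => ?_
    have h1 : (fun j => (Fin.cons (m 0 * m 1) (fun j : Fin n => m j.succ.succ) :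
          Fin (n + 1) → Matrix ι ι A) j (r (j - 1)) (r j)) =
        Fin.cons (∑ x, m 0 (r (Fin.last n)) x * m 1 x (r 0))
          fun j : Fin n => m j.succ.succ (r j.castSucc) (r j.succ) := by
      ext j
      refine Fin.cases ?_ (fun j => ?_) j
      · have : (0 - 1 : Fin (n + 1)) = Fin.last n := by
          rw [sub_eq_iff_eq_add]; simp
        rw [Fin.cons_zero, Fin.cons_zero, this, Matrix.mul_apply]
      · have : (j.succ - 1 : Fin (n + 1)) = j.castSucc := by
          rw [sub_eq_iff_eq_add]; simp
        rw [Fin.cons_succ, Fin.cons_succ, this]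
    rw [h1, pure_cons_sum]
    refine Finset.sum_congr rfl fun x _ => ?_
    rw [face0_pure]
    congr 1
    have h2 : (0 - 1 : Fin (n + 2)) = (Fin.last n).succ := by
      rw [sub_eq_iff_eq_add]; simp
    have h3 : (1 : Fin (n + 2)) = (0 : Fin (n + 1)).succ := by simp
    have h4 : ∀ j : Fin n, (j.succ.succ - 1 : Fin (n + 2)) = j.castSucc.succ := by
      intro j; rw [sub_eq_iff_eq_add]; exact (Fin.coeSucc_eq_succ (a := j.succ)).symm
    simp only [Fin.consEquiv_apply, h2, h4, sub_self, Fin.cons_succ, Fin.cons_zero]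
    rw [h3, Fin.cons_succ]
  exact LinearMap.congr_fun h x

/-- The map `HC_m(M_ι(A)) → HC_m(A)` induced by the generalized trace. -/
def traceHC (m : ℕ) : HC k (Matrix ι ι A) m →ₗ[k] HC k A m :=
  homologyMap k _ _ _ _ (trace k) (trace_face0 k) (trace_rot k) m

/-- The Chern character `tr (c(e)) ∈ HC_{2p}(A)` of an idempotent matrix `e`, where
`c(e) = (y_p e ⊗ ⋯ ⊗ e, z_p e ⊗ ⋯ ⊗ e, …, z_1 e ⊗ e, y_0 e)`. -/
def chernIdem (p : ℕ) (e : Matrix ι ι A) (he : IsIdempotentElem e) : HC k A (2 * p) :=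
  traceHC (ι := ι) (A := A) k (2 * p) (sigmaClass k p e he)

theorem chernIdem_eq (p : ℕ) (e : Matrix ι ι A) (he : IsIdempotentElem e) :
    ∃ h, chernIdem k p e he = Submodule.Quotient.mk
      ⟨sigmaChain (fun q => trace k q (pure k _ fun _ => e)) (2 * p), h⟩ := by
  have h1 : totMap k (trace k) (2 * p) (sigma k p e) =
      sigmaChain (fun q => trace k q (pure k _ fun _ => e)) (2 * p) := by
    ext q
    change trace k (q : ℕ) (sigmaCoeff q • pure k _ fun _ => e) = sigmaCoeff q • _
    rw [map_zsmul]
  have h2 : sigmaChain (fun q => trace k q (pure k _ fun _ => e)) (2 * p) ∈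
      HCCycles k A (2 * p) := by
    rw [← h1]
    exact totMap_mem_cycles k _ _ _ _ (trace_face0 k) (trace_rot k) _ (sigma_mem_cycles k p he)
  exact ⟨h2, congrArg (Submodule.Quotient.mk (p := (LinearMap.range (totD k (face0 k A) (rot k A) (2 * p))).submoduleOf
    (HCCycles k A (2 * p))))
    (Subtype.ext h1)⟩

end Trace

/-! ### Invariance of the Chern character of idempotents -/

section Invariance

variable (k : Type*) [CommRing k]

/-- The free module on the functions `Fin (n + 1) → Bool`. -/
abbrev FreeChains (n : ℕ) : Type _ := (Fin (n + 1) → Bool) →₀ k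

/-- Forgetting the zeroth entry. -/
def freeFace0 (n : ℕ) : FreeChains k (n + 1) →ₗ[k] FreeChains k n :=
  Finsupp.lmapDomain k k fun w j => w j.succ

/-- Rotation of the entries. -/
def freeRot (n : ℕ) : FreeChains k n ≃ₗ[k] FreeChains k n :=
  Finsupp.domLCongr (Equiv.arrowCongr (Equiv.addRight (1 : Fin (n + 1))) (Equiv.refl Bool))

/-- Insertion of a zeroth entry. -/
def freeCons (n : ℕ) : FreeChains k n →ₗ[k] FreeChains k (n + 1) :=
  Finsupp.lmapDomain k k fun w => Fin.cons true w

theorem freeFace0_single {n : ℕ} (w : Fin (n + 2) → Bool) (c : k) :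
    freeFace0 k n (Finsupp.single w c) = Finsupp.single (fun j => w j.succ) c := by
  simp [freeFace0]

theorem freeCons_single {n : ℕ} (w : Fin (n + 1) → Bool) (c : k) :
    freeCons k n (Finsupp.single w c) = Finsupp.single (Fin.cons true w) c := by
  simp [freeCons]

theorem freeRot_single {n : ℕ} (w : Fin (n + 1) → Bool) (c : k) :
    freeRot k n (Finsupp.single w c) = Finsupp.single (fun j => w (j - 1)) c := by
  simp only [freeRot, Finsupp.domLCongr_single]
  congr 1
  ext j
  simp [Equiv.arrowCongr, sub_eq_add_neg]

theorem freeRot_pow_single {n : ℕ} (w : Fin (n + 1) → Bool) (c : k) (i : ℕ) :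
    (freeRot k n ^ i : FreeChains k n ≃ₗ[k] FreeChains k n) (Finsupp.single w c) =
      Finsupp.single (fun j => w (j - Fin.ofNat (n + 1) i)) c := by
  induction i generalizing w with
  | zero => simp
  | succ i ih =>
    rw [pow_succ, LinearEquiv.mul_apply, freeRot_single, ih]
    have h : Fin.ofNat (n + 1) (i + 1) = Fin.ofNat (n + 1) i + 1 := by
      ext; simp [Fin.val_add]
    simp only [h, sub_sub]

theorem freeRot_inv_pow_single {n : ℕ} (w : Fin (n + 1) → Bool) (c : k) (i : ℕ) :
    ((freeRot k n ^ i)⁻¹ : FreeChains k n ≃ₗ[k] FreeChains k n) (Finsupp.single w c) =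
      Finsupp.single (fun j => w (j + Fin.ofNat (n + 1) i)) c := by
  apply (freeRot k n ^ i : FreeChains k n ≃ₗ[k] FreeChains k n).injective
  rw [← LinearEquiv.mul_apply, freeRot_pow_single]
  simp

theorem freeRot_period (n : ℕ) : freeRot k n ^ (n + 1) = 1 := by
  apply LinearEquiv.toLinearMap_injective
  refine Finsupp.lhom_ext fun w c => ?_
  refine (freeRot_pow_single k w c (n + 1)).trans ?_
  rw [show Fin.ofNat (n + 1) (n + 1) = 0 by ext; simp]
  simp only [sub_zero]
  rfl

theorem freeFace_single {n : ℕ} (w : Fin (n + 2) → Bool) (c : k) (i : Fin (n + 2)) :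
    face k (freeFace0 k) (freeRot k) n i (Finsupp.single w c) =
      Finsupp.single (fun j => w (i.succAbove j)) c := by
  simp only [face, LinearMap.comp_apply, LinearEquiv.coe_coe, freeRot_inv_pow_single,
    freeFace0_single, freeRot_pow_single]
  congr 1; ext j
  congr 1; ext
  have hj := j.isLt
  have hi := i.isLt
  simp only [Fin.val_add, Fin.val_ofNat, Fin.val_succ, Fin.val_sub, Fin.succAbove,
    Fin.lt_def, Fin.val_castSucc]
  rw [Nat.add_mod_mod]
  rcases Nat.lt_or_ge i (n + 1) with h | h
  · rw [Nat.mod_eq_of_lt h]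
    split_ifs with h1
    · rw [Nat.mod_eq_of_lt (show n + 1 - (i : ℕ) + j < n + 1 by omega),
        show n + 1 - (i : ℕ) + j + 1 + i = j + (n + 2) by omega, Nat.add_mod_right,
        Nat.mod_eq_of_lt (by omega)]
      rfl
    · rw [show n + 1 - (i : ℕ) + j = (j - i) + (n + 1) by omega, Nat.add_mod_right,
        Nat.mod_eq_of_lt (show (j : ℕ) - i < n + 1 by omega),
        Nat.mod_eq_of_lt (show (j : ℕ) - i + 1 + i < n + 2 by omega), Fin.val_succ]
      omega
  · have hi' : (i : ℕ) = n + 1 := by omega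
    rw [hi', Nat.mod_self, if_pos (by omega), Nat.sub_zero, Nat.add_mod_left,
      Nat.mod_eq_of_lt hj, show (j : ℕ) + 1 + (n + 1) = j + (n + 2) by ring, Nat.add_mod_right,
      Nat.mod_eq_of_lt (by omega)]
    rfl

theorem freeFace_zero_cons (n : ℕ) (x : FreeChains k n) :
    face k (freeFace0 k) (freeRot k) n 0 (freeCons k n x) = x := by
  have h : face k (freeFace0 k) (freeRot k) n 0 ∘ₗ freeCons k n = LinearMap.id := by
    refine Finsupp.lhom_ext fun w c => ?_
    have := freeFace_single k (Fin.cons true w : Fin (n + 2) → Bool) c 0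
    simp only [LinearMap.comp_apply, freeCons_single, LinearMap.id_apply]
    simpa using this
  exact LinearMap.congr_fun h x

theorem freeFace_succ_cons (n i : ℕ) (hi : i < n + 2) (x : FreeChains k (n + 1)) :
    face k (freeFace0 k) (freeRot k) (n + 1) (i + 1) (freeCons k (n + 1) x) =
      freeCons k n (face k (freeFace0 k) (freeRot k) n i x) := by
  have h : face k (freeFace0 k) (freeRot k) (n + 1) (i + 1) ∘ₗ freeCons k (n + 1) =
      freeCons k n ∘ₗ face k (freeFace0 k) (freeRot k) n i := by
    refine Finsupp.lhom_ext fun w c => ?_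
    have h1 := freeFace_single k (Fin.cons true w : Fin (n + 3) → Bool) c (Fin.succ ⟨i, hi⟩)
    have h2 := freeFace_single k w c ⟨i, hi⟩
    simp only [LinearMap.comp_apply, freeCons_single]
    refine h1.trans ?_
    refine Eq.trans ?_ (congrArg (freeCons k n) h2).symm
    rw [freeCons_single]
    congr 1; ext j
    refine Fin.cases ?_ (fun j => ?_) j
    · simp
    · rw [Fin.succ_succAbove_succ, Fin.cons_succ, Fin.cons_succ]
  exact LinearMap.congr_fun h x

theorem freeCons_b (q : ℕ) (x : FreeChains k (q + 1)) :
    bMap k (freeFace0 k) (freeRot k) (q + 1) (freeCons k (q + 1) x) +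
      freeCons k q (bMap k (freeFace0 k) (freeRot k) q x) = x := by
  simp only [bMap, LinearMap.sum_apply, LinearMap.smul_apply, map_sum, map_smul]
  rw [Finset.sum_range_succ', freeFace_zero_cons, pow_zero, one_smul, add_right_comm,
    ← Finset.sum_add_distrib, Finset.sum_eq_zero, zero_add]
  intro i hi
  rw [freeFace_succ_cons k q i (Finset.mem_range.1 hi), pow_succ]
  simp

theorem freeCons_b' (q : ℕ) (x : FreeChains k (q + 1)) :
    bMap' k (freeFace0 k) (freeRot k) (q + 1) (freeCons k (q + 1) x) +
      freeCons k q (bMap' k (freeFace0 k) (freeRot k) q x) = x := by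
  simp only [bMap', LinearMap.sum_apply, LinearMap.smul_apply, map_sum, map_smul]
  rw [Finset.sum_range_succ', freeFace_zero_cons, pow_zero, one_smul, add_right_comm,
    ← Finset.sum_add_distrib, Finset.sum_eq_zero, zero_add]
  intro i hi
  rw [freeFace_succ_cons k q i ((Finset.mem_range.1 hi).trans (by omega)), pow_succ]
  simp

theorem freeCons_b'_zero (x : FreeChains k 0) :
    bMap' k (freeFace0 k) (freeRot k) 0 (freeCons k 0 x) = x := by
  simp [bMap', freeFace_zero_cons]

variable {A : Type*} [Ring A] [Algebra k A]

/-- The map `w ↦ g_{wₙ w₀} ⊗ g_{w₀ w₁} ⊗ ⋯ ⊗ g_{wₙ₋₁ wₙ}`. -/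
def freeMap (g : Bool → Bool → A) (n : ℕ) : FreeChains k n →ₗ[k] Chains k A n :=
  Finsupp.linearCombination k fun w => pure k A fun j => g (w (j - 1)) (w j)

theorem freeMap_single (g : Bool → Bool → A) {n : ℕ} (w : Fin (n + 1) → Bool) (c : k) :
    freeMap k g n (Finsupp.single w c) = c • pure k A fun j => g (w (j - 1)) (w j) := by
  simp [freeMap]

theorem freeMap_rot (g : Bool → Bool → A) (n : ℕ) (x : FreeChains k n) :
    freeMap k g n (freeRot k n x) = rot k A n (freeMap k g n x) := by
  have h : freeMap k g n ∘ₗ (freeRot k n).toLinearMap =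
      (rot k A n).toLinearMap ∘ₗ freeMap k g n := by
    refine Finsupp.lhom_ext fun w c => ?_
    simp only [LinearMap.comp_apply, LinearEquiv.coe_coe, freeRot_single, freeMap_single, map_smul,
      rot_pure]
  exact LinearMap.congr_fun h x

theorem freeMap_face0 {g : Bool → Bool → A} (hg : ∀ x y z, g x y * g y z = g x z) (n : ℕ)
    (x : FreeChains k (n + 1)) :
    freeMap k g n (freeFace0 k n x) = face0 k A n (freeMap k g (n + 1) x) := by
  have h : freeMap k g n ∘ₗ freeFace0 k n = face0 k A n ∘ₗ freeMap k g (n + 1) := by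
    refine Finsupp.lhom_ext fun w c => ?_
    simp only [LinearMap.comp_apply, freeFace0_single, freeMap_single, map_smul, face0_pure]
    congr 2; ext j
    have h2 : (0 - 1 : Fin (n + 2)) = (Fin.last n).succ := by
      rw [sub_eq_iff_eq_add]; simp
    refine Fin.cases ?_ (fun j => ?_) j
    · have h1 : (0 - 1 : Fin (n + 1)) = Fin.last n := by
        rw [sub_eq_iff_eq_add]; simp
      rw [Fin.cons_zero, sub_self, hg, h1, h2]
      simp
    · have h1 : (j.succ - 1 : Fin (n + 1)) = j.castSucc := by
        rw [sub_eq_iff_eq_add]; simp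
      have h4 : (j.succ.succ - 1 : Fin (n + 2)) = j.castSucc.succ := by
        rw [sub_eq_iff_eq_add]; exact (Fin.coeSucc_eq_succ (a := j.succ)).symm
      rw [Fin.cons_succ, h1, h4]
  exact LinearMap.congr_fun h x

theorem sigmaClass_eq {g : Bool → Bool → A} (hg : ∀ x y z, g x y * g y z = g x z) (p : ℕ) {e f : A}
    (he : IsIdempotentElem e) (hf : IsIdempotentElem f) (hge : g true true = e)
    (hgf : g false false = f) : sigmaClass k p e he = sigmaClass k p f hf := by
  let x : Bool → ∀ q, FreeChains k q := fun o q => Finsupp.single (fun _ => o) 1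
  have hxδ : ∀ o q, freeFace0 k q (x o (q + 1)) = x o q := fun o q => freeFace0_single k _ _
  have hxτ : ∀ o q, freeRot k q (x o q) = x o q := fun o q => freeRot_single k _ _
  let z : ∀ q, FreeChains k q := fun q => sigmaCoeff q • x true q - sigmaCoeff q • x false q
  obtain ⟨y, hy⟩ := mem_range_totD k (freeFace0 k) (freeRot k) (freeRot_period k) (freeCons k)
    (freeCons_b k) (freeCons_b' k) (freeCons_b'_zero k) z (by
      have h1 : ∀ o, face k (freeFace0 k) (freeRot k) 0 1 (freeCons k 0 (x o 0)) = x true 0 := by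
        intro o
        have := freeFace_single k (Fin.cons true (fun _ => o) : Fin 2 → Bool) 1 1
        rw [freeCons_single]
        refine this.trans ?_
        congr 1; ext j
        obtain rfl : j = 0 := Subsingleton.elim (α := Fin 1) _ _
        simp
      simp only [bMap, LinearMap.sum_apply, LinearMap.smul_apply]
      rw [Finset.sum_range_succ, Finset.sum_range_one, freeFace_zero_cons]
      simp only [z, map_sub, map_zsmul, h1]
      simp) (2 * p) (by
      intro q c hc
      have hodd : Odd (c + q) := by
        by_contra h
        rw [Nat.not_odd_iff_even] at h
        exact absurd (show Even (c + q + 1) by rw [hc]; simp) (by simp [Nat.even_add_one, h])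
      simp only [z, map_sub]
      rw [sub_add_sub_comm, sigma_rel k _ _ (hxδ true) (hxτ true) hodd,
        sigma_rel k _ _ (hxδ false) (hxτ false) hodd, sub_zero])
  refine (Submodule.Quotient.eq _).2 ?_
  refine ⟨totMap k (freeMap k g) (2 * p + 1) y, ?_⟩
  rw [← totMap_totD k _ _ _ _ (freeMap_face0 k hg) (freeMap_rot k g), hy]
  ext q
  change freeMap k g q (z q) = sigmaCoeff q • pure k A (fun _ => e) -
    sigmaCoeff q • pure k A fun _ => f
  simp only [z, x, map_sub, map_zsmul, freeMap_single, one_smul, hge, hgf]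

/-! ### Block matrices -/

variable {ι κ : Type*} [Fintype ι] [DecidableEq ι] [Fintype κ] [DecidableEq κ]

theorem trace_fromBlocks (e : Matrix ι ι A) (f : Matrix κ κ A) (q : ℕ) :
    trace k q (pure k _ fun _ => Matrix.fromBlocks e 0 0 f) =
      trace k q (pure k _ fun _ => e) + trace k q (pure k _ fun _ => f) := by
  simp only [trace_pure]
  symm
  refine (Fintype.sum_sum_type (Sum.elim
    (fun s : Fin (q + 1) → ι => pure k A fun j => e (s (j - 1)) (s j))
    (fun s : Fin (q + 1) → κ => pure k A fun j => f (s (j - 1)) (s j)))).symm.trans ?_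
  refine Finset.sum_of_injOn
    (Sum.elim (fun s j => Sum.inl (s j)) fun s j => Sum.inr (s j)) ?_ (by simp) ?_ ?_
  · rintro (s | s) - (s' | s') - h
    · exact congrArg Sum.inl (funext fun j => Sum.inl_injective (congrFun h j))
    · exact absurd (congrFun h 0) (by simp)
    · exact absurd (congrFun h 0) (by simp)
    · exact congrArg Sum.inr (funext fun j => Sum.inr_injective (congrFun h j))
  · intro s _ hs
    by_cases hc : ∀ j, (s (j - 1)).isLeft = (s j).isLeft
    · exfalso
      have hall : ∀ j, (s j).isLeft = (s 0).isLeft := by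
        intro j
        induction j using Fin.induction with
        | zero => rfl
        | succ j ih =>
          rw [← hc, ← ih]
          congr 2
          rw [sub_eq_iff_eq_add]; simp
      apply hs
      cases h0 : (s 0).isLeft with
      | true =>
        have hl : ∀ j, ∃ a, s j = Sum.inl a := fun j => Sum.isLeft_iff.1 ((hall j).trans h0)
        choose a ha using hl
        exact ⟨Sum.inl a, by simp, by ext j; simp [ha]⟩
      | false =>
        have hl : ∀ j, ∃ a, s j = Sum.inr a := fun j =>
          Sum.isRight_iff.1 (by rw [← Sum.not_isLeft, hall j, h0]; simp)
        choose a ha using hl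
        exact ⟨Sum.inr a, by simp, by ext j; simp [ha]⟩
    · push Not at hc
      obtain ⟨j, hj⟩ := hc
      refine MultilinearMap.map_coord_zero _ j ?_
      rcases h1 : s (j - 1) with a | a <;> rcases h2 : s j with b | b <;>
        simp_all
  · rintro (s | s) - <;> rfl

theorem isIdempotentElem_fromBlocks {α β : Type*} [Fintype α] [Fintype β] {e : Matrix α α A}
    {f : Matrix β β A}
    (he : IsIdempotentElem e) (hf : IsIdempotentElem f) :
    IsIdempotentElem (Matrix.fromBlocks e 0 0 f) := by
  simp [IsIdempotentElem, Matrix.fromBlocks_multiply, he.eq, hf.eq]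

theorem chernIdem_fromBlocks (p : ℕ) {e : Matrix ι ι A} {f : Matrix κ κ A}
    (he : IsIdempotentElem e) (hf : IsIdempotentElem f)
    (h : IsIdempotentElem (Matrix.fromBlocks e 0 0 f)) :
    chernIdem k p (Matrix.fromBlocks e 0 0 f) h = chernIdem k p e he + chernIdem k p f hf := by
  obtain ⟨h1, e1⟩ := chernIdem_eq k p _ h
  obtain ⟨h2, e2⟩ := chernIdem_eq k p _ he
  obtain ⟨h3, e3⟩ := chernIdem_eq k p _ hf
  rw [e1, e2, e3, ← Submodule.Quotient.mk_add]
  congr 1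
  apply Subtype.ext
  refine Eq.trans ?_ (sigmaChain_add (M := Chains k A) (fun q => trace k q (pure k _ fun _ => e))
    (fun q => trace k q (pure k _ fun _ => f)) (2 * p))
  exact congrArg (fun x => sigmaChain (M := Chains k A) x (2 * p))
    (funext fun q => trace_fromBlocks k e f q)

theorem chernIdem_zero (p : ℕ) (h : IsIdempotentElem (0 : Matrix ι ι A)) :
    chernIdem k p (0 : Matrix ι ι A) h = 0 := by
  obtain ⟨h1, e1⟩ := chernIdem_eq k p _ h
  rw [e1, Submodule.Quotient.mk_eq_zero]
  refine ⟨0, ?_⟩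
  have h2 : (fun q => trace k q (pure k (Matrix ι ι A) fun _ => 0)) = fun q => 0 := by
    ext q
    rw [trace_pure, Finset.sum_eq_zero]
    exact fun s _ => MultilinearMap.map_coord_zero _ 0 rfl
  rw [map_zero]
  exact ((congrArg (fun x => sigmaChain (M := Chains k A) x (2 * p)) h2).trans
    (sigmaChain_zero (Chains k A) (2 * p))).symm

theorem chernIdem_congr (p : ℕ) {e : Matrix ι ι A} {f : Matrix κ κ A}
    (he : IsIdempotentElem e) (hf : IsIdempotentElem f) (u : Matrix ι κ A) (v : Matrix κ ι A)
    (huv : u * v = e) (hvu : v * u = f) (heu : e * u = u) (hfv : f * v = v) :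
    chernIdem k p e he = chernIdem k p f hf := by
  have huf : u * f = u := by rw [← hvu, ← Matrix.mul_assoc, huv, heu]
  have hve : v * e = v := by rw [← huv, ← Matrix.mul_assoc, hvu, hfv]
  have h0 : IsIdempotentElem (0 : Matrix ι ι A) := by simp [IsIdempotentElem]
  have h0' : IsIdempotentElem (0 : Matrix κ κ A) := by simp [IsIdempotentElem]
  have h1 := chernIdem_fromBlocks k p he h0' (isIdempotentElem_fromBlocks he h0')
  have h2 := chernIdem_fromBlocks k p h0 hf (isIdempotentElem_fromBlocks h0 hf)
  rw [chernIdem_zero, add_zero] at h1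
  rw [chernIdem_zero, zero_add] at h2
  rw [← h1, ← h2, chernIdem, chernIdem]
  congr 1
  let g : Bool → Bool → Matrix (ι ⊕ κ) (ι ⊕ κ) A := fun x y =>
    match x, y with
    | true, true => Matrix.fromBlocks e 0 0 0
    | true, false => Matrix.fromBlocks 0 u 0 0
    | false, true => Matrix.fromBlocks 0 0 v 0
    | false, false => Matrix.fromBlocks 0 0 0 f
  refine sigmaClass_eq k (g := g) ?_ p _ _ rfl rfl
  rintro (_ | _) (_ | _) (_ | _) <;>
    simp [g, Matrix.fromBlocks_multiply, he.eq, hf.eq, huv, hvu, heu, hfv, huf, hve]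

end Invariance

/-! ### The Grothendieck group of finitely generated projective modules -/

section KTheory

universe u

/-- The finitely generated projective left `A`-modules. -/
structure FGProjective (A : Type u) [Ring A] where
  carrier : Type u
  [addCommGroup : AddCommGroup carrier]
  [module : Module A carrier]
  [finite : Module.Finite A carrier]
  [projective : Module.Projective A carrier]

attribute [instance] FGProjective.addCommGroup FGProjective.module FGProjective.finite
  FGProjective.projective

instance (A : Type u) [Ring A] : CoeSort (FGProjective A) (Type u) := ⟨FGProjective.carrier⟩

/-- The relations of the Grothendieck group: `[P] - [Q]` for `P ≅ Q`, and
`[P ⊕ Q] - [P] - [Q]`. -/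
inductive K0Relation (A : Type u) [Ring A] : FreeAbelianGroup (FGProjective A) → Prop
  | iso (P Q : FGProjective A) (θ : P ≃ₗ[A] Q) :
      K0Relation A (FreeAbelianGroup.of P - FreeAbelianGroup.of Q)
  | sum (P Q : FGProjective A) :
      K0Relation A (FreeAbelianGroup.of ⟨P × Q⟩ - FreeAbelianGroup.of P - FreeAbelianGroup.of Q)

/-- The Grothendieck group `K₀(A)` of finitely generated projective left `A`-modules. -/
abbrev K0 (A : Type u) [Ring A] : Type (u + 1) :=
  FreeAbelianGroup (FGProjective A) ⧸ AddSubgroup.closure {x | K0Relation A x}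

/-- The class `[P]` in `K₀(A)`. -/
def K0.mk {A : Type u} [Ring A] (P : FGProjective A) : K0 A :=
  QuotientAddGroup.mk (FreeAbelianGroup.of P)

variable {A : Type u} [Ring A]

theorem projective_range_vecMul {ι : Type*} [Fintype ι] {e : Matrix ι ι A}
    (he : IsIdempotentElem e) : Module.Projective A (LinearMap.range e.vecMulLinear) := by
  refine Module.Projective.of_split (LinearMap.range e.vecMulLinear).subtype
    e.vecMulLinear.rangeRestrict ?_
  ext ⟨_, y, rfl⟩
  simp [he.eq]

/-- The finitely generated projective module `A^ι e` of an idempotent matrix `e`: the image of the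
endomorphism `v ↦ v e` of `A^ι`. -/
def idemModule {ι : Type} [Fintype ι] (e : Matrix ι ι A) (he : IsIdempotentElem e) :
    FGProjective A :=
  haveI := projective_range_vecMul he
  ⟨LinearMap.range e.vecMulLinear⟩

/-- The projective left module `A e` of an idempotent `e ∈ A`, that is, the image of the
endomorphism `a ↦ a e` of `A`. -/
def principal (e : A) (he : IsIdempotentElem e) : FGProjective A :=
  haveI : Module.Projective A (LinearMap.range (LinearMap.toSpanSingleton A A e)) :=
    Module.Projective.of_split (LinearMap.range (LinearMap.toSpanSingleton A A e)).subtype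
      (LinearMap.toSpanSingleton A A e).rangeRestrict (by
        ext ⟨_, y, rfl⟩
        simp [mul_assoc, he.eq])
  ⟨LinearMap.range (LinearMap.toSpanSingleton A A e)⟩

theorem exists_matrix_of_linearMap {ι κ : Type} [Fintype ι] [DecidableEq ι]
    (f : (ι → A) →ₗ[A] (κ → A)) : ∃ u : Matrix ι κ A, ∀ v, f v = Matrix.vecMul v u :=
  ⟨LinearMap.toMatrixRight' f, fun v => by
    conv_lhs => rw [← LinearEquiv.symm_apply_apply LinearMap.toMatrixRight' f]
    rfl⟩

theorem matrix_ext_vecMul {ι κ : Type} [Fintype ι] [DecidableEq ι] {a b : Matrix ι κ A}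
    (h : ∀ x, Matrix.vecMul x a = Matrix.vecMul x b) : a = b := by
  ext i j
  simpa using congrFun (h (Pi.single i 1)) j

theorem exists_idemModule (P : FGProjective A) :
    ∃ (m : ℕ) (e : Matrix (Fin m) (Fin m) A) (he : IsIdempotentElem e),
      Nonempty (P ≃ₗ[A] idemModule e he) := by
  obtain ⟨m, f, hf⟩ := Module.Finite.exists_fin' A P
  obtain ⟨g, hg⟩ := Module.projective_lifting_property f LinearMap.id hf
  obtain ⟨e, he⟩ := exists_matrix_of_linearMap (g ∘ₗ f)
  have hfg : ∀ x, f (g x) = x := LinearMap.congr_fun hg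
  have hidem : IsIdempotentElem e := by
    refine matrix_ext_vecMul fun x => ?_
    rw [← Matrix.vecMul_vecMul, ← he, ← he]
    simp [hfg]
  refine ⟨m, e, hidem, ⟨?_⟩⟩
  have hr : LinearMap.range g = LinearMap.range e.vecMulLinear := by
    apply le_antisymm
    · rintro _ ⟨x, rfl⟩
      exact ⟨g x, by rw [Matrix.vecMulLinear_apply, ← he, LinearMap.comp_apply, hfg]⟩
    · rintro _ ⟨v, rfl⟩
      exact ⟨f v, by rw [Matrix.vecMulLinear_apply, ← he]; rfl⟩
  exact (LinearEquiv.ofInjective g (Function.LeftInverse.injective hfg)).trans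
    (LinearEquiv.ofEq _ _ hr)

variable (k : Type*) [CommRing k] [Algebra k A]

theorem chernIdem_congr_of_equiv (p : ℕ) {ι κ : Type} [Fintype ι] [DecidableEq ι] [Fintype κ]
    [DecidableEq κ] {e : Matrix ι ι A} {f : Matrix κ κ A} (he : IsIdempotentElem e)
    (hf : IsIdempotentElem f) (θ : idemModule e he ≃ₗ[A] idemModule f hf) :
    chernIdem k p e he = chernIdem k p f hf := by
  change LinearMap.range e.vecMulLinear ≃ₗ[A] LinearMap.range f.vecMulLinear at θ
  obtain ⟨u, hu⟩ := exists_matrix_of_linearMap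
    ((LinearMap.range f.vecMulLinear).subtype ∘ₗ θ.toLinearMap ∘ₗ e.vecMulLinear.rangeRestrict)
  obtain ⟨v, hv⟩ := exists_matrix_of_linearMap
    ((LinearMap.range e.vecMulLinear).subtype ∘ₗ θ.symm.toLinearMap ∘ₗ
      f.vecMulLinear.rangeRestrict)
  have hu' : ∀ x, Matrix.vecMul x u = (θ (e.vecMulLinear.rangeRestrict x) : κ → A) :=
    fun x => (hu x).symm
  have hv' : ∀ x, Matrix.vecMul x v = (θ.symm (f.vecMulLinear.rangeRestrict x) : ι → A) :=
    fun x => (hv x).symm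
  have hfix : ∀ y : LinearMap.range f.vecMulLinear, f.vecMulLinear.rangeRestrict (y : κ → A) = y := by
    rintro ⟨_, y, rfl⟩
    ext1
    simp [hf.eq]
  have hfix' : ∀ y : LinearMap.range e.vecMulLinear, e.vecMulLinear.rangeRestrict (y : ι → A) = y := by
    rintro ⟨_, y, rfl⟩
    ext1
    simp [he.eq]
  refine chernIdem_congr k p he hf u v (matrix_ext_vecMul fun x => ?_) (matrix_ext_vecMul fun x => ?_)
    (matrix_ext_vecMul fun x => ?_) (matrix_ext_vecMul fun x => ?_)
  · rw [← Matrix.vecMul_vecMul, hv', hu', hfix, LinearEquiv.symm_apply_apply]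
    rfl
  · rw [← Matrix.vecMul_vecMul, hu', hv', hfix', LinearEquiv.apply_symm_apply]
    rfl
  · rw [← Matrix.vecMul_vecMul, hu', hu']
    congr 2
    exact hfix' (e.vecMulLinear.rangeRestrict x)
  · rw [← Matrix.vecMul_vecMul, hv', hv']
    congr 2
    exact hfix (f.vecMulLinear.rangeRestrict x)

/-- The isomorphism `A^ι e ⊕ A^κ f ≅ A^(ι ⊕ κ) (e ⊕ f)`. -/
def idemModuleSum {ι κ : Type} [Fintype ι] [Fintype κ]
    {e : Matrix ι ι A} {f : Matrix κ κ A} (he : IsIdempotentElem e) (hf : IsIdempotentElem f) :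
    (idemModule e he × idemModule f hf) ≃ₗ[A]
      idemModule (Matrix.fromBlocks e 0 0 f) (isIdempotentElem_fromBlocks he hf) := by
  let E : ((ι → A) × (κ → A)) ≃ₗ[A] (ι ⊕ κ → A) := (LinearEquiv.sumArrowLequivProdArrow ι κ A A).symm
  let j : (LinearMap.range e.vecMulLinear × LinearMap.range f.vecMulLinear) →ₗ[A] (ι ⊕ κ → A) :=
    E.toLinearMap ∘ₗ LinearMap.prodMap (LinearMap.range e.vecMulLinear).subtype
      (LinearMap.range f.vecMulLinear).subtype
  have hj : Function.Injective j := E.injective.comp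
    (Function.Injective.prodMap Subtype.val_injective Subtype.val_injective)
  have hE : ∀ x y, Matrix.vecMul (E (x, y)) (Matrix.fromBlocks e 0 0 f) =
      E (Matrix.vecMul x e, Matrix.vecMul y f) := by
    intro x y
    ext i
    rcases i with i | i <;> simp [E, Matrix.vecMul, dotProduct]
  have hr : LinearMap.range j = LinearMap.range (Matrix.fromBlocks e 0 0 f).vecMulLinear := by
    apply le_antisymm
    · rintro _ ⟨⟨⟨_, x, rfl⟩, ⟨_, y, rfl⟩⟩, rfl⟩
      exact ⟨E (x, y), hE x y⟩
    · rintro _ ⟨w, rfl⟩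
      obtain ⟨⟨x, y⟩, rfl⟩ := E.surjective w
      exact ⟨(⟨_, x, rfl⟩, ⟨_, y, rfl⟩), (hE x y).symm⟩
  exact (LinearEquiv.ofInjective j hj).trans (LinearEquiv.ofEq _ _ hr)

/-- The Chern character of a finitely generated projective module `P`: the class `tr (c(e))` for an
idempotent matrix `e` with `P ≅ A^m e`. -/
def chernModule (p : ℕ) (P : FGProjective A) : HC k A (2 * p) :=
  chernIdem k p (exists_idemModule P).choose_spec.choose
    (exists_idemModule P).choose_spec.choose_spec.choose

theorem chernModule_eq (p : ℕ) (P : FGProjective A) {ι : Type} [Fintype ι] [DecidableEq ι]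
    (e : Matrix ι ι A) (he : IsIdempotentElem e) (θ : P ≃ₗ[A] idemModule e he) :
    chernModule k p P = chernIdem k p e he :=
  chernIdem_congr_of_equiv k p _ he
    ((exists_idemModule P).choose_spec.choose_spec.choose_spec.some.symm.trans θ)

/-- The Chern character `ch_{0,p} : K₀(A) → HC_{2p}(A)`. -/
def chernCharacter (p : ℕ) : K0 A →+ HC k A (2 * p) :=
  QuotientAddGroup.lift _ (FreeAbelianGroup.lift (chernModule k p)) (by
    rw [AddSubgroup.closure_le]
    rintro x (⟨P, Q, θ⟩ | ⟨P, Q⟩)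
    · obtain ⟨m, e, he, ⟨η⟩⟩ := exists_idemModule Q
      change FreeAbelianGroup.lift _ _ = 0
      rw [map_sub, FreeAbelianGroup.lift_apply_of, FreeAbelianGroup.lift_apply_of,
        chernModule_eq k p Q e he η, chernModule_eq k p P e he (θ.trans η), sub_self]
    · obtain ⟨m, e, he, ⟨θ⟩⟩ := exists_idemModule P
      obtain ⟨l, f, hf, ⟨η⟩⟩ := exists_idemModule Q
      change FreeAbelianGroup.lift _ _ = 0
      rw [map_sub, map_sub, FreeAbelianGroup.lift_apply_of, FreeAbelianGroup.lift_apply_of,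
        FreeAbelianGroup.lift_apply_of, chernModule_eq k p P e he θ, chernModule_eq k p Q f hf η,
        chernModule_eq k p ⟨P × Q⟩ _ _ ((θ.prodCongr η).trans (idemModuleSum he hf)),
        chernIdem_fromBlocks k p he hf]
      abel)

/-- On the class of the image `A^ι e` of an idempotent matrix `e`, the Chern character is
`tr (c(e))`. -/
theorem chernCharacter_idemModule (p : ℕ) {ι : Type} [Fintype ι] [DecidableEq ι]
    (e : Matrix ι ι A) (he : IsIdempotentElem e) :
    chernCharacter k p (K0.mk (idemModule e he)) = chernIdem k p e he := by
  refine Eq.trans ?_ (chernModule_eq k p _ e he (LinearEquiv.refl A _))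
  exact FreeAbelianGroup.lift_apply_of _ _

/-- The `k`-linear extension `k ⊗_ℤ K₀(A) → HC_{2p}(A)` of the Chern character. -/
def chernCharacterLinear (p : ℕ) : k ⊗[ℤ] K0 A →ₗ[k] HC k A (2 * p) :=
  (chernCharacter (A := A) k p).toIntLinearMap.liftBaseChange k

end KTheory

end CyclicHomology

/-! ### Quivers with relations -/

namespace QuiverAlgebra

section

variable (k : Type*) [CommRing k] {V E : Type*}

/-- The generator of the free algebra attached to a vertex `v`. -/
abbrev vtx (v : V) : FreeAlgebra k (V ⊕ E) := FreeAlgebra.ι k (Sum.inl v)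

/-- The generator of the free algebra attached to an arrow `a`. -/
abbrev arr (a : E) : FreeAlgebra k (V ⊕ E) := FreeAlgebra.ι k (Sum.inr a)

/-- The defining relations of the algebra of a quiver with finite vertex set `V`, set of arrows `E`,
sources `s` and targets `t`, and with a set `R` of relations: the relations of the path algebra
(the vertices are orthogonal idempotents of sum `1`, and `e_{s(a)} a = a = a e_{t(a)}` for all
arrows `a`, so that paths are written from left to right) together with `x = 0` for `x ∈ R`. -/
inductive Relation [Fintype V] (s t : E → V) (R : FreeAlgebra k (V ⊕ E) → Prop) :
    FreeAlgebra k (V ⊕ E) → FreeAlgebra k (V ⊕ E) → Prop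
  | sum_vertices : Relation s t R (∑ v, vtx k v) 1
  | vertex_idem (v : V) : Relation s t R (vtx k v * vtx k v) (vtx k v)
  | vertex_orth (v w : V) (h : v ≠ w) : Relation s t R (vtx k v * vtx k w) 0
  | source (a : E) : Relation s t R (vtx k (s a) * arr k a) (arr k a)
  | target (a : E) : Relation s t R (arr k a * vtx k (t a)) (arr k a)
  | rel (x : FreeAlgebra k (V ⊕ E)) (hx : R x) : Relation s t R x 0

/-- The quotient of the path algebra of the quiver `(V, E, s, t)` by the ideal generated by `R`. -/
def BoundQuiverAlgebra [Fintype V] (s t : E → V) (R : FreeAlgebra k (V ⊕ E) → Prop) : Type _ :=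
  RingQuot (Relation k s t R)

variable [Fintype V] (s t : E → V) (R : FreeAlgebra k (V ⊕ E) → Prop)

instance : Ring (BoundQuiverAlgebra k s t R) :=
  inferInstanceAs (Ring (RingQuot (Relation k s t R)))

instance : Algebra k (BoundQuiverAlgebra k s t R) :=
  inferInstanceAs (Algebra k (RingQuot (Relation k s t R)))

/-- The idempotent of the algebra attached to a vertex. -/
def vertex (v : V) : BoundQuiverAlgebra k s t R :=
  RingQuot.mkAlgHom k (Relation k s t R) (vtx k v)

theorem vertex_idempotent (v : V) : IsIdempotentElem (vertex k s t R v) := by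
  have h := RingQuot.mkAlgHom_rel k (Relation.vertex_idem (s := s) (t := t) (R := R) v)
  rw [map_mul] at h
  exact h

end

/-- The relations of the Taft algebra: the paths `x_i x_{i+1} ⋯ x_{i+m-1}` of length `m ≥ n`, where
`x_i : i → i + 1` are the arrows of the oriented cycle. -/
def taftRelation (k : Type*) [CommRing k] (n : ℕ) (x : FreeAlgebra k (ZMod n ⊕ ZMod n)) : Prop :=
  ∃ (i : ZMod n) (m : ℕ), n ≤ m ∧
    x = (List.ofFn fun j : Fin m => (arr k (i + (j : ℕ)) : FreeAlgebra k (ZMod n ⊕ ZMod n))).prod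

/-- The Taft algebra `Λ_n`: its quiver is an oriented cycle with `n` vertices and `n` arrows
`x_i : i → i + 1`, and its relations are all the paths of length at least `n`. -/
abbrev TaftAlgebra (k : Type*) [CommRing k] (n : ℕ) [NeZero n] : Type _ :=
  BoundQuiverAlgebra k (V := ZMod n) (E := ZMod n) (fun i => i) (fun i => i + 1) (taftRelation k n)

/-- The arrows of the quiver `Q_n`: `a_{i,u} : (i - 1, u) → (i, u)` for `u ≠ i - 1`, and
`b_{i,u} : (i, u - 1) → (i, u)` for `u ≠ i`. -/
inductive AuslanderArrow (n : ℕ) : Type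
  | a (i u : ZMod n) (h : u ≠ i - 1) : AuslanderArrow n
  | b (i u : ZMod n) (h : u ≠ i) : AuslanderArrow n

/-- The source of an arrow of `Q_n`. -/
def AuslanderArrow.source {n : ℕ} : AuslanderArrow n → ZMod n × ZMod n
  | .a i u _ => (i - 1, u)
  | .b i u _ => (i, u - 1)

/-- The target of an arrow of `Q_n`. -/
def AuslanderArrow.target {n : ℕ} : AuslanderArrow n → ZMod n × ZMod n
  | .a i u _ => (i, u)
  | .b i u _ => (i, u)

/-- The mesh relations `a_{i,i-2} b_{i,i-1}` and `a_{i,u-1} b_{i,u} + b_{i-1,u} a_{i,u}`. -/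
inductive auslanderRelation (k : Type*) [CommRing k] (n : ℕ) :
    FreeAlgebra k ((ZMod n × ZMod n) ⊕ AuslanderArrow n) → Prop
  | triangle (i : ZMod n) (h₁ : i - 2 ≠ i - 1) (h₂ : i - 1 ≠ i) :
      auslanderRelation k n (arr k (.a i (i - 2) h₁) * arr k (.b i (i - 1) h₂))
  | square (i u : ZMod n) (h₁ : u - 1 ≠ i - 1) (h₂ : u ≠ i) (h₃ : u ≠ i - 1) :
      auslanderRelation k n (arr k (.a i (u - 1) h₁) * arr k (.b i u h₂) +
        arr k (.b (i - 1) u h₃) * arr k (.a i u h₃))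

/-- The Auslander algebra `Γ_{Λ_n}` of the Taft algebra `Λ_n`: the path algebra of the quiver `Q_n`
modulo the mesh relations. -/
abbrev AuslanderAlgebra (k : Type*) [CommRing k] (n : ℕ) [NeZero n] : Type _ :=
  BoundQuiverAlgebra k (V := ZMod n × ZMod n) (E := AuslanderArrow n) AuslanderArrow.source
    AuslanderArrow.target (auslanderRelation k n)

section

variable (k : Type*) [CommRing k] (n : ℕ) [NeZero n]

/-- The idempotent `e_j` of `Λ_n`. -/
abbrev taftVertex (j : ZMod n) : TaftAlgebra k n := vertex k _ _ _ j

/-- The idempotent `e_{i,u}` of `Γ_{Λ_n}`. -/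
abbrev auslanderVertex (i u : ZMod n) : AuslanderAlgebra k n := vertex k _ _ _ (i, u)

/-- The projective module `P_j = Λ_n e_j`. -/
abbrev taftProjective (j : ZMod n) : CyclicHomology.FGProjective (TaftAlgebra k n) :=
  CyclicHomology.principal (taftVertex k n j) (vertex_idempotent k _ _ _ j)

/-- The projective module `P_{i,u} = Γ_{Λ_n} e_{i,u}`. -/
abbrev auslanderProjective (i u : ZMod n) : CyclicHomology.FGProjective (AuslanderAlgebra k n) :=
  CyclicHomology.principal (auslanderVertex k n i u) (vertex_idempotent k _ _ _ (i, u))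

/-- The class of `σ^p_j = σ^p(e_j, …, e_j)` in `HC_{2p}(Λ_n)`. -/
abbrev taftSigma (p : ℕ) (j : ZMod n) : CyclicHomology.HC k (TaftAlgebra k n) (2 * p) :=
  CyclicHomology.sigmaClass k p (taftVertex k n j) (vertex_idempotent k _ _ _ j)

/-- The class of `σ^p_{i,u} = σ^p(e_{i,u}, …, e_{i,u})` in `HC_{2p}(Γ_{Λ_n})`. -/
abbrev auslanderSigma (p : ℕ) (i u : ZMod n) :
    CyclicHomology.HC k (AuslanderAlgebra k n) (2 * p) :=
  CyclicHomology.sigmaClass k p (auslanderVertex k n i u) (vertex_idempotent k _ _ _ (i, u))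

end

end QuiverAlgebra

end

/-! The projective `A e` is the image of the `1 × 1` matrix `(e)`, on which the generalized trace is
the identity; this is the first assertion (`chernCharacter_principal`). Surjectivity of the
linearized Chern character then follows as soon as the classes `σ^p` of the vertices span, and that
is the substance of the theorem.

In total degree `2p` of the cyclic bicomplex, rows and columns have the same parity. Given a cycle,
its row `0` can be removed by a combination of the cycles `σ^p` and a boundary, because `A / [A, A]`
is spanned by the vertices. The other rows are removed one after the other, going up. An odd row
lies in an odd column, where `b'` is contracted by `a ↦ 1 ⊗ a`. An even row of positive degree lies
in an even column, where a Hochschild cycle `z` of degree `2j + 2` has to be removed; this works if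
`z = (1 - t) y + b w` with `b' y = N x` and `b x = 0`, since `w`, `y`, `x`, placed in three
neighbouring columns, then have boundary `z` and nothing below it. This criterion is
`span_sigmaChain_eq_top`.

The Hochschild input is obtained dually. Both algebras have a basis which is closed under
multiplication up to zero, so functionals on Hochschild chains are functions on words in a semigroup
with zero, and `ker_bMap_le` turns a statement about cocycles into one about cycles.

For the Auslander algebra, the basis consists up to sign of the paths `b ⋯ b a ⋯ a`. Filter it by
the distance of the two coordinates at the turning vertex `v`. The graded pieces of the bimodule `A`
are sums of products `L ⊗ R`, with `R = e_v A / b A` and `b A` either zero or projective. Hence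
`Tor(R, L)`, which computes the Hochschild homology of `L ⊗ R`, vanishes in degrees at least two
(`MeshPath.exists_coboundary_eq`). One takes `y = x = 0`, and the characteristic plays no role.

For the Taft algebra, the extension by paths of length less than `2n` defines a two-cocycle
`overflow`, and the cap product with it is a periodicity: a cocycle of degree `2c` is, up to a
coboundary, the `c`-fold cap product of a trace (`CyclePath.exists_cap_iterate`). A trace is a
function on the vertices, and for `c > 0` the constant ones give coboundaries
(`CyclePath.cap_iterate_trace`). The differences of values at neighbouring vertices are detected by
the cycles `(1 - t) loopChain`, so these span the even homology of positive degree modulo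
boundaries. They have the form required above, except that `x` involves a division by `j + 1`; here
`j + 1 ≤ p`, whence the condition `p! ≠ 0`. -/

noncomputable section

namespace CyclicHomology

/-! ### Hochschild cochains on words in a semigroup with zero -/

section Cochains

variable {k : Type*} [CommRing k] {S X : Type*} [Mul S]

/-- The alternating sum `F (a₁ a₂, …) - F (a₁, a₂ a₃, …) + ⋯ ± H aₙ (a₁, …, aₙ₋₁)`. -/
def innerFaces : (List S → k) → (S → List S → k) → List S → k
  | _, _, [] => 0
  | _, H, [a] => H a []
  | F, H, a :: b :: l =>
    F (a * b :: l) - innerFaces (fun l => F (a :: l)) (fun s l => H s (a :: l)) (b :: l)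

/-- The Hochschild coboundary of a cochain with coefficients in a set `X` with a left action `L` and
a right action `R` of `S`. -/
def coboundary (L : S → X → X) (R : X → S → X) (f : X → List S → k) : X → List S → k
  | _, [] => 0
  | x, a :: l => f (R x a) l - innerFaces (f x) (fun s l => f (L s x) l) (a :: l)

/-- Every face shortens a word by one letter. Cochains are defined on words of all lengths, and this
allows them to be compared only in the degree that matters. -/
theorem innerFaces_congr {F F' : List S → k} {H H' : S → List S → k} {m : ℕ} {l : List S}
    (hl : l.length = m + 1) (hF : ∀ l', l'.length = m → F l' = F' l')
    (hH : ∀ s l', l'.length = m → H s l' = H' s l') :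
    innerFaces F H l = innerFaces F' H' l := by
  induction m generalizing F F' H H' l with
  | zero =>
    obtain ⟨a, rfl⟩ := List.length_eq_one_iff.1 hl
    exact hH _ _ rfl
  | succ m ih =>
    match l, hl with
    | a :: b :: l, hl =>
      have hl' : (b :: l).length = m + 1 := by simpa using hl
      rw [innerFaces, innerFaces, hF (a * b :: l) (by simpa using hl),
        ih hl' (fun l' h => hF (a :: l') (by simp [h])) fun s l' h => hH s (a :: l') (by simp [h])]

theorem innerFaces_add (F F' : List S → k) (H H' : S → List S → k) (l : List S) :
    innerFaces (fun l => F l + F' l) (fun s l => H s l + H' s l) l =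
      innerFaces F H l + innerFaces F' H' l := by
  induction l generalizing F F' H H' with
  | nil => simp [innerFaces]
  | cons a l ih =>
    cases l with
    | nil => simp [innerFaces]
    | cons b l => rw [innerFaces, innerFaces, innerFaces, ih]; ring

theorem innerFaces_smul (c : k) (F : List S → k) (H : S → List S → k) (l : List S) :
    innerFaces (fun l => c * F l) (fun s l => c * H s l) l = c * innerFaces F H l := by
  induction l generalizing F H with
  | nil => simp [innerFaces]
  | cons a l ih =>
    cases l with
    | nil => simp [innerFaces]
    | cons b l => rw [innerFaces, innerFaces, ih]; ring

theorem innerFaces_neg (F : List S → k) (H : S → List S → k) (l : List S) :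
    innerFaces (fun l => -F l) (fun s l => -H s l) l = -innerFaces F H l := by
  simpa using innerFaces_smul (-1) F H l

theorem innerFaces_sub (F F' : List S → k) (H H' : S → List S → k) (l : List S) :
    innerFaces (fun l => F l - F' l) (fun s l => H s l - H' s l) l =
      innerFaces F H l - innerFaces F' H' l := by
  simp only [sub_eq_add_neg, innerFaces_add, innerFaces_neg]

theorem innerFaces_zero (l : List S) :
    innerFaces (fun _ => (0 : k)) (fun _ _ => 0) l = 0 := by
  simpa using innerFaces_smul (0 : k) (fun _ => 0) (fun _ _ => 0) l

theorem innerFaces_sum {ι : Type*} (t : Finset ι) (F : ι → List S → k) (H : ι → S → List S → k)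
    (l : List S) :
    innerFaces (fun l => ∑ i ∈ t, F i l) (fun s l => ∑ i ∈ t, H i s l) l =
      ∑ i ∈ t, innerFaces (F i) (H i) l := by
  classical
  induction t using Finset.induction_on with
  | empty => simpa using innerFaces_zero l
  | insert i t hi ih => simp only [Finset.sum_insert hi, innerFaces_add, ih]

theorem coboundary_congr {L : S → X → X} {R : X → S → X} {f g : X → List S → k} {m : ℕ}
    (h : ∀ x l, l.length = m → f x l = g x l) (x : X) {l : List S} (hl : l.length = m + 1) :
    coboundary L R f x l = coboundary L R g x l := by
  match l, hl with
  | a :: l, hl =>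
    rw [coboundary, coboundary, h _ l (by simpa using hl),
      innerFaces_congr hl (fun l' h' => h x l' h') fun s l' h' => h _ l' h']

theorem coboundary_add (L : S → X → X) (R : X → S → X) (f g : X → List S → k) (x : X)
    (l : List S) : coboundary L R (fun x l => f x l + g x l) x l =
      coboundary L R f x l + coboundary L R g x l := by
  cases l with
  | nil => simp [coboundary]
  | cons a l => rw [coboundary, coboundary, coboundary, innerFaces_add]; ring

theorem coboundary_smul (L : S → X → X) (R : X → S → X) (c : k) (f : X → List S → k) (x : X)
    (l : List S) : coboundary L R (fun x l => c * f x l) x l = c * coboundary L R f x l := by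
  cases l with
  | nil => simp [coboundary]
  | cons a l => rw [coboundary, coboundary, innerFaces_smul]; ring

theorem coboundary_sub (L : S → X → X) (R : X → S → X) (f g : X → List S → k) (x : X)
    (l : List S) : coboundary L R (fun x l => f x l - g x l) x l =
      coboundary L R f x l - coboundary L R g x l := by
  cases l with
  | nil => simp [coboundary]
  | cons a l => rw [coboundary, coboundary, coboundary, innerFaces_sub]; ring

/-- The simplicial identities. Removing the last letter `s` and then the letter `s'` before it must
agree with removing their product, hence `H (s' * s)`. The induction strips the first letter `a`:
apart from the faces that merge `a`, the double sum is that of the shorter word. -/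
theorem innerFaces_innerFaces {S : Type*} [Semigroup S] (F : List S → k) (H : S → List S → k)
    {m : ℕ} {l : List S} (hl : l.length = m + 2) :
    innerFaces (innerFaces F H) (fun s => innerFaces (H s) fun s' => H (s' * s)) l = 0 := by
  induction m generalizing F H l with
  | zero =>
    match l, hl with
    | [a, b], _ => simp [innerFaces]
  | succ m ih =>
    match l, hl with
    | a :: b :: c :: l, hl =>
      have hl' : (b :: c :: l).length = m + 1 + 1 := by simpa using hl
      -- `M` merges `a` into the first letter of `y`; the default value of `headD` never occurs, as
      -- `y` is nonempty.
      let M : List S → List S := fun y => a * y.headD a :: y.tail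
      have key : innerFaces (fun y => innerFaces F H (a :: y))
          (fun s y => innerFaces (H s) (fun s' => H (s' * s)) (a :: y)) (b :: c :: l) =
          innerFaces (fun y => F (M y) - innerFaces (fun y => F (a :: y)) (fun s y => H s (a :: y)) y)
            (fun s y => H s (M y) - innerFaces (fun y => H s (a :: y))
              (fun s' y => H (s' * s) (a :: y)) y) (b :: c :: l) := by
        refine innerFaces_congr hl' (fun y hy => ?_) fun s y hy => ?_ <;>
        · match y, hy with
          | y :: y', _ => rfl
      rw [innerFaces, key, innerFaces_sub,
        ih (fun y => F (a :: y)) (fun s y => H s (a :: y)) hl', innerFaces, innerFaces]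
      simp [M, mul_assoc]

/-- The inner faces cancel by `innerFaces_innerFaces`; those through `R` cancel because `R` is an
action commuting with `L`. -/
theorem coboundary_coboundary {S : Type*} [Semigroup S] {L : S → X → X} {R : X → S → X}
    (hL : ∀ s t x, L (s * t) x = L s (L t x)) (hR : ∀ x s t, R x (s * t) = R (R x s) t)
    (hLR : ∀ s x t, L s (R x t) = R (L s x) t) (f : X → List S → k) (x : X) {m : ℕ} {l : List S}
    (hl : l.length = m + 2) : coboundary L R (coboundary L R f) x l = 0 := by
  match l, hl with
  | a :: b :: l, hl =>
    have h1 : innerFaces (coboundary L R f x) (fun s => coboundary L R f (L s x)) (a :: b :: l) =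
        innerFaces (fun y => f (R x (y.headD a)) y.tail -
            innerFaces (f x) (fun s y => f (L s x) y) y)
          (fun s y => f (R (L s x) (y.headD a)) y.tail -
            innerFaces (f (L s x)) (fun s' y => f (L (s' * s) x) y) y) (a :: b :: l) := by
      simp only [hL]
      refine innerFaces_congr hl (fun y hy => ?_) fun s y hy => ?_ <;>
      · match y, hy with
        | y :: y', _ => rfl
    have h2 := innerFaces_innerFaces (f x) (fun s y => f (L s x) y) hl
    rw [coboundary, coboundary, h1, innerFaces_sub, h2, innerFaces]
    simp [hR, hLR]

/-- Multiplication of the entries with numbers `i` and `i + 1` of a word. -/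
def mergeAt : ℕ → List S → List S
  | 0, a :: b :: l => a * b :: l
  | i + 1, a :: l => a :: mergeAt i l
  | _, _ => []

theorem innerFaces_eq_sum (F : List S → k) (H : S → List S → k) (a : S) (l : List S) :
    innerFaces F H (a :: l) = ∑ i ∈ Finset.range l.length, (-1 : k) ^ i * F (mergeAt i (a :: l)) +
      (-1 : k) ^ l.length * H ((a :: l).getLast (by simp)) (a :: l).dropLast := by
  induction l generalizing F H a with
  | nil => simp [innerFaces]
  | cons b l ih =>
    rw [innerFaces, ih, List.length_cons, Finset.sum_range_succ']
    simp only [mergeAt, pow_succ, List.getLast_cons_cons, List.dropLast_cons_cons]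
    simp only [mul_neg, mul_one, neg_mul, Finset.sum_neg_distrib, pow_zero, one_mul]
    ring

theorem getD_mergeAt (z : S) (i j : ℕ) (l : List S) (h : i + 1 < l.length) :
    (mergeAt i l).getD j z = if j < i then l.getD j z else
      if j = i then l.getD i z * l.getD (i + 1) z else l.getD (j + 1) z := by
  induction i generalizing j l with
  | zero =>
    match l, h with
    | a :: b :: l, h => cases j <;> simp [mergeAt]
  | succ i ih =>
    match l, h with
    | a :: l, h =>
      cases j with
      | zero => simp [mergeAt]
      | succ j => simpa [mergeAt] using ih j l (by simpa using h)

/-- A cochain which vanishes as soon as one of its arguments is zero. -/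
def Contracted [Zero S] (f : S → List S → k) : Prop := ∀ x l, x = 0 ∨ 0 ∈ l → f x l = 0

/-- In each face a zero letter survives, is absorbed into a zero product, or becomes the argument of
`H`. -/
theorem innerFaces_eq_zero {S : Type*} [SemigroupWithZero S] {F : List S → k} {H : S → List S → k}
    (hF : ∀ l, 0 ∈ l → F l = 0) (hH : ∀ s l, s = 0 ∨ 0 ∈ l → H s l = 0) {l : List S} (hl : 0 ∈ l) :
    innerFaces F H l = 0 := by
  induction l generalizing F H with
  | nil => rfl
  | cons a l ih =>
    cases l with
    | nil => exact hH _ _ (Or.inl (by simpa [eq_comm] using hl))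
    | cons b l =>
      rw [innerFaces]
      by_cases h : 0 ∈ b :: l
      · rw [ih (fun l h => hF _ (by simp [h])) (fun s l h => hH _ _ (by simp; tauto)) h, hF, sub_zero]
        rcases List.mem_cons.1 h with rfl | h <;> simp_all
      · obtain rfl : a = 0 := by simp only [List.mem_cons] at hl h; tauto
        rw [hF _ (by simp)]
        simp only [fun l => hF (0 :: l) (by simp), fun s l => hH s (0 :: l) (by simp),
          innerFaces_zero, sub_zero]

/-- The coboundary of cochains with coefficients in `S`. -/
abbrev hochschildCoboundary {S : Type*} [SemigroupWithZero S] (f : S → List S → k) : S → List S → k :=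
  coboundary (fun s x => s * x) (fun x s => x * s) f

theorem contracted_coboundary {S : Type*} [SemigroupWithZero S] {f : S → List S → k}
    (hf : Contracted f) : Contracted (hochschildCoboundary f) := by
  rintro x (_ | ⟨a, l⟩) h
  · rfl
  rw [hochschildCoboundary, coboundary]
  by_cases hx : x = 0
  · subst hx
    have h0 : f 0 = fun _ => 0 := funext fun l => hf 0 l (Or.inl rfl)
    simp only [zero_mul, mul_zero, h0, innerFaces_zero, sub_zero]
  · have h' : 0 ∈ a :: l := h.resolve_left hx
    rw [innerFaces_eq_zero (fun l h => hf _ _ (Or.inr h)) (fun s l h => hf _ _ ?_) h', hf, sub_zero]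
    · rcases List.mem_cons.1 h' with rfl | h
      · simp
      · exact Or.inr h
    · rcases h with rfl | h
      · simp
      · exact Or.inr h

end Cochains

/-! ### Functionals on Hochschild chains as cochains on words of basis elements -/

section Functionals

variable {k : Type*} [CommRing k] {A : Type*} [Ring A] [Algebra k A] {S : Type*} [SemigroupWithZero S]

/-- The family of `m` elements attached to a word. -/
abbrev wordTuple (β : S → A) (m : ℕ) (l : List S) : Fin m → A := fun j => β (l.getD j 0)

/-- The cochain of a functional on Hochschild chains. -/
def cochainOf (β : S → A) (q : ℕ) (Φ : Chains k A q →ₗ[k] k) : S → List S → k :=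
  fun x l => if l.length = q then Φ (pure k A (wordTuple β (q + 1) (x :: l))) else 0

theorem cochainOf_apply (β : S → A) {q : ℕ} (Φ : Chains k A q →ₗ[k] k) (x : S) {l : List S}
    (hl : l.length = q) :
    cochainOf β q Φ x l = Φ (pure k A (wordTuple β (q + 1) (x :: l))) := if_pos hl

theorem length_mergeAt (i : ℕ) (l : List S) (h : i + 1 < l.length) :
    (mergeAt i l).length + 1 = l.length := by
  induction i generalizing l with
  | zero =>
    match l, h with
    | a :: b :: l, h => simp [mergeAt]
  | succ i ih =>
    match l, h with
    | a :: l, h => simpa [mergeAt] using ih l (by simpa using h)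

theorem pure_wordTuple_eq_zero {β : S → A} (h0 : β 0 = 0) {q : ℕ} {l : List S}
    (hl : l.length = q + 1) (h : 0 ∈ l) : pure k A (wordTuple β (q + 1) l) = 0 := by
  obtain ⟨j, hj, hj'⟩ := List.mem_iff_getElem.1 h
  refine MultilinearMap.map_coord_zero _ (⟨j, hl ▸ hj⟩ : Fin (q + 1)) ?_
  simp only [wordTuple, List.getD_eq_getElem _ _ hj, hj', h0]

theorem contracted_cochainOf {β : S → A} (h0 : β 0 = 0) {q : ℕ} (Φ : Chains k A q →ₗ[k] k) :
    Contracted (cochainOf β q Φ) := by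
  intro x l h
  unfold cochainOf
  split_ifs with hl
  · rw [pure_wordTuple_eq_zero h0 (by simp [hl]) (by simpa [eq_comm] using h), map_zero]
  · rfl

theorem face_wordTuple {β : S → A} (hβ : ∀ s t, β (s * t) = β s * β t) {q : ℕ}
    {l : List S} (hl : l.length = q + 2) {i : ℕ} (hi : i < q + 1) :
    face k (face0 k A) (rot k A) q i (pure k A (wordTuple β (q + 2) l)) =
      pure k A (wordTuple β (q + 1) (mergeAt i l)) := by
  have h := face_pure k (wordTuple β (q + 2) l) ⟨i, hi⟩
  refine h.trans ?_
  congr 1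
  ext j
  simp only [wordTuple]
  rw [getD_mergeAt _ _ _ _ (by omega), apply_ite β, apply_ite β, hβ]
  simp [Fin.lt_def, Fin.ext_iff]

theorem face_last_wordTuple {β : S → A} (hβ : ∀ s t, β (s * t) = β s * β t) {q : ℕ}
    {x : S} {l : List S} (hl : l.length = q + 1) (h0 : l ≠ []) :
    face k (face0 k A) (rot k A) q (q + 1) (pure k A (wordTuple β (q + 2) (x :: l))) =
      pure k A (wordTuple β (q + 1) (l.getLast h0 * x :: l.dropLast)) := by
  refine (face_last_pure k _).trans ?_
  congr 1
  ext j
  refine Fin.cases ?_ (fun j => ?_) j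
  · simp [wordTuple, hβ, List.getLast_eq_getElem, hl]
  · have : (j : ℕ) < q := j.2
    simp [wordTuple, hl, this]

/-- The coboundary is the transpose of `b`: cocycles correspond to functionals vanishing on
boundaries, and coboundaries to functionals factoring through `b`. -/
theorem coboundary_cochainOf {β : S → A} (hβ : ∀ s t, β (s * t) = β s * β t) {q : ℕ}
    (Φ : Chains k A q →ₗ[k] k) (x : S) {l : List S} (hl : l.length = q + 1) :
    hochschildCoboundary (cochainOf β q Φ) x l =
      Φ (bMap k (face0 k A) (rot k A) q (pure k A (wordTuple β (q + 2) (x :: l)))) := by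
  match l, hl with
  | a :: l, hl =>
    have hl' : l.length = q := by simpa using hl
    rw [hochschildCoboundary, coboundary, innerFaces_eq_sum, bMap, LinearMap.sum_apply,
      Finset.sum_range_succ, Finset.sum_range_succ']
    simp only [LinearMap.smul_apply, map_add, map_sum, map_smul]
    rw [face_last_wordTuple hβ hl (by simp), face_wordTuple hβ (by simp [hl']) (by omega)]
    have : ∀ i ∈ Finset.range q, (-1 : k) ^ (i + 1) •
        Φ (face k (face0 k A) (rot k A) q (i + 1)
          (pure k A (wordTuple β (q + 2) (x :: a :: l)))) =
        -((-1 : k) ^ i * cochainOf β q Φ x (mergeAt i (a :: l))) := by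
      intro i hi
      have hi' : i < q := by simpa using hi
      have := length_mergeAt i (a :: l) (by simp [hl', hi'])
      rw [face_wordTuple hβ (by simp [hl']) (by omega), cochainOf_apply _ _ _ (by simpa [hl'] using this)]
      simp [mergeAt, pow_succ]
    rw [Finset.sum_congr rfl this, hl', Finset.sum_neg_distrib]
    rw [cochainOf_apply _ _ _ hl', cochainOf_apply _ _ _ (by simp [hl'])]
    simp only [mergeAt, pow_succ, smul_eq_mul, pow_zero]
    ring

theorem wordTuple_cons_ofFn {B : Type*} (β : S → B) {m : ℕ} (a : Fin (m + 1) → S) :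
    wordTuple β (m + 1) (a 0 :: List.ofFn fun j : Fin m => a j.succ) = fun j => β (a j) := by
  ext j
  refine Fin.cases ?_ (fun j => ?_) j <;> simp [wordTuple]

/-- A contracted cochain extends to a functional. -/
theorem exists_functional {β : S → A} (h0 : β 0 = 0) (b : Module.Basis {s : S // s ≠ 0} k A)
    (hb : ∀ s, b s = β s) {q : ℕ} {g : S → List S → k} (hg : Contracted g) :
    ∃ ψ : Chains k A q →ₗ[k] k, ∀ x l, l.length = q → cochainOf β q ψ x l = g x l := by
  classical
  let B := Basis.piTensorProduct (R := k) fun _ : Fin (q + 1) => b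
  let ψ : Chains k A q →ₗ[k] k :=
    B.constr k fun a => g (a 0) (List.ofFn fun j : Fin q => (a j.succ : S))
  refine ⟨ψ, fun x l hl => ?_⟩
  by_cases hx : x = 0 ∨ 0 ∈ l
  · rw [hg x l hx, contracted_cochainOf h0 ψ x l hx]
  · have hx' : ∀ j : Fin (q + 1), (x :: l).getD j 0 ≠ 0 := by
      intro j h
      have hj : (j : ℕ) < (x :: l).length := by simp [hl, Nat.lt_succ_iff.1 j.2]
      rw [List.getD_eq_getElem _ _ hj] at h
      have := List.getElem_mem hj
      rw [h, List.mem_cons] at this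
      exact hx (this.imp Eq.symm id)
    have h1 : pure k A (wordTuple β (q + 1) (x :: l)) = B fun j => ⟨_, hx' j⟩ := by
      rw [Basis.piTensorProduct_apply]
      congr 1
      ext j
      rw [hb]
    rw [cochainOf_apply _ _ _ hl, h1, Module.Basis.constr_basis]
    congr 1
    refine List.ext_getElem (by simp [hl]) fun i h2 h3 => ?_
    simp [List.getElem?_eq_getElem h3]

/-- Two functionals with the same cochain are equal. -/
theorem functional_ext {β : S → A} (b : Module.Basis {s : S // s ≠ 0} k A)
    (hb : ∀ s, b s = β s) {q : ℕ} {Φ ψ : Chains k A q →ₗ[k] k}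
    (h : ∀ x l, l.length = q → cochainOf β q Φ x l = cochainOf β q ψ x l) : Φ = ψ := by
  refine (Basis.piTensorProduct (R := k) fun _ : Fin (q + 1) => b).ext fun a => ?_
  have := h (a 0) (List.ofFn fun j : Fin q => (a j.succ : S)) (by simp)
  rw [cochainOf_apply _ _ _ (by simp), cochainOf_apply _ _ _ (by simp), wordTuple_cons_ofFn β fun j => (a j : S)] at this
  rw [Basis.piTensorProduct_apply]
  simpa only [hb] using this

end Functionals

end CyclicHomology

namespace QuiverAlgebra

open CyclicHomology

/-! ### The multiplicative basis of the Auslander algebra -/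

/-- The nonzero paths of the Auslander algebra up to sign, together with zero: `path i d m r` is the
path with source `(i, i + d)` and target `(i + r, i + m)`. -/
inductive MeshPath (n : ℕ) : Type
  | zero : MeshPath n
  | path (i : ZMod n) (d m r : ℕ) (hd : d ≤ m) (hm : m < n) (hr : r ≤ m) : MeshPath n

namespace MeshPath

variable {n : ℕ}

instance : Zero (MeshPath n) := ⟨zero⟩

instance : Mul (MeshPath n) :=
  ⟨fun
    | path i d m r hd _ _, path i' d' m' r' _ _ hr' =>
      if h : i' = i + r ∧ d' + r = m ∧ r + m' < n then
        path i d (r + m') (r + r') (by omega) h.2.2 (by omega)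
      else 0
    | _, _ => 0⟩

theorem path_mul_path {i : ZMod n} {d m r : ℕ} {hd hm hr} {i' : ZMod n} {d' m' r' : ℕ} {hd' hm' hr'} :
    (path i d m r hd hm hr * path i' d' m' r' hd' hm' hr' : MeshPath n) =
      if h : i' = i + r ∧ d' + r = m ∧ r + m' < n then
        path i d (r + m') (r + r') (by omega) h.2.2 (by omega)
      else 0 := rfl

theorem zero_mul' (x : MeshPath n) : 0 * x = 0 := rfl

theorem mul_zero' (x : MeshPath n) : x * 0 = 0 := by cases x <;> rfl

theorem zero_eq : (zero : MeshPath n) = 0 := rfl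

theorem path_congr {i i' : ZMod n} {d d' m m' r r' : ℕ} {hd hm hr hd' hm' hr'} (h1 : i = i')
    (h2 : d = d') (h3 : m = m') (h4 : r = r') :
    (path i d m r hd hm hr : MeshPath n) = path i' d' m' r' hd' hm' hr' := by
  subst h1 h2 h3 h4; rfl

instance : SemigroupWithZero (MeshPath n) where
  zero_mul := zero_mul'
  mul_zero := mul_zero'
  mul_assoc := by
    rintro (_ | ⟨i, d, m, r, hd, hm, hr⟩) (_ | ⟨i', d', m', r', hd', hm', hr'⟩)
      (_ | ⟨i₂, d₂, m₂, r₂, hd₂, hm₂, hr₂⟩) <;> try simp only [zero_eq, zero_mul', mul_zero']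
    simp only [path_mul_path]
    split_ifs with h1 h2 h2
    · simp only [path_mul_path]
      have e : i + ((r + r' : ℕ) : ZMod n) = i' + r' := by rw [h1.1]; push_cast; ring
      by_cases h3 : i₂ = i + ((r + r' : ℕ) : ZMod n) ∧ d₂ + (r + r') = r + m' ∧ r + r' + m₂ < n
      · rw [dif_pos h3, dif_pos ⟨h1.1, h1.2.1, by omega⟩]
        exact path_congr rfl rfl (by omega) (by omega)
      · rw [dif_neg h3, dif_neg]
        rintro h4
        exact h3 ⟨by rw [e]; exact h2.1, by omega, by omega⟩
    · simp only [path_mul_path, mul_zero']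
      rw [dif_neg]
      have e : i + ((r + r' : ℕ) : ZMod n) = i' + r' := by rw [h1.1]; push_cast; ring
      rintro h3
      exact h2 ⟨by rw [← e]; exact h3.1, by omega, by omega⟩
    · simp only [path_mul_path, zero_mul']
      rw [dif_neg]
      rintro h3
      exact h1 ⟨h3.1, h3.2.1, by omega⟩
    · rw [zero_mul', mul_zero']

/-- The difference between the two coordinates of the middle vertex of a path. -/
def level : MeshPath n → ℕ
  | zero => n
  | path _ _ m _ _ _ _ => m

/-- The first half of a path, which does not change the first coordinate. -/
def left : MeshPath n → MeshPath n
  | zero => 0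
  | path i d m _ hd hm _ => path i d m 0 hd hm (Nat.zero_le _)

/-- The second half of a path, which does not change the second coordinate. -/
def right : MeshPath n → MeshPath n
  | zero => 0
  | path i _ m r _ hm hr => path i m m r le_rfl hm hr

/-- The arrow increasing the second coordinate which has the same source as a given path. -/
def head : MeshPath n → MeshPath n
  | zero => 0
  | path i d _ _ _ _ _ => if h : d + 1 < n then path i d (d + 1) 0 (by omega) h (by omega) else 0

/-- The quotient of a path by its first arrow, if this increases the second coordinate. -/
def tail : MeshPath n → MeshPath n
  | zero => 0
  | path i d m r _ hm hr => if h : d < m then path i (d + 1) m r h hm hr else 0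

@[simp] theorem level_zero : level (0 : MeshPath n) = n := rfl

@[simp] theorem tail_zero : tail (0 : MeshPath n) = 0 := rfl

/-- Factorization at the turning vertex, where arrows `b` end and arrows `a` begin. -/
theorem left_mul_right (x : MeshPath n) : left x * right x = x := by
  rcases x with _ | ⟨i, d, m, r, hd, hm, hr⟩
  · rfl
  · simp only [left, right, path_mul_path]
    rw [dif_pos (by simpa using hm)]
    exact path_congr rfl rfl (by omega) (by omega)

theorem level_le (x : MeshPath n) : level x ≤ n := by
  rcases x with _ | ⟨i, d, m, r, hd, hm, hr⟩
  · exact le_rfl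
  · exact hm.le

/-- Multiplication on either side never lowers the level, zero having the largest level `n`. So the
cochains vanishing above a given level form a subcomplex. -/
theorem level_mul_left (x s : MeshPath n) : level x ≤ level (s * x) := by
  rcases x with _ | ⟨i, d, m, r, hd, hm, hr⟩ <;> rcases s with _ | ⟨i', d', m', r', hd', hm', hr'⟩
  · exact le_rfl
  · exact le_rfl
  · exact level_le _
  · rw [path_mul_path]
    split_ifs with h
    · exact Nat.le_add_left _ _
    · exact level_le _

theorem level_mul_right (x s : MeshPath n) : level x ≤ level (x * s) := by
  rcases x with _ | ⟨i, d, m, r, hd, hm, hr⟩ <;> rcases s with _ | ⟨i', d', m', r', hd', hm', hr'⟩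
  · exact le_rfl
  · exact le_rfl
  · exact level_le _
  · rw [path_mul_path]
    split_ifs with h
    · simp only [level]; omega
    · exact level_le _

/-- While the level stays the same, right multiplication only affects the second half. With
`left_right_mul_left`, this exhibits a graded piece of the filtration as a sum of products of a left
module of first halves and a right module of second halves. -/
theorem left_right_mul {x s : MeshPath n} (h : level (x * s) = level x) :
    left (x * s) = left x ∧ right (x * s) = right x * s ∧ tail (right x * s) = 0 := by
  rcases x with _ | ⟨i, d, m, r, hd, hm, hr⟩ <;> rcases s with _ | ⟨i', d', m', r', hd', hm', hr'⟩
  · exact ⟨rfl, rfl, rfl⟩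
  · exact ⟨rfl, rfl, rfl⟩
  · simp only [level] at h; exact absurd h.symm hm.ne
  · rw [path_mul_path] at h ⊢
    split_ifs at h ⊢ with h'
    · simp only [level] at h
      simp only [left, right, path_mul_path, dif_pos h']
      refine ⟨path_congr rfl rfl h rfl, path_congr rfl h rfl rfl, ?_⟩
      simp only [tail]
      rw [dif_neg (by omega)]
    · simp only [level] at h; exact absurd h.symm hm.ne

/-- A product of a second half with `s` which does not begin with an arrow `b` is zero or again a
second half; a nonzero `tail` means that the product has entered the submodule generated by `b`. -/
theorem right_mul_eq_zero_or {x s : MeshPath n} (h : tail (right x * s) = 0) :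
    right x * s = 0 ∨ level (x * s) = level x := by
  rcases x with _ | ⟨i, d, m, r, hd, hm, hr⟩ <;> rcases s with _ | ⟨i', d', m', r', hd', hm', hr'⟩
  · exact Or.inl rfl
  · exact Or.inl rfl
  · exact Or.inl rfl
  · simp only [right, path_mul_path] at h ⊢
    split_ifs at h ⊢ with h'
    · right
      simp only [tail] at h
      split_ifs at h with h2
      · simp only [level]; omega
    · exact Or.inl rfl

theorem left_right_mul_left {x s : MeshPath n} (h : level (s * x) = level x) :
    left (s * x) = s * left x ∧ right (s * x) = right x := by
  rcases x with _ | ⟨i, d, m, r, hd, hm, hr⟩ <;> rcases s with _ | ⟨i', d', m', r', hd', hm', hr'⟩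
  · exact ⟨rfl, rfl⟩
  · exact ⟨rfl, rfl⟩
  · simp only [level] at h; exact absurd h.symm hm.ne
  · rw [path_mul_path] at h ⊢
    split_ifs at h ⊢ with h'
    · simp only [level] at h
      obtain rfl : r' = 0 := by omega
      simp only [left, right, path_mul_path, dif_pos h']
      refine ⟨trivial, path_congr (by simp [h'.1]) (by omega) (by omega) (by omega)⟩
    · simp only [level] at h; exact absurd h.symm hm.ne

theorem level_lt_mul_left {x s : MeshPath n} (h : level (s * x) ≠ level x) :
    level x < level (s * left x) := by
  rcases x with _ | ⟨i, d, m, r, hd, hm, hr⟩ <;> rcases s with _ | ⟨i', d', m', r', hd', hm', hr'⟩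
  · exact absurd rfl h
  · exact absurd rfl h
  · exact hm
  · simp only [left]
    rw [path_mul_path] at h ⊢
    split_ifs at h ⊢ with h'
    · simp only [level] at h ⊢; omega
    · exact hm

/-- Either the product is zero, of level `n`, or the additional arrow `b` raises the level by one.
For a cocycle vanishing above the level of `x`, this kills the face merging `head` into the
coefficient. -/
theorem level_lt_left_mul_head {x : MeshPath n} (u : MeshPath n) (h : x ≠ 0) :
    level x < level (left x * head u) := by
  rcases x with _ | ⟨i, d, m, r, hd, hm, hr⟩
  · exact absurd rfl h
  rcases u with _ | ⟨i', d', m', r', hd', hm', hr'⟩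
  · exact hm
  · simp only [left, head]
    split_ifs with h'
    · rw [path_mul_path]
      split_ifs with h2
      · simp only [level]; omega
      · exact hm
    · exact hm

theorem head_mul_tail {u : MeshPath n} (h : tail u ≠ 0) : head u * tail u = u := by
  rcases u with _ | ⟨i, d, m, r, hd, hm, hr⟩
  · exact absurd rfl h
  · have h1 : d < m := by
      by_contra h1
      exact h (by simp [tail, h1])
    simp only [tail, head, dif_pos h1, dif_pos (show d + 1 < n by omega), path_mul_path]
    rw [dif_pos (by simp; omega)]
    exact path_congr rfl rfl (by omega) (by omega)

/-- Left multiplication by an arrow `b` is injective on the projective right module at its target;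
`tail` inverts it, and is therefore compatible with right multiplication. -/
theorem tail_mul {u : MeshPath n} (h : tail u ≠ 0) (s : MeshPath n) :
    tail (u * s) = tail u * s ∧ (u * s ≠ 0 → head (u * s) = head u) := by
  rcases u with _ | ⟨i, d, m, r, hd, hm, hr⟩
  · exact absurd rfl h
  rcases s with _ | ⟨i', d', m', r', hd', hm', hr'⟩
  · exact ⟨by simp [zero_eq], fun h => absurd rfl h⟩
  · simp only [tail] at h
    split_ifs at h with h1
    · simp only [tail, dif_pos h1, path_mul_path]
      split_ifs with h2
      · refine ⟨?_, fun _ => rfl⟩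
        simp only [dif_pos (show d < r + m' by omega)]
      · exact ⟨rfl, fun h => absurd rfl h⟩
    · exact absurd rfl h

/-! ### Acyclicity in degrees at least two for the Auslander algebra -/

section Exactness

variable {k : Type*} [CommRing k]

/-- The correction term in the contraction `contraction`. -/
def correction (f : MeshPath n → List (MeshPath n) → k) (v u : MeshPath n) (l : List (MeshPath n)) :
    k :=
  f v (head u :: tail u :: l)

/-- A contraction of the cochains concentrated in level `t`. -/
def contraction (f : MeshPath n → List (MeshPath n) → k) (t : ℕ) :
    MeshPath n → List (MeshPath n) → k
  | _, [] => 0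
  | x, s :: l => if level x = t then
      f (left x) (right x :: s :: l) - correction f (left x) (right x * s) l else 0

variable {f : MeshPath n → List (MeshPath n) → k}

theorem correction_eq_zero (hf : Contracted f) (v : MeshPath n) {u : MeshPath n} (hu : tail u = 0)
    (l : List (MeshPath n)) : correction f v u l = 0 :=
  hf _ _ (by simp [hu])

theorem correction_mul (hf : Contracted f) (v s : MeshPath n) {u : MeshPath n} (hu : tail u ≠ 0)
    (l : List (MeshPath n)) : correction f v (u * s) l = f v (head u :: (tail u * s) :: l) := by
  obtain ⟨h1, h2⟩ := tail_mul hu s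
  by_cases h : u * s = 0
  · rw [correction_eq_zero hf _ (by rw [h, tail_zero]), hf]
    simp [← h1, h]
  · rw [correction, h1, h2 h]

theorem contracted_contraction (hf : Contracted f) {t : ℕ} (ht : t < n) :
    Contracted (contraction f t) := by
  rintro x (_ | ⟨s, l⟩) h
  · rfl
  rw [contraction]
  split_ifs with hx
  · have hx0 : x ≠ 0 := by rintro rfl; simp at hx; omega
    have h' : s = 0 ∨ 0 ∈ l := by simpa [hx0, eq_comm] using h
    rw [hf _ _ (Or.inr (by simp; tauto)), correction, hf, sub_zero]
    rcases h' with rfl | h'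
    · simp
    · simp [h']
  · rfl

/-- The homotopy comes from the resolution of length one of the right module of second halves, the
quotient of `e_v A` by the submodule generated by `b`. Splitting the coefficient puts its second
half into the word, as in the bar resolution; when the product with the next letter falls into the
submodule generated by `b`, `correction` lifts it along `tail`. Since `contraction` needs one
letter, `f` must have degree at least two. -/
theorem coboundary_contraction (hf : Contracted f) {q t : ℕ} (ht : t < n)
    (hc : ∀ x l, l.length = q + 3 → hochschildCoboundary f x l = 0)
    (hv : ∀ x l, t < level x → f x l = 0) (x : MeshPath n) (hx : t ≤ level x)
    {l : List (MeshPath n)} (hl : l.length = q + 2) :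
    hochschildCoboundary (contraction f t) x l = f x l := by
  match l, hl with
  | s :: s' :: l, hl =>
  have hl' : l.length = q := by simpa using hl
  rcases hx.lt_or_eq with hx | hx
  · have h0 : ∀ y (l' : List (MeshPath n)), level x ≤ level y → contraction f t y l' = 0 := by
      rintro y (_ | ⟨a, l'⟩) hy
      · rfl
      · rw [contraction, if_neg (by omega)]
    rw [hv x _ hx, hochschildCoboundary, coboundary, h0 _ _ (level_mul_right x s),
      innerFaces_congr hl (F' := fun _ => 0) (H' := fun _ _ => 0) (fun l' _ => h0 _ _ le_rfl)
      (fun a l' _ => h0 _ _ (level_mul_left x a)), innerFaces_zero, sub_zero]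
  · have hx0 : x ≠ 0 := by rintro rfl; simp at hx; omega
    -- If `a` raises the level, the left side is zero by definition and the right side because `f`
    -- vanishes above level `t`.
    have hg : ∀ a y l', contraction f t (a * x) (y :: l') =
        f (a * left x) (right x :: y :: l') - correction f (a * left x) (right x * y) l' := by
      intro a y l'
      rw [contraction]
      split_ifs with h
      · obtain ⟨h1, h2⟩ := left_right_mul_left (h.trans hx)
        rw [h1, h2]
      · have := level_lt_mul_left (s := a) (x := x) (fun h' => h (h'.trans hx.symm))
        rw [correction, hv _ _ (hx ▸ this), hv _ _ (hx ▸ this), sub_zero]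
    have h1 := hc (left x) (right x :: s :: s' :: l) (by simp [hl'])
    rw [hochschildCoboundary, coboundary, innerFaces, innerFaces, left_mul_right] at h1
    rw [hochschildCoboundary, coboundary, innerFaces]
    have hx1 : ∀ y l', contraction f t x (y :: l') =
        f (left x) (right x :: y :: l') - correction f (left x) (right x * y) l' :=
      fun y l' => by rw [contraction, if_pos hx.symm]
    simp only [hg, hx1]
    rw [innerFaces_sub]
    -- Here the product with `s` does not begin with `b`: no correction in `s` appears, and the
    -- cocycle identity `h1` is enough.
    by_cases hT : tail (right x * s) = 0
    · have hz : ∀ v, correction f v (right x * s) = fun _ => 0 := fun v =>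
        funext fun l => correction_eq_zero hf v hT l
      simp only [hz]
      rw [innerFaces_zero]
      rcases right_mul_eq_zero_or hT with h | h
      · have h3 : x * s = 0 := by
          rw [← left_mul_right x, mul_assoc, h, mul_zero]
        rw [h3, contraction, if_neg (by simp; omega)]
        rw [h, hf _ (0 :: s' :: l) (by simp)] at h1
        rw [correction_eq_zero hf _ (by rw [← mul_assoc, h, zero_mul, tail_zero])]
        linear_combination -h1
      · obtain ⟨h3, h4, _⟩ := left_right_mul h
        rw [contraction, if_pos (h.trans hx.symm), h3, h4, mul_assoc (right x) s s']
        linear_combination -h1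
    -- Here `right x * s` begins with `b`. The cocycle identity at its `head` and `tail` replaces
    -- the face with `right x * s` as a letter by the corrections.
    · have h2 := hc (left x) (head (right x * s) :: tail (right x * s) :: s' :: l) (by simp [hl'])
      rw [hochschildCoboundary, coboundary, innerFaces, innerFaces, head_mul_tail hT,
        hv _ _ (hx ▸ level_lt_left_mul_head _ hx0)] at h2
      have h3 : level (x * s) ≠ level x := fun h => hT (left_right_mul h).2.2
      have h4 : contraction f t (x * s) (s' :: l) = 0 := by
        rw [contraction, if_neg (by omega)]
      rw [h4, ← mul_assoc, correction_mul hf _ _ hT]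
      unfold correction
      linear_combination h2 - h1

/-- The Hochschild cohomology of the Auslander algebra vanishes in degrees at least two. -/
theorem exists_coboundary_eq (hf : Contracted f) {q : ℕ}
    (hc : ∀ x l, l.length = q + 3 → hochschildCoboundary f x l = 0) :
    ∃ g : MeshPath n → List (MeshPath n) → k, Contracted g ∧
      ∀ x l, l.length = q + 2 → hochschildCoboundary g x l = f x l := by
  -- Induction on a level from which `f` vanishes: subtracting the coboundary of the contraction
  -- removes the top level.
  suffices h : ∀ t ≤ n, ∀ f : MeshPath n → List (MeshPath n) → k, Contracted f →
      (∀ x l, l.length = q + 3 → hochschildCoboundary f x l = 0) →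
      (∀ x l, t ≤ level x → f x l = 0) →
      ∃ g : MeshPath n → List (MeshPath n) → k, Contracted g ∧
        ∀ x l, l.length = q + 2 → hochschildCoboundary g x l = f x l by
    refine h n le_rfl f hf hc fun x l hx => ?_
    rcases x with _ | ⟨i, d, m, r, hd, hm, hr⟩
    · exact hf _ _ (Or.inl rfl)
    · exact absurd hm (not_lt.2 hx)
  intro t
  induction t with
  | zero =>
    intro _ f _ _ h0
    refine ⟨fun _ _ => 0, fun _ _ _ => rfl, fun x l _ => ?_⟩
    rw [h0 x l (Nat.zero_le _)]
    simpa using coboundary_smul (fun s x => s * x) (fun x s => x * s) (0 : k)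
      (fun (_ : MeshPath n) (_ : List (MeshPath n)) => (0 : k)) x l
  | succ t ih =>
    intro ht f hf hc hv
    have hg := coboundary_contraction hf ht hc hv
    have hgc := contracted_contraction (t := t) hf ht
    -- Vanishing from a given level is required for words of all lengths but known for the
    -- difference only in length `q + 2`; elsewhere the difference is replaced by zero.
    obtain ⟨f', hd, hd'⟩ : ∃ f' : MeshPath n → List (MeshPath n) → k, (∀ x l, l.length = q + 2 →
        f' x l = f x l - hochschildCoboundary (contraction f t) x l) ∧
        ∀ x l, l.length ≠ q + 2 → f' x l = 0 :=
      ⟨fun x l => if l.length = q + 2 then f x l - hochschildCoboundary (contraction f t) x l else 0,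
        fun _ _ hl => if_pos hl, fun _ _ hl => if_neg hl⟩
    obtain ⟨g, hg1, hg2⟩ := ih (by omega) f'
      (fun x l h => by
        by_cases hl : l.length = q + 2
        · rw [hd x l hl, hf x l h, contracted_coboundary hgc x l h, sub_zero]
        · exact hd' x l hl)
      (fun x l hl => by
        refine (coboundary_congr hd x hl).trans ?_
        rw [coboundary_sub]
        exact (congrArg₂ (· - ·) (hc x l hl) (coboundary_coboundary mul_assoc
          (fun _ _ _ => (mul_assoc _ _ _).symm) (fun _ _ _ => (mul_assoc _ _ _).symm) _ _ hl)).trans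
          (sub_zero _))
      fun x l hx => by
        by_cases hl : l.length = q + 2
        · rw [hd x l hl, hg x hx hl, sub_self]
        · exact hd' x l hl
    refine ⟨fun x l => g x l + contraction f t x l, fun x l h => ?_, fun x l hl => ?_⟩
    · exact (congrArg₂ (· + ·) (hg1 x l h) (hgc x l h)).trans (add_zero _)
    · rw [hochschildCoboundary, coboundary_add]
      exact (congrArg₂ (· + ·) ((hg2 x l hl).trans (hd x l hl)) rfl).trans (sub_add_cancel _ _)

end Exactness

end MeshPath

/-! ### The multiplicative basis of the Taft algebra -/

/-- The paths of length less than `n` in the oriented cycle with `n` vertices, together with zero: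
`path i l` has source `i` and length `l`. -/
inductive CyclePath (n : ℕ) : Type
  | zero : CyclePath n
  | path (i : ZMod n) (l : ℕ) (h : l < n) : CyclePath n

namespace CyclePath

variable {n : ℕ}

instance : Zero (CyclePath n) := ⟨zero⟩

/-- The path of length `l` with source `i`, which is zero if `l ≥ n`. -/
def mk (i : ZMod n) (l : ℕ) : CyclePath n := if h : l < n then path i l h else 0

instance : Mul (CyclePath n) :=
  ⟨fun
    | path i l _, path j m _ => if j = i + l then mk i (l + m) else 0
    | _, _ => 0⟩

theorem zero_mul' (x : CyclePath n) : 0 * x = 0 := rfl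

theorem mul_zero' (x : CyclePath n) : x * 0 = 0 := by cases x <;> rfl

theorem mk_eq_zero {i : ZMod n} {l : ℕ} (h : n ≤ l) : mk i l = 0 := dif_neg (not_lt.2 h)

theorem path_eq_mk (i : ZMod n) (l : ℕ) (h : l < n) : path i l h = mk i l := (dif_pos h).symm

theorem mk_ne_zero {i : ZMod n} {l : ℕ} (h : l < n) : mk i l ≠ 0 := by
  rw [← path_eq_mk i l h]; nofun

theorem mk_mul_mk (i j : ZMod n) (l m : ℕ) :
    mk i l * mk j m = if j = i + l then mk i (l + m) else 0 := by
  by_cases hl : l < n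
  · by_cases hm : m < n
    · rw [← path_eq_mk i l hl, ← path_eq_mk j m hm]; rfl
    · rw [mk_eq_zero (not_lt.1 hm), mul_zero', mk_eq_zero (by omega), ite_self]
  · rw [mk_eq_zero (not_lt.1 hl), zero_mul', mk_eq_zero (by omega), ite_self]

theorem mk_mul_mk_of_eq {i j : ZMod n} {l : ℕ} (m : ℕ) (h : j = i + l) :
    mk i l * mk j m = mk i (l + m) := by rw [mk_mul_mk, if_pos h]

theorem mk_mul_mk_of_ne {i j : ZMod n} {l : ℕ} (m : ℕ) (h : j ≠ i + l) :
    mk i l * mk j m = 0 := by rw [mk_mul_mk, if_neg h]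

theorem eq_zero_or_mk (x : CyclePath n) : x = 0 ∨ ∃ i l, l < n ∧ x = mk i l := by
  rcases x with _ | ⟨i, l, h⟩
  · exact Or.inl rfl
  · exact Or.inr ⟨i, l, h, path_eq_mk i l h⟩

instance : SemigroupWithZero (CyclePath n) where
  zero_mul := zero_mul'
  mul_zero := mul_zero'
  mul_assoc a b c := by
    rcases eq_zero_or_mk a with rfl | ⟨i, l, _, rfl⟩
    · rfl
    rcases eq_zero_or_mk b with rfl | ⟨j, m, _, rfl⟩
    · rw [mul_zero', zero_mul', mul_zero']
    rcases eq_zero_or_mk c with rfl | ⟨t, r, _, rfl⟩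
    · rw [mul_zero', mul_zero', mul_zero']
    by_cases h1 : j = i + l
    · by_cases h2 : t = j + m
      · rw [mk_mul_mk_of_eq _ h1, mk_mul_mk_of_eq _ h2, mk_mul_mk_of_eq _ h1, mk_mul_mk_of_eq,
          add_assoc]
        rw [h2, h1]; push_cast; ring
      · rw [mk_mul_mk_of_eq _ h1, mk_mul_mk_of_ne _ h2, mul_zero', mk_mul_mk_of_ne]
        rintro rfl
        exact h2 (by rw [h1]; push_cast; ring)
    · rw [mk_mul_mk_of_ne _ h1, zero_mul']
      by_cases h2 : t = j + m
      · rw [mk_mul_mk_of_eq _ h2, mk_mul_mk_of_ne _ h1]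
      · rw [mk_mul_mk_of_ne _ h2, mul_zero']

/-- The two-cocycle of the algebra `k Q / (paths of length ≥ 2 n)`, as an extension of the Taft
algebra by itself. -/
def overflow : CyclePath n → CyclePath n → CyclePath n
  | path i l _, path j m _ => if j = i + l ∧ n ≤ l + m then mk i (l + m - n) else 0
  | _, _ => 0

theorem overflow_zero_left (x : CyclePath n) : overflow 0 x = 0 := rfl

theorem overflow_zero_right (x : CyclePath n) : overflow x 0 = 0 := by cases x <;> rfl

theorem overflow_mk (i j : ZMod n) {l m : ℕ} (hl : l < n) (hm : m < n) :
    overflow (mk i l) (mk j m) = if j = i + l ∧ n ≤ l + m then mk i (l + m - n) else 0 := by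
  rw [← path_eq_mk i l hl, ← path_eq_mk j m hm]; rfl

/-! ### The overflow cocycle and the cap product -/

section Cap

variable {k : Type*} [CommRing k]

/-- Associativity of composition of paths of length less than `2 n`. For composable paths all
nonzero terms are `G` of the same path, of length `l + m + r - n`; the cases differ in whether `b c`
and `a b` overflow, and in each of them these terms cancel. -/
theorem overflow_cocycle (a b c : CyclePath n) {G : CyclePath n → k} (hG : G 0 = 0) :
    G (a * overflow b c) - G (overflow (a * b) c) + G (overflow a (b * c)) -
      G (overflow a b * c) = 0 := by
  rcases eq_zero_or_mk a with rfl | ⟨i, l, hl, rfl⟩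
  · simp [overflow_zero_left, hG]
  rcases eq_zero_or_mk b with rfl | ⟨j, m, hm, rfl⟩
  · simp [overflow_zero_left, overflow_zero_right, hG]
  rcases eq_zero_or_mk c with rfl | ⟨t, r, hr, rfl⟩
  · simp [overflow_zero_right, hG]
  rw [overflow_mk _ _ hl hm, overflow_mk _ _ hm hr]
  by_cases h1 : j = i + l
  · by_cases h2 : t = j + m
    · have h3 : t = i + ((l + m : ℕ) : ZMod n) := by rw [h2, h1]; push_cast; ring
      have hc : ∀ q, n ≤ q → ((q - n : ℕ) : ZMod n) = q := by
        intro q hq; rw [Nat.cast_sub hq]; simp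
      rw [mk_mul_mk_of_eq _ h1, mk_mul_mk_of_eq _ h2]
      by_cases hP : n ≤ m + r <;> by_cases hQ : n ≤ l + m
      · rw [if_pos ⟨h2, hP⟩, if_pos ⟨h1, hQ⟩, mk_eq_zero hP, mk_eq_zero hQ, overflow_zero_left,
          overflow_zero_right, mk_mul_mk_of_eq _ h1, mk_mul_mk_of_eq _ (by rw [hc _ hQ, h3]),
          show l + (m + r - n) = l + m - n + r by omega]
        ring
      · rw [if_pos ⟨h2, hP⟩, if_neg (by tauto), mk_eq_zero hP, overflow_zero_right,
          overflow_mk _ _ (by omega) hr, if_pos ⟨h3, by omega⟩, mk_mul_mk_of_eq _ h1, zero_mul,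
          show l + (m + r - n) = l + m + r - n by omega]
        ring
      · rw [if_neg (by tauto), if_pos ⟨h1, hQ⟩, mk_eq_zero hQ, overflow_zero_left,
          overflow_mk _ _ hl (by omega), if_pos ⟨h1, by omega⟩,
          mk_mul_mk_of_eq _ (by rw [hc _ hQ, h3]), mul_zero,
          show l + (m + r) - n = l + m - n + r by omega]
        ring
      · rw [if_neg (by tauto), if_neg (by tauto), overflow_mk _ _ hl (by omega),
          overflow_mk _ _ (by omega) hr, mul_zero, zero_mul, add_assoc]
        simp only [h1, h3, true_and]
        ring
    · have h3 : t ≠ i + ((l + m : ℕ) : ZMod n) := by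
        rintro rfl
        exact h2 (by rw [h1]; push_cast; ring)
      rw [mk_mul_mk_of_eq _ h1, mk_mul_mk_of_ne _ h2, overflow_zero_right, if_neg (by tauto),
        mul_zero, hG]
      have h4 : overflow (mk i (l + m)) (mk t r) = 0 := by
        by_cases hQ : l + m < n
        · rw [overflow_mk _ _ hQ hr, if_neg (by tauto)]
        · rw [mk_eq_zero (not_lt.1 hQ), overflow_zero_left]
      rw [h4]
      split_ifs with h5
      · rw [mk_mul_mk_of_ne, hG]; ring
        rw [Nat.cast_sub h5.2]
        simpa using h3
      · rw [zero_mul, hG]; ring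
  · have h4 : mk i l * (if t = j + m ∧ n ≤ m + r then mk j (m + r - n) else 0) = 0 := by
      split_ifs with h5
      · rw [mk_mul_mk_of_ne _ h1]
      · rw [mul_zero]
    have h5 : overflow (mk i l) (mk j m * mk t r) = 0 := by
      by_cases h2 : t = j + m
      · rw [mk_mul_mk_of_eq _ h2]
        by_cases hQ : m + r < n
        · rw [overflow_mk _ _ hl hQ, if_neg (by tauto)]
        · rw [mk_eq_zero (not_lt.1 hQ), overflow_zero_right]
      · rw [mk_mul_mk_of_ne _ h2, overflow_zero_right]
    have h6 : (if j = i + l ∧ n ≤ l + m then mk i (l + m - n) else 0) * mk t r = 0 := by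
      rw [if_neg (fun h => h1 h.1), zero_mul]
    rw [mk_mul_mk_of_ne _ h1, overflow_zero_left, h4, h5, h6, hG]; ring

/-- The cap product with the cocycle `overflow`. -/
def cap (f : CyclePath n → List (CyclePath n) → k) : CyclePath n → List (CyclePath n) → k
  | x, a :: b :: l => f (x * overflow a b) l
  | _, _ => 0

theorem contracted_cap {f : CyclePath n → List (CyclePath n) → k} (hf : Contracted f) :
    Contracted (cap f) := by
  rintro x (_ | ⟨a, _ | ⟨b, l⟩⟩) h
  · rfl
  · rfl
  · refine hf _ _ ?_
    rcases h with rfl | h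
    · exact Or.inl (zero_mul _)
    · rw [List.mem_cons, List.mem_cons] at h
      rcases h with h | h | h
      · exact Or.inl (by rw [← h, overflow_zero_left, mul_zero])
      · exact Or.inl (by rw [← h, overflow_zero_right, mul_zero])
      · exact Or.inr h

/-- Faces away from the first three letters agree on both sides; the others differ by the cocycle
identity for `overflow` under `z ↦ f (x * z) l`. -/
theorem coboundary_cap {f : CyclePath n → List (CyclePath n) → k} (hf : Contracted f)
    (x a b c : CyclePath n) (l : List (CyclePath n)) :
    hochschildCoboundary (cap f) x (a :: b :: c :: l) =
      cap (hochschildCoboundary f) x (a :: b :: c :: l) := by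
  have h := overflow_cocycle a b c (G := fun z => f (x * z) l) (hf _ _ (Or.inl (mul_zero _)))
  rw [cap, hochschildCoboundary, hochschildCoboundary, coboundary, coboundary, innerFaces, innerFaces]
  simp only [cap, mul_assoc] at h ⊢
  linear_combination h

theorem contracted_cap_iterate {f : CyclePath n → List (CyclePath n) → k} (hf : Contracted f)
    (c : ℕ) : Contracted (cap^[c] f) := by
  induction c with
  | zero => exact hf
  | succ c ih => rw [Function.iterate_succ_apply']; exact contracted_cap ih

theorem cap_congr {f g : CyclePath n → List (CyclePath n) → k} {q : ℕ}
    (h : ∀ x l, l.length = q → f x l = g x l) (x : CyclePath n) {l : List (CyclePath n)}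
    (hl : l.length = q + 2) : cap f x l = cap g x l := by
  match l, hl with
  | a :: b :: l, hl => exact h _ _ (by simpa using hl)

theorem cap_iterate_coboundary {f : CyclePath n → List (CyclePath n) → k} (hf : Contracted f)
    {q : ℕ} (c : ℕ) (x : CyclePath n) {l : List (CyclePath n)} (hl : l.length = q + 1 + 2 * c) :
    cap^[c] (hochschildCoboundary f) x l = hochschildCoboundary (cap^[c] f) x l := by
  induction c generalizing x l with
  | zero => rfl
  | succ c ih =>
    rw [Function.iterate_succ_apply', Function.iterate_succ_apply', cap_congr (fun x l hl => ih x hl) x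
      (by rw [hl]; ring)]
    match l, hl with
    | a :: b :: d :: l, hl => exact (coboundary_cap (contracted_cap_iterate hf c) x a b d l).symm
    | [a, b], hl => simp at hl; omega
    | [a], hl => simp at hl; omega
    | [], hl => simp at hl

end Cap

end CyclePath

/-! ### Lowering the degree of a cocycle by two -/

namespace CyclePath

variable {n : ℕ} {k : Type*} [CommRing k]

/-- The trivial path at the target of a path. -/
def endpoint : CyclePath n → CyclePath n
  | zero => 0
  | path i l _ => mk (i + (l : ZMod n)) 0

theorem endpoint_mk {i : ZMod n} {l : ℕ} (h : l < n) : endpoint (mk i l) = mk (i + (l : ZMod n)) 0 := by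
  rw [← path_eq_mk i l h]; rfl

theorem mul_endpoint (x : CyclePath n) : x * endpoint x = x := by
  rcases eq_zero_or_mk x with rfl | ⟨i, l, hl, rfl⟩
  · rfl
  · rw [endpoint_mk hl, mk_mul_mk_of_eq _ rfl, add_zero]

theorem endpoint_mul {x y : CyclePath n} (h : x * y ≠ 0) : endpoint (x * y) = endpoint y := by
  rcases eq_zero_or_mk x with rfl | ⟨i, l, hl, rfl⟩
  · exact absurd rfl h
  rcases eq_zero_or_mk y with rfl | ⟨j, m, hm, rfl⟩
  · exact absurd (mul_zero _) h
  by_cases h1 : j = i + l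
  · rw [mk_mul_mk_of_eq _ h1] at h ⊢
    have h2 : l + m < n := by
      by_contra h2
      exact h (mk_eq_zero (not_lt.1 h2))
    rw [endpoint_mk h2, endpoint_mk hm, h1]
    congr 1; push_cast; ring
  · exact absurd (mk_mul_mk_of_ne _ h1) h

/-- The sum of the values of a cochain at the decompositions `y x₀ ⊗ x ⊗ x₁` of a path `a = x₀ x x₁`
with an arrow `x` in the middle. -/
def spread (f : CyclePath n → List (CyclePath n) → k) (y : CyclePath n) :
    CyclePath n → List (CyclePath n) → k
  | zero, _ => 0
  | path i m _, l =>
    ∑ j ∈ Finset.range m, f (y * mk i j) (mk (i + (j : ZMod n)) 1 :: mk (i + (j : ZMod n) + 1) (m - 1 - j) :: l)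

/-- The cochain which is lifted to a given cocycle by the cap product with `overflow`. -/
def lower (f : CyclePath n → List (CyclePath n) → k) : CyclePath n → List (CyclePath n) → k
  | zero, _ => 0
  | path i m _, l => ∑ b ∈ Finset.range n,
      f (mk i (m + n - 1 - b)) (mk (i + (m : ZMod n) - 1 - (b : ZMod n)) 1 :: mk (i + (m : ZMod n) - (b : ZMod n)) b :: l)

/-- The cochain whose coboundary is the difference between a cocycle and a cap product. -/
def lowerHomotopy (f : CyclePath n → List (CyclePath n) → k) :
    CyclePath n → List (CyclePath n) → k
  | _, [] => 0
  | y, a :: l => f y (endpoint y :: a :: l) - spread f y a l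

variable {f : CyclePath n → List (CyclePath n) → k}

theorem spread_mk {i : ZMod n} {m : ℕ} (hm : m < n) (y : CyclePath n) (l : List (CyclePath n)) :
    spread f y (mk i m) l =
      ∑ j ∈ Finset.range m, f (y * mk i j) (mk (i + (j : ZMod n)) 1 :: mk (i + (j : ZMod n) + 1) (m - 1 - j) :: l) := by
  rw [← path_eq_mk i m hm]; rfl

theorem spread_zero (y : CyclePath n) (l : List (CyclePath n)) : spread f y 0 l = 0 := rfl

theorem lower_zero (l : List (CyclePath n)) : lower f 0 l = 0 := rfl

theorem lower_mk (hf : Contracted f) (i : ZMod n) (m : ℕ) (l : List (CyclePath n)) :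
    lower f (mk i m) l = ∑ b ∈ Finset.range n,
      f (mk i (m + n - 1 - b)) (mk (i + (m : ZMod n) - 1 - (b : ZMod n)) 1 :: mk (i + (m : ZMod n) - (b : ZMod n)) b :: l) := by
  by_cases hm : m < n
  · rw [← path_eq_mk i m hm]; rfl
  · rw [mk_eq_zero (not_lt.1 hm), lower_zero, Finset.sum_eq_zero]
    intro b hb
    have := Finset.mem_range.1 hb
    -- For `m ≥ n` each coefficient is a path of length `m + n - 1 - b ≥ n`.
    exact hf _ _ (Or.inl (mk_eq_zero (by omega)))

theorem contracted_lower (hf : Contracted f) : Contracted (lower f) := by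
  rintro (_ | ⟨i, m, hm⟩) l h
  · rfl
  · rw [path_eq_mk, lower_mk hf, Finset.sum_eq_zero]
    intro b _
    refine hf _ _ (Or.inr ?_)
    have : 0 ∈ l := h.resolve_left nofun
    simp [this]

theorem contracted_lowerHomotopy (hf : Contracted f) : Contracted (lowerHomotopy f) := by
  rintro y (_ | ⟨a, l⟩) h
  · rfl
  rw [lowerHomotopy, hf _ _ (by simp only [List.mem_cons] at h ⊢; tauto), zero_sub, neg_eq_zero]
  rcases eq_zero_or_mk a with rfl | ⟨i, m, hm, rfl⟩
  · rfl
  rw [spread_mk hm, Finset.sum_eq_zero]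
  intro j _
  have h0 : (0 : CyclePath n) ≠ mk i m := (mk_ne_zero hm).symm
  rcases h with rfl | h
  · exact hf _ _ (Or.inl (zero_mul _))
  · have : 0 ∈ l := (List.mem_cons.1 h).resolve_left h0
    exact hf _ _ (Or.inr (by simp [this]))

/-- The cost of moving the letter `p` from the word into the coefficient. Applied with `p` an arrow,
the left side telescopes along a path. -/
theorem cocycle_split {q : ℕ} (hc : ∀ x l, l.length = q → hochschildCoboundary f x l = 0)
    (v p w b : CyclePath n) {l : List (CyclePath n)} (hl : l.length + 3 = q) :
    f v (p * w :: b :: l) - f (v * p) (w :: b :: l) = f v (p :: w * b :: l) -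
      innerFaces (fun l => f v (p :: w :: l)) (fun s l => f (s * v) (p :: w :: l)) (b :: l) := by
  have h := hc v (p :: w :: b :: l) (by simpa using hl)
  rw [hochschildCoboundary, coboundary, innerFaces, innerFaces] at h
  linear_combination -h

/-- The sum in `lower` runs over the cuts, at an arrow, of a path of length `m + n`, as in the
periodic bimodule resolution of a truncated cycle. By `cocycle_split` the faces telescope, except
for those merging the end of the cut path with `s`; these give the sum for the path prolonged by
`s`, with the cut shifted. -/
theorem lower_cocycle (hf : Contracted f) {q : ℕ}
    (hc : ∀ x l, l.length = q + 3 → hochschildCoboundary f x l = 0) (x : CyclePath n)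
    {l : List (CyclePath n)} (hl : l.length = q + 1) : hochschildCoboundary (lower f) x l = 0 := by
  match l, hl with
  | s :: l, hl =>
  have hl' : l.length + 3 = q + 3 := by simpa using hl
  rcases eq_zero_or_mk x with rfl | ⟨i, m, hm, rfl⟩
  · exact contracted_coboundary (contracted_lower hf) _ _ (Or.inl rfl)
  have hL : ∀ a l', lower f (a * mk i m) l' = ∑ b ∈ Finset.range n,
      f (a * mk i (m + n - 1 - b)) (mk (i + (m : ZMod n) - 1 - (b : ZMod n)) 1 :: mk (i + (m : ZMod n) - (b : ZMod n)) b :: l') := by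
    intro a l'
    rcases eq_zero_or_mk a with rfl | ⟨t, r, hr, rfl⟩
    · simp only [zero_mul, lower_zero]
      rw [Finset.sum_eq_zero fun b _ => hf _ _ (Or.inl rfl)]
    by_cases h : i = t + r
    · rw [mk_mul_mk_of_eq _ h, lower_mk hf]
      refine Finset.sum_congr rfl fun b hb => ?_
      have := Finset.mem_range.1 hb
      rw [mk_mul_mk_of_eq _ h, show r + m + n - 1 - b = r + (m + n - 1 - b) by omega, h]
      push_cast
      simp only [add_assoc]
    · rw [mk_mul_mk_of_ne _ h, lower_zero, Finset.sum_eq_zero]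
      intro b _
      rw [mk_mul_mk_of_ne _ h, hf _ _ (Or.inl rfl)]
  have hL1 : lower f (mk i m) = fun l' => ∑ b ∈ Finset.range n,
      f (mk i (m + n - 1 - b)) (mk (i + (m : ZMod n) - 1 - (b : ZMod n)) 1 :: mk (i + (m : ZMod n) - (b : ZMod n)) b :: l') :=
    funext fun l' => lower_mk hf i m l'
  rw [hochschildCoboundary, coboundary]
  simp only [hL]
  rw [hL1, innerFaces_sum]
  -- The boundary terms of the telescope: in `U 0` the coefficient has length at least `n`, in `U n`
  -- the first letter has length `n`, so both vanish.
  let U : ℕ → k := fun b => f (mk i (m + n - b)) (mk (i + (m : ZMod n) - (b : ZMod n)) b :: s :: l)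
  have hU : ∀ b ∈ Finset.range n, innerFaces
      (fun l' => f (mk i (m + n - 1 - b)) (mk (i + (m : ZMod n) - 1 - (b : ZMod n)) 1 :: mk (i + (m : ZMod n) - (b : ZMod n)) b :: l'))
      (fun a l' => f (a * mk i (m + n - 1 - b)) (mk (i + (m : ZMod n) - 1 - (b : ZMod n)) 1 :: mk (i + (m : ZMod n) - (b : ZMod n)) b :: l'))
      (s :: l) = (U b - U (b + 1)) +
        f (mk i (m + n - 1 - b)) (mk (i + (m : ZMod n) - 1 - (b : ZMod n)) 1 :: mk (i + (m : ZMod n) - (b : ZMod n)) b * s :: l) := by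
    intro b hb
    have hb := Finset.mem_range.1 hb
    have h := cocycle_split hc (mk i (m + n - 1 - b)) (mk (i + (m : ZMod n) - 1 - (b : ZMod n)) 1) (mk (i + (m : ZMod n) - (b : ZMod n)) b) s hl'
    have e1 : mk i (m + n - 1 - b) * mk (i + (m : ZMod n) - 1 - (b : ZMod n)) 1 = mk i (m + n - b) := by
      rw [mk_mul_mk_of_eq, show m + n - 1 - b + 1 = m + n - b by omega]
      rw [show m + n - 1 - b = m + (n - 1 - b) by omega, Nat.cast_add, Nat.cast_sub (by omega),
        Nat.cast_sub (by omega)]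
      simp; ring
    have e2 : mk (i + (m : ZMod n) - 1 - (b : ZMod n)) 1 * mk (i + (m : ZMod n) - (b : ZMod n)) b = mk (i + (m : ZMod n) - ((b + 1 : ℕ) : ZMod n)) (b + 1) := by
      rw [mk_mul_mk_of_eq _ (by push_cast; ring)]
      congr 1
      · push_cast; ring
      · ring
    rw [e1, e2] at h
    simp only [U]
    rw [show m + n - (b + 1) = m + n - 1 - b by omega]
    linear_combination h
  rw [Finset.sum_congr rfl hU, Finset.sum_add_distrib, Finset.sum_range_sub']
  have hU0 : U 0 = 0 := hf _ _ (Or.inl (mk_eq_zero (by omega)))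
  have hUn : U n = 0 := hf _ _ (Or.inr (by simp [mk_eq_zero]))
  rw [hU0, hUn, sub_zero, zero_add, sub_eq_zero]
  rcases eq_zero_or_mk s with rfl | ⟨t, r, hr, rfl⟩
  · rw [mul_zero, lower_zero, Finset.sum_eq_zero]
    intro b _
    exact hf _ _ (Or.inr (by simp))
  by_cases h : t = i + m
  · rw [mk_mul_mk_of_eq _ h, lower_mk hf]
    -- The summands for the prolonged path. Terms with `b ≥ n` have a zero letter and terms with `b
    -- < r` a zero coefficient, so the summation range can be shifted by `r`.
    let V : ℕ → k := fun b => f (mk i (m + r + n - 1 - b))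
      (mk (i + ((m + r : ℕ) : ZMod n) - 1 - (b : ZMod n)) 1 :: mk (i + ((m + r : ℕ) : ZMod n) - (b : ZMod n)) b :: l)
    have h1 : ∑ b ∈ Finset.range (n + r), V b = ∑ b ∈ Finset.range n, V b := by
      rw [Finset.sum_range_add, add_eq_left]
      refine Finset.sum_eq_zero fun b _ => ?_
      exact hf _ _ (Or.inr (by simp [mk_eq_zero (show n ≤ n + b by omega)]))
    have h2 : ∑ b ∈ Finset.range (r + n), V b = ∑ b ∈ Finset.range n, V (r + b) := by
      rw [Finset.sum_range_add, add_eq_right]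
      refine Finset.sum_eq_zero fun b hb => ?_
      have := Finset.mem_range.1 hb
      exact hf _ _ (Or.inl (mk_eq_zero (by omega)))
    refine (h1.symm.trans ((congrArg (fun c => ∑ b ∈ Finset.range c, V b) (add_comm n r)).trans
      h2)).trans ?_
    refine Finset.sum_congr rfl fun b hb => ?_
    have := Finset.mem_range.1 hb
    simp only [V]
    rw [mk_mul_mk_of_eq _ (by rw [h]; ring), show m + r + n - 1 - (r + b) = m + n - 1 - b by omega,
      add_comm r b,
      show i + ((m + r : ℕ) : ZMod n) - 1 - ((b + r : ℕ) : ZMod n) = i + m - 1 - b by push_cast; ring,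
      show i + ((m + r : ℕ) : ZMod n) - ((b + r : ℕ) : ZMod n) = i + m - b by push_cast; ring]
  · rw [mk_mul_mk_of_ne _ h, lower_zero, Finset.sum_eq_zero]
    intro b _
    refine hf _ _ (Or.inr ?_)
    rw [mk_mul_mk_of_ne _ (by simpa using h)]
    simp

/-- After inserting the endpoint of `x`, the arrows of the first letter `a` are moved one by one
into the coefficient. This leaves sums over the arrows of `a`, `b` and `a * b`. They cancel when `a
* b` does not overflow; otherwise the third sum is empty and the first two form `lower f` at `x *
overflow a b`. -/
theorem cap_lower_add (hf : Contracted f) {q : ℕ}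
    (hc : ∀ x l, l.length = q + 3 → hochschildCoboundary f x l = 0) (x : CyclePath n)
    {l : List (CyclePath n)} (hl : l.length = q + 2) :
    f x l = cap (lower f) x l + hochschildCoboundary (lowerHomotopy f) x l := by
  match l, hl with
  | a :: b :: l, hl =>
  have hl' : l.length + 3 = q + 3 := by simpa using hl
  by_cases h0 : x = 0 ∨ 0 ∈ a :: b :: l
  · rw [hf _ _ h0, contracted_cap (contracted_lower hf) _ _ h0,
      contracted_coboundary (contracted_lowerHomotopy hf) _ _ h0, add_zero]
  obtain ⟨i, m, hm, rfl⟩ := (eq_zero_or_mk x).resolve_left fun h => h0 (Or.inl h)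
  obtain ⟨s, α, hα, rfl⟩ := (eq_zero_or_mk a).resolve_left fun h => h0 (Or.inr (by simp [h]))
  obtain ⟨t, β, hβ, rfl⟩ := (eq_zero_or_mk b).resolve_left fun h => h0 (Or.inr (by simp [h]))
  -- the normalization step
  have step1 : f (mk i m) (mk s α :: mk t β :: l) = f (mk i m) (endpoint (mk i m) * mk s α :: mk t β :: l)
      - innerFaces (fun l => f (mk i m) (endpoint (mk i m) :: l))
        (fun c l => f (c * mk i m) (endpoint (mk i m) :: l)) (mk s α :: mk t β :: l) := by
    have h := hc (mk i m) (endpoint (mk i m) :: mk s α :: mk t β :: l) (by simpa using hl)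
    rw [hochschildCoboundary, coboundary, mul_endpoint, innerFaces] at h
    linear_combination h
  have hσ : ∀ c l', f (c * mk i m) (endpoint (c * mk i m) :: l') =
      f (c * mk i m) (endpoint (mk i m) :: l') := by
    intro c l'
    by_cases h : c * mk i m = 0
    · rw [hf _ _ (Or.inl h), hf _ _ (Or.inl h)]
    · rw [endpoint_mul h]
  -- In `T j` the first `j` arrows of the first letter have been moved into the coefficient.
  let T : ℕ → k := fun j => f (mk i m * mk s j) (mk (s + (j : ZMod n)) (α - j) :: mk t β :: l)
  have hT0 : T 0 = f (mk i m) (endpoint (mk i m) * mk s α :: mk t β :: l) := by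
    simp only [T]
    rw [endpoint_mk hm, Nat.cast_zero, add_zero, Nat.sub_zero]
    by_cases h : s = i + m
    · rw [mk_mul_mk_of_eq _ h, mk_mul_mk_of_eq _ (by simpa using h), h, zero_add, add_zero]
    · rw [mk_mul_mk_of_ne _ h, mk_mul_mk_of_ne _ (by simpa using h), hf _ _ (Or.inl rfl),
        hf _ _ (Or.inr (by simp))]
  have hTα : T α = f (mk i m * mk s α) (endpoint (mk i m * mk s α) :: mk t β :: l) := by
    simp only [T]
    by_cases h : mk i m * mk s α = 0
    · rw [hf _ _ (Or.inl h), hf _ _ (Or.inl h)]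
    · rw [endpoint_mul h, endpoint_mk hα, Nat.sub_self]
  let E : ℕ → k := fun j => innerFaces
    (fun l => f (mk i m * mk s j) (mk (s + (j : ZMod n)) 1 :: mk (s + (j : ZMod n) + 1) (α - 1 - j) :: l))
    (fun c l => f (c * (mk i m * mk s j)) (mk (s + (j : ZMod n)) 1 :: mk (s + (j : ZMod n) + 1) (α - 1 - j) :: l))
    (mk t β :: l)
  have hT : T 0 - T α = ∑ j ∈ Finset.range α, (f (mk i m * mk s j)
      (mk (s + (j : ZMod n)) 1 :: mk (s + (j : ZMod n) + 1) (α - 1 - j) * mk t β :: l) - E j) := by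
    rw [← Finset.sum_range_sub']
    refine Finset.sum_congr rfl fun j hj => ?_
    have hj := Finset.mem_range.1 hj
    have h := cocycle_split hc (mk i m * mk s j) (mk (s + (j : ZMod n)) 1) (mk (s + (j : ZMod n) + 1) (α - 1 - j))
      (mk t β) hl'
    have e1 : mk (s + (j : ZMod n)) 1 * mk (s + (j : ZMod n) + 1) (α - 1 - j) =
        mk (s + (j : ZMod n)) (α - j) := by
      rw [mk_mul_mk_of_eq _ (by simp), show 1 + (α - 1 - j) = α - j by omega]
    rw [mul_assoc (mk i m), mk_mul_mk_of_eq (i := s) 1 rfl, e1] at h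
    simp only [T, E]
    rw [show α - (j + 1) = α - 1 - j by omega, Nat.cast_add, Nat.cast_one, ← add_assoc]
    exact h
  have hE : ∑ j ∈ Finset.range α, E j = innerFaces (fun l => spread f (mk i m) (mk s α) l)
      (fun c l => spread f (c * mk i m) (mk s α) l) (mk t β :: l) := by
    simp only [spread_mk hα, E, mul_assoc]
    rw [innerFaces_sum]
  rw [Finset.sum_sub_distrib, hE, hT0, hTα] at hT
  rw [hochschildCoboundary, coboundary]
  have hσ1 : lowerHomotopy f (mk i m) = fun l' => lowerHomotopy f (mk i m) l' := rfl
  rw [innerFaces]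
  simp only [lowerHomotopy, hσ]
  rw [innerFaces_sub]
  rw [innerFaces] at step1
  -- The rest is combinatorics of cut paths; the cocycle condition is not needed any more.
  suffices hD : ∑ j ∈ Finset.range α, f (mk i m * mk s j)
      (mk (s + (j : ZMod n)) 1 :: mk (s + (j : ZMod n) + 1) (α - 1 - j) * mk t β :: l) +
      spread f (mk i m * mk s α) (mk t β) l - spread f (mk i m) (mk s α * mk t β) l =
      cap (lower f) (mk i m) (mk s α :: mk t β :: l) by
    linear_combination step1 + hT + hD
  clear step1 hσ hT0 hTα hT hE E T hl h0 hc
  rw [cap, overflow_mk _ _ hα hβ]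
  have hz : ∀ (a : CyclePath n) l', spread f 0 a l' = 0 := by
    intro a l'
    rcases eq_zero_or_mk a with rfl | ⟨t, r, hr, rfl⟩
    · rfl
    · rw [spread_mk hr, Finset.sum_eq_zero]
      intro j _
      exact hf _ _ (Or.inl (zero_mul _))
  by_cases h1 : s = i + m
  swap
  · rw [mk_mul_mk_of_ne _ h1, hz, Finset.sum_eq_zero fun j _ => by
      rw [mk_mul_mk_of_ne _ h1, hf _ _ (Or.inl rfl)]]
    have e1 : spread f (mk i m) (mk s α * mk t β) l = 0 := by
      rw [mk_mul_mk]
      split_ifs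
      · by_cases h : α + β < n
        · rw [spread_mk h, Finset.sum_eq_zero fun j _ => by
            rw [mk_mul_mk_of_ne _ h1, hf _ _ (Or.inl rfl)]]
        · rw [mk_eq_zero (not_lt.1 h), spread_zero]
      · rfl
    rw [e1]
    split_ifs
    · rw [mk_mul_mk_of_ne _ h1, lower_zero]; ring
    · rw [mul_zero, lower_zero]; ring
  by_cases h2 : t = s + α
  swap
  · rw [mk_mul_mk_of_ne _ h2, spread_zero, if_neg (by tauto), mul_zero, lower_zero, spread_mk hβ,
      Finset.sum_eq_zero, Finset.sum_eq_zero]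
    · ring
    · intro j _
      rw [mul_assoc, mk_mul_mk_of_ne _ h2, mul_zero, hf _ _ (Or.inl rfl)]
    · intro j hj
      have hj := Finset.mem_range.1 hj
      refine hf _ _ (Or.inr ?_)
      rw [mk_mul_mk_of_ne]
      · simp
      · have : s + (j : ZMod n) + 1 + ((α - 1 - j : ℕ) : ZMod n) = s + α := by
          rw [Nat.sub_sub, Nat.cast_sub (by omega)]
          push_cast
          ring
        rwa [this]
  -- The cut at the `j`-th arrow of the concatenation of `a` and `b`, meaningful even if its length
  -- `α + β` is at least `n`.
  let term : ℕ → k := fun j => f (mk i (m + j))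
    (mk (s + (j : ZMod n)) 1 :: mk (s + (j : ZMod n) + 1) (α + β - 1 - j) :: l)
  have e1 : ∑ j ∈ Finset.range α, f (mk i m * mk s j) (mk (s + (j : ZMod n)) 1 ::
      mk (s + (j : ZMod n) + 1) (α - 1 - j) * mk t β :: l) = ∑ j ∈ Finset.range α, term j := by
    refine Finset.sum_congr rfl fun j hj => ?_
    have hj := Finset.mem_range.1 hj
    rw [mk_mul_mk_of_eq _ h1, mk_mul_mk_of_eq, show α - 1 - j + β = α + β - 1 - j by omega]
    rw [h2, Nat.sub_sub, Nat.cast_sub (by omega)]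
    push_cast
    ring
  have e2 : spread f (mk i m * mk s α) (mk t β) l = ∑ j ∈ Finset.range β, term (α + j) := by
    rw [spread_mk hβ]
    refine Finset.sum_congr rfl fun j hj => ?_
    have hj := Finset.mem_range.1 hj
    simp only [term]
    rw [mul_assoc, mk_mul_mk_of_eq _ h2, mk_mul_mk_of_eq _ h1,
      show α + β - 1 - (α + j) = β - 1 - j by omega, h2]
    push_cast
    simp only [add_assoc]
  rw [e1, e2, ← Finset.sum_range_add, mk_mul_mk_of_eq _ h2]
  by_cases h : α + β < n
  · rw [if_neg (by omega), mul_zero, lower_zero, spread_mk h, sub_eq_zero]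
    refine Finset.sum_congr rfl fun j hj => ?_
    rw [mk_mul_mk_of_eq _ h1]
  -- On overflow the cuts are counted from the end, `j = α + β - 1 - b`. The cuts with `b ≥ n` leave
  -- a zero letter; the others are those of `lower`.
  · rw [mk_eq_zero (not_lt.1 h), spread_zero, sub_zero, if_pos ⟨h2, not_lt.1 h⟩,
      mk_mul_mk_of_eq _ h1, lower_mk hf, ← Finset.sum_range_reflect,
      show α + β = n + (α + β - n) by omega, Finset.sum_range_add, add_eq_left.2]
    · refine Finset.sum_congr rfl fun b hb => ?_
      have hb := Finset.mem_range.1 hb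
      simp only [term]
      have e3 : n + (α + β - n) = α + β := by omega
      rw [e3, show m + (α + β - n) + n - 1 - b = m + (α + β - 1 - b) by omega,
        show α + β - 1 - (α + β - 1 - b) = b by omega]
      have e4 : s + ((α + β - 1 - b : ℕ) : ZMod n) = i + ((m + (α + β - n) : ℕ) : ZMod n) - 1 - b := by
        rw [h1, Nat.cast_add m, Nat.cast_sub (by omega), Nat.cast_sub (by omega),
          Nat.cast_sub (by omega)]
        simp
        ring
      rw [e4, sub_right_comm, sub_add_cancel]
    · refine Finset.sum_eq_zero fun b hb => ?_
      have hb := Finset.mem_range.1 hb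
      refine hf _ _ (Or.inr ?_)
      rw [mk_eq_zero (show n ≤ α + β - 1 - (n + (α + β - n) - 1 - (n + b)) by omega)]
      simp

end CyclePath

/-! ### Iterated cap products of traces -/

namespace CyclePath

variable {n : ℕ} {k : Type*} [CommRing k]

/-- Repeated use of `cap_lower_add` lowers the cocycle to degree zero; the errors are carried back
up because `cap` commutes with the coboundary. -/
theorem exists_cap_iterate (c : ℕ) {f : CyclePath n → List (CyclePath n) → k} (hf : Contracted f)
    (hc : ∀ x l, l.length = 2 * c + 1 → hochschildCoboundary f x l = 0) :
    ∃ f₀ g : CyclePath n → List (CyclePath n) → k, Contracted f₀ ∧ Contracted g ∧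
      (∀ x l, l.length = 1 → hochschildCoboundary f₀ x l = 0) ∧
      ∀ x l, l.length = 2 * c → f x l = cap^[c] f₀ x l + hochschildCoboundary g x l := by
  induction c generalizing f with
  | zero =>
    refine ⟨f, fun _ _ => 0, hf, fun _ _ _ => rfl, hc, fun x l hl => ?_⟩
    obtain rfl := List.length_eq_zero_iff.1 hl
    exact (add_zero _).symm
  | succ c ih =>
    obtain ⟨f₀, g, h1, h2, h3, h4⟩ := ih (contracted_lower hf)
      (lower_cocycle hf (q := 2 * c) (by simpa [mul_add] using hc))
    refine ⟨f₀, fun x l => cap g x l + lowerHomotopy f x l, h1, fun x l h => ?_, h3, fun x l hl => ?_⟩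
    · exact (congrArg₂ (· + ·) (contracted_cap h2 x l h)
        (contracted_lowerHomotopy hf x l h)).trans (add_zero _)
    have h5 : cap (lower f) x l = cap (cap^[c] f₀) x l + hochschildCoboundary (cap g) x l := by
      refine (cap_congr h4 x hl).trans ?_
      match l, hl with
      | a :: b :: d :: l, hl => rw [coboundary_cap h2]; rfl
      -- This is the case `c = 0`: coboundaries are zero on the empty word, and `cap g` is zero on
      -- words with one letter.
      | [a, b], hl => simp [cap, coboundary, innerFaces]
      | [a], hl => simp at hl; omega
      | [], hl => simp at hl
    rw [cap_lower_add hf (q := 2 * c) (by simpa [mul_add] using hc) x hl, h5,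
      hochschildCoboundary, hochschildCoboundary, hochschildCoboundary, coboundary_add,
      Function.iterate_succ_apply']
    ring

variable (k) in
/-- The number of times that the path of length `m` with source `j` passes through the arrow with
source `0`. -/
def passages (j : ZMod n) (m : ℕ) : k :=
  ∑ t ∈ Finset.range m, if j + (t : ZMod n) = 0 then 1 else 0

theorem passages_add (j : ZMod n) (m r : ℕ) :
    passages k j (m + r) = passages k j m + passages k (j + (m : ZMod n)) r := by
  simp only [passages, Finset.sum_range_add, Nat.cast_add, add_assoc]

/-- A full turn uses each arrow once; the arrow at `0` comes after `(-j).val` steps. -/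
theorem passages_self [NeZero n] (j : ZMod n) : passages k j n = 1 := by
  rw [passages, Finset.sum_eq_single (-j).val, if_pos]
  · simp
  · intro t ht h
    refine if_neg fun h1 => h ?_
    rw [← eq_neg_of_add_eq_zero_right h1, ZMod.val_natCast,
      Nat.mod_eq_of_lt (Finset.mem_range.1 ht)]
  · intro h
    exact absurd (Finset.mem_range.2 (ZMod.val_lt _)) h

variable (k) in
/-- A cochain whose coboundary is the cap product of `overflow` with the trace which is one on the
trivial paths. -/
def loopCochain : CyclePath n → List (CyclePath n) → k
  | path i l _, [path j m _] => if j = i + l ∧ l + m = n then passages k j m else 0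
  | _, _ => 0

theorem contracted_loopCochain : Contracted (loopCochain (n := n) k) := by
  rintro (_ | ⟨i, l, hl⟩) (_ | ⟨_ | ⟨j, m, hm⟩, _ | ⟨b, l⟩⟩) h <;> try rfl
  rcases h with h | h
  · cases h
  · rw [List.mem_singleton] at h; cases h

/-- The condition `m < n` is needed because `mk j n` is zero although `passages k j n` is one. No
condition on `l` is needed: `l = n` forces `m = 0`, with no passages. -/
theorem loopCochain_mk (i j : ZMod n) (l m : ℕ) : loopCochain k (mk i l) [mk j m] =
    if j = i + l ∧ l + m = n ∧ m < n then passages k j m else 0 := by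
  by_cases hl : l < n
  · by_cases hm : m < n
    · rw [← path_eq_mk i l hl, ← path_eq_mk j m hm]
      simp [loopCochain, hm]
    · rw [mk_eq_zero (not_lt.1 hm), if_neg (by tauto)]
      exact contracted_loopCochain _ _ (by simp)
  · rw [mk_eq_zero (not_lt.1 hl)]
    split_ifs with h
    · obtain rfl : m = 0 := by omega
      rw [contracted_loopCochain _ _ (by simp)]
      rfl
    · exact contracted_loopCochain _ _ (by simp)

/-- A path of length strictly between `0` and `n` is not closed, hence is a commutator with its
source; longer paths are zero. -/
theorem trace_mk {f : CyclePath n → List (CyclePath n) → k} (hf : Contracted f)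
    (hc : ∀ x l, l.length = 1 → hochschildCoboundary f x l = 0) (i : ZMod n) {l : ℕ} (hl : 0 < l) :
    f (mk i l) [] = 0 := by
  by_cases hln : l < n
  · have h := hc (mk i l) [mk i 0] rfl
    rw [hochschildCoboundary, coboundary, innerFaces, mk_mul_mk_of_ne, mk_mul_mk_of_eq _ (by simp),
      hf _ _ (Or.inl rfl), zero_add, zero_sub, neg_eq_zero] at h
    · exact h
    · intro h
      rw [left_eq_add, ZMod.natCast_eq_zero_iff] at h
      exact absurd (Nat.le_of_dvd hl h) (not_le.2 hln)
  · exact hf _ _ (Or.inl (mk_eq_zero (not_lt.1 hln)))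

/-- On a closed triple of total length `n`, the coboundary of `loopCochain` counts the passages of
`a` and of `b`, minus those of `a * b`. This is zero by additivity, unless `a * b` overflows to
zero; then `x` is a vertex, `a` and `b` make one full turn, and the value is one, as for the cap
product. -/
theorem cap_trace [NeZero n] {f : CyclePath n → List (CyclePath n) → k} (hf : Contracted f)
    (hc : ∀ x l, l.length = 1 → hochschildCoboundary f x l = 0) {κ : k}
    (hκ : ∀ i, f (mk i 0) [] = κ) (x a b : CyclePath n) :
    cap f x [a, b] = κ * hochschildCoboundary (loopCochain k) x [a, b] := by
  by_cases h0 : x = 0 ∨ 0 ∈ [a, b]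
  · rw [contracted_cap hf _ _ h0, contracted_coboundary contracted_loopCochain _ _ h0, mul_zero]
  obtain ⟨i, l, hl, rfl⟩ := (eq_zero_or_mk x).resolve_left fun h => h0 (Or.inl h)
  obtain ⟨j, m, hm, rfl⟩ := (eq_zero_or_mk a).resolve_left fun h => h0 (Or.inr (by simp [h]))
  obtain ⟨t, r, hr, rfl⟩ := (eq_zero_or_mk b).resolve_left fun h => h0 (Or.inr (by simp [h]))
  rw [cap, hochschildCoboundary, coboundary, innerFaces, innerFaces, overflow_mk _ _ hm hr]
  have hn0 : n ≠ 0 := NeZero.ne n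
  have e0 : ∀ {l m : ℕ}, l + m = n → (l : ZMod n) + m = 0 := by
    intro l m h
    rw [← Nat.cast_add, h, ZMod.natCast_self]
  have c0 : ∀ y : CyclePath n, loopCochain k y [0] = 0 := fun y =>
    contracted_loopCochain _ _ (by simp)
  have z0 : ∀ l : List (CyclePath n), loopCochain k 0 l = 0 := fun l =>
    contracted_loopCochain _ _ (Or.inl rfl)
  -- For a triple that does not close up to a path of length `n`, each term vanishes separately.
  by_cases hP : j = i + l ∧ t = j + m ∧ l + m + r = n
  · obtain ⟨h1, h2, h3⟩ := hP
    have h4 : i = t + r := by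
      have := e0 h3
      push_cast at this
      rw [h2, h1]
      linear_combination -this
    have h5 : t = i + ((l + m : ℕ) : ZMod n) := by rw [h2, h1]; push_cast; ring
    have h6 : j = t + ((r + l : ℕ) : ZMod n) := by rw [h1, h4]; push_cast; ring
    rw [mk_mul_mk_of_eq _ h1, mk_mul_mk_of_eq _ h2, mk_mul_mk_of_eq _ h4]
    have h9 : loopCochain k (mk i (l + m)) [mk t r] = passages k t r := by
      rw [loopCochain_mk, if_pos ⟨h5, by omega, hr⟩]
    have h10 : loopCochain k (mk t (r + l)) [mk j m] = passages k j m := by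
      rw [loopCochain_mk, if_pos ⟨h6, by omega, hm⟩]
    rw [h9, h10, loopCochain_mk]
    have h7 := passages_add (k := k) j m r
    rw [← h2] at h7
    by_cases h8 : n ≤ m + r
    · obtain rfl : l = 0 := by omega
      rw [if_pos ⟨h2, h8⟩, if_neg (by omega), mk_mul_mk_of_eq _ h1,
        show 0 + (m + r - n) = 0 by omega, hκ]
      rw [show m + r = n by omega, passages_self] at h7
      linear_combination κ * h7
    · rw [if_neg (by tauto), if_pos ⟨h1, by omega, by omega⟩, mul_zero, hf _ _ (Or.inl rfl)]
      linear_combination κ * h7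
  · have t1 : f (mk i l * if t = j + m ∧ n ≤ m + r then mk j (m + r - n) else 0) [] = 0 := by
      split_ifs with h
      · by_cases h1 : j = i + l
        · rw [mk_mul_mk_of_eq _ h1]
          refine trace_mk hf hc _ ?_
          by_contra h2
          exact hP ⟨h1, h.1, by omega⟩
        · rw [mk_mul_mk_of_ne _ h1, hf _ _ (Or.inl rfl)]
      · rw [mul_zero, hf _ _ (Or.inl rfl)]
    have t2 : loopCochain k (mk i l * mk j m) [mk t r] = 0 := by
      rw [mk_mul_mk]
      split_ifs with h1
      · rw [loopCochain_mk, if_neg]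
        rintro ⟨h2, h3, -⟩
        exact hP ⟨h1, by rw [h2, h1]; push_cast; ring, by omega⟩
      · exact z0 _
    have t3 : loopCochain k (mk i l) [mk j m * mk t r] = 0 := by
      rw [mk_mul_mk]
      split_ifs with h1
      · rw [loopCochain_mk, if_neg]
        rintro ⟨h2, h3, -⟩
        exact hP ⟨h2, h1, by omega⟩
      · exact c0 _
    have t4 : loopCochain k (mk t r * mk i l) [mk j m] = 0 := by
      rw [mk_mul_mk]
      split_ifs with h1
      · rw [loopCochain_mk, if_neg]
        rintro ⟨h2, h3, -⟩
        have := e0 h3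
        push_cast at h2 this
        refine hP ⟨by rw [h2, h1]; ring, by rw [h2]; linear_combination -this, by omega⟩
      · exact z0 _
    rw [t1, t2, t3, t4]
    ring

/-- The innermost cap product is a coboundary by `cap_trace`, and the remaining ones commute with
the coboundary. -/
theorem cap_iterate_trace [NeZero n] {f : CyclePath n → List (CyclePath n) → k} (hf : Contracted f)
    (hc : ∀ x l, l.length = 1 → hochschildCoboundary f x l = 0) {κ : k}
    (hκ : ∀ i, f (mk i 0) [] = κ) (c : ℕ) :
    ∃ g : CyclePath n → List (CyclePath n) → k, Contracted g ∧
      ∀ x l, l.length = 2 * (c + 1) → cap^[c + 1] f x l = hochschildCoboundary g x l := by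
  have hη : Contracted fun x l => κ * loopCochain (n := n) k x l := fun x l h => by
    change κ * loopCochain k x l = 0
    rw [contracted_loopCochain x l h, mul_zero]
  refine ⟨cap^[c] fun x l => κ * loopCochain k x l, contracted_cap_iterate hη c, fun x l hl => ?_⟩
  rw [← cap_iterate_coboundary hη (q := 1) c x (by omega), Function.iterate_succ_apply]
  have key : ∀ (c : ℕ) x (l : List (CyclePath n)), l.length = 2 * (c + 1) → cap^[c] (cap f) x l =
      cap^[c] (hochschildCoboundary fun x l => κ * loopCochain k x l) x l := by
    intro c
    induction c with
    | zero =>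
      intro x l hl
      obtain ⟨a, b, rfl⟩ := List.length_eq_two.1 hl
      refine (cap_trace hf hc hκ x a b).trans ?_
      exact (coboundary_smul _ _ κ (loopCochain k) x [a, b]).symm
    | succ c ih =>
      intro x l hl
      rw [Function.iterate_succ_apply', Function.iterate_succ_apply']
      exact cap_congr ih x hl
  exact key c x l hl

end CyclePath

end QuiverAlgebra

namespace CyclicHomology

/-! ### Clearing the rows of the cyclic bicomplex -/

section Generic

variable (k : Type*) [CommRing k] {M : ℕ → Type*} [∀ n, AddCommGroup (M n)] [∀ n, Module k (M n)]
  (δ : ∀ n, M (n + 1) →ₗ[k] M n) (τ : ∀ n, M n ≃ₗ[k] M n)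

/-- The cycle condition for a family of chains in the total degree `m`. -/
def IsTotCycle (m : ℕ) (z : ∀ q, M q) : Prop :=
  ∀ q c, c + q + 1 = m → vert k δ τ c q (z (q + 1)) + horiz k τ c q (z q) = 0

/-- The condition that a family of chains is a boundary in the total degree `m`. -/
def IsTotBoundary (m : ℕ) (z : ∀ q, M q) : Prop :=
  ∃ y : ∀ q, M q, ∀ q c, c + q = m → vert k δ τ c q (y (q + 1)) + horiz k τ c q (y q) = z q

/-- A cycle which vanishes below row `r` and which agrees in row `r` with the boundary of a chain
`y` that vanishes above row `r + 1` is homologous to a cycle which vanishes up to row `r`. -/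
theorem isTotBoundary_of_le (hτ : ∀ n, τ n ^ (n + 1) = 1) {m r : ℕ} {z : ∀ q, M q}
    (hz : IsTotCycle k δ τ m z) (y : ∀ q, M q) (hy : ∀ q, r + 1 < q → y q = 0)
    (h : ∀ q c, q ≤ r → c + q = m → vert k δ τ c q (y (q + 1)) + horiz k τ c q (y q) = z q)
    (ih : ∀ z, IsTotCycle k δ τ m z → (∀ q, q ≤ r → q ≤ m → z q = 0) → IsTotBoundary k δ τ m z) :
    IsTotBoundary k δ τ m z := by
  let d : ∀ q, M q := fun q => vert k δ τ (m - q) q (y (q + 1)) + horiz k τ (m - q) q (y q)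
  have hd : ∀ q c, c + q = m → d q = vert k δ τ c q (y (q + 1)) + horiz k τ c q (y q) := by
    intro q c hc
    obtain rfl : c = m - q := by omega
    rfl
  have h0 : ∀ q, q ≤ r → q ≤ m → d q = z q := fun q h1 h2 =>
    (hd q (m - q) (by omega)).trans (h q _ h1 (by omega))
  obtain ⟨w, hw⟩ := ih (fun q => z q - d q) (by
    intro q c hc
    rcases lt_or_ge q r with hq | hq
    · simp [h0 q (by omega) (by omega), h0 (q + 1) (by omega) (by omega)]
    -- From row `r` on, `y (q + 2)` is zero, and the remaining terms of `d` cancel since the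
    -- differentials anticommute.
    · have e1 : vert k δ τ c q (d (q + 1)) = - horiz k τ c q (vert k δ τ (c + 1) q (y (q + 1))) := by
        rw [hd (q + 1) c (by omega), hy (q + 2) (by omega), map_zero, zero_add, vert_horiz k δ τ hτ]
      have e2 : horiz k τ c q (d q) = horiz k τ c q (vert k δ τ (c + 1) q (y (q + 1))) := by
        rw [hd q (c + 1) (by omega), map_add, horiz_horiz k τ hτ, add_zero]
      rw [map_sub, map_sub, e1, e2, ← hz q c hc]
      abel) (fun q h1 h2 => by rw [h0 q h1 h2, sub_self])
  refine ⟨fun q => w q + y q, fun q c hc => ?_⟩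
  have : vert k δ τ c q (w (q + 1)) + horiz k τ c q (w q) = z q - d q := hw q c hc
  rw [hd q c hc] at this
  rw [map_add, map_add, add_add_add_comm, this]
  abel

/-- A cycle of even degree which vanishes in row `0` is a boundary, if the odd columns are exact and
Hochschild cycles of positive even degree lift to the total complex of the first three columns. -/
theorem isTotBoundary_of_zero (hτ : ∀ n, τ n ^ (n + 1) = 1) (s : ∀ q, M q →ₗ[k] M (q + 1))
    (hs : ∀ q x, bMap' k δ τ (q + 1) (s (q + 1) x) + s q (bMap' k δ τ q x) = x) {p : ℕ}
    (hb : ∀ j < p, ∀ z : M (2 * j + 2), bMap k δ τ (2 * j + 1) z = 0 →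
      ∃ (y : M (2 * j + 2)) (w : M (2 * j + 3)) (x : M (2 * j + 1)),
        (1 - tMap k τ (2 * j + 2)) y + bMap k δ τ (2 * j + 2) w = z ∧
        bMap' k δ τ (2 * j + 1) y = normMap k τ (2 * j + 1) x ∧ bMap k δ τ (2 * j) x = 0)
    {z : ∀ q, M q} (hz : IsTotCycle k δ τ (2 * p) z) (hz0 : z 0 = 0) :
    IsTotBoundary k δ τ (2 * p) z := by
  -- Induction on the number `d` of rows still to be cleared above row `r`.
  suffices H : ∀ d r (z : ∀ q, M q), r + d = 2 * p → IsTotCycle k δ τ (2 * p) z →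
      (∀ q, q ≤ r → q ≤ 2 * p → z q = 0) → IsTotBoundary k δ τ (2 * p) z by
    refine H (2 * p) 0 z (by omega) hz fun q hq _ => ?_
    obtain rfl := Nat.le_zero.1 hq
    exact hz0
  intro d
  induction d with
  | zero =>
    intro r z hr hz h
    refine ⟨fun _ => 0, fun q c hc => ?_⟩
    rw [h q (by omega) (by omega), map_zero, map_zero, add_zero]
  | succ d ih =>
    intro r z hr hz h
    have hv : ∀ c, c + r + 1 = 2 * p → vert k δ τ c r (z (r + 1)) = 0 := by
      intro c hc
      have := hz r c hc
      rwa [h r le_rfl (by omega), map_zero, add_zero] at this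
    have hv' := hv (2 * p - (r + 1)) (by omega)
    rcases Nat.even_or_odd' r with ⟨j, rfl | rfl⟩
    -- Row `2 j + 1` lies in an odd column, with differential `-b'`; this explains the sign of the
    -- correcting chain.
    · have hc : ¬ Even (2 * p - (2 * j + 1)) := by
        rw [Nat.even_sub (by omega)]; simp
      rw [vert, if_neg hc, LinearMap.neg_apply, neg_eq_zero] at hv'
      refine isTotBoundary_of_le k δ τ hτ (r := 2 * j + 1) hz
        (Pi.single (2 * j + 2) (-s (2 * j + 1) (z (2 * j + 1)))) (fun q hq => ?_)
        (fun q c hq hc => ?_) fun z hz h => ih _ z (by omega) hz h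
      · exact Pi.single_eq_of_ne (by omega) _
      · rw [Pi.single_eq_of_ne (show q ≠ 2 * j + 2 by omega), map_zero, add_zero]
        rcases hq.lt_or_eq with hq | rfl
        · rw [Pi.single_eq_of_ne (by omega), map_zero, h q (by omega) (by omega)]
        · have hc : ¬ Even c := by
            obtain rfl : c = 2 * p - (2 * j + 1) := by omega
            assumption
          rw [Pi.single_eq_same, vert, if_neg hc, LinearMap.neg_apply, map_neg, neg_neg]
          have := hs (2 * j) (z (2 * j + 1))
          rwa [hv', map_zero, add_zero] at this
    -- Row `2 j + 2` lies in an even column `c`. Put `w` in column `c`, `y` in column `c + 1`, `x`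
    -- in column `c + 2`: in row `2 j + 1` the term `-b' y` is cancelled by `N x`, and in row `2 j`
    -- one has `b x = 0`.
    · have hc : Even (2 * p - (2 * j + 1 + 1)) := by
        rw [Nat.even_sub (by omega)]; simp [Nat.even_add_one]
      rw [vert, if_pos hc] at hv'
      obtain ⟨y, w, x, h1, h2, h3⟩ := hb j (by omega) _ hv'
      let Y : ∀ q, M q := Pi.single (2 * j + 3) w + Pi.single (2 * j + 2) y + Pi.single (2 * j + 1) x
      have y0 : ∀ q, q ≠ 2 * j + 3 → q ≠ 2 * j + 2 → q ≠ 2 * j + 1 → Y q = 0 := by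
        intro q h1 h2 h3
        simp [Y, Pi.single_eq_of_ne h1, Pi.single_eq_of_ne h2, Pi.single_eq_of_ne h3]
      have y1 : Y (2 * j + 1) = x := by simp [Y]
      have y2 : Y (2 * j + 2) = y := by simp [Y]
      have y3 : Y (2 * j + 3) = w := by simp [Y]
      refine isTotBoundary_of_le k δ τ hτ (r := 2 * j + 1 + 1) hz Y (fun q hq => ?_)
        (fun q c hq hc => ?_) fun z hz h => ih _ z (by omega) hz h
      · exact y0 q (by omega) (by omega) (by omega)
      · have par : Even c ↔ Even q := by
          rw [show c = 2 * p - q by omega, Nat.even_sub (by omega)]; simp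
        by_cases q3 : q = 2 * j + 1 + 1
        · subst q3
          have hc : Even c := by rw [par]; simp [Nat.even_add_one]
          rw [vert, horiz, if_pos hc, if_pos hc, y3, y2]
          exact (add_comm _ _).trans h1
        by_cases q2 : q = 2 * j + 1
        · subst q2
          have hc : ¬ Even c := by rw [par]; simp
          rw [vert, horiz, if_neg hc, if_neg hc, y2, y1, LinearMap.neg_apply, h2, neg_add_cancel,
            h _ le_rfl (by omega)]
        by_cases q1 : q = 2 * j
        · subst q1
          have hc : Even c := by rw [par]; simp
          rw [vert, if_pos hc, y1, y0 _ (by omega) (by omega) (by omega), map_zero, h3, add_zero,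
            h _ (by omega) (by omega)]
        · rw [y0 q (by omega) (by omega) (by omega), y0 (q + 1) (by omega) (by omega) (by omega),
            map_zero, map_zero, add_zero, h _ (by omega) (by omega)]

/-- A criterion for the classes of the cycles `sigmaChain` to span the homology in degree `2 p`. -/
theorem span_sigmaChain_eq_top (hτ : ∀ n, τ n ^ (n + 1) = 1) (s : ∀ q, M q →ₗ[k] M (q + 1))
    (hs : ∀ q x, bMap' k δ τ (q + 1) (s (q + 1) x) + s q (bMap' k δ τ q x) = x) {p : ℕ}
    (hb : ∀ j < p, ∀ z : M (2 * j + 2), bMap k δ τ (2 * j + 1) z = 0 →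
      ∃ (y : M (2 * j + 2)) (w : M (2 * j + 3)) (x : M (2 * j + 1)),
        (1 - tMap k τ (2 * j + 2)) y + bMap k δ τ (2 * j + 2) w = z ∧
        bMap' k δ τ (2 * j + 1) y = normMap k τ (2 * j + 1) x ∧ bMap k δ τ (2 * j) x = 0)
    {V : Type*} [Fintype V] (e : V → ∀ q, M q) (hδ : ∀ v q, δ q (e v (q + 1)) = e v q)
    (hrot : ∀ v q, τ q (e v q) = e v q)
    (h0 : ∀ z : M 0, ∃ (c : V → k) (w : M 1), z = ∑ v, c v • e v 0 + bMap k δ τ 0 w) :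
    Submodule.span k (Set.range fun v => (Submodule.Quotient.mk
      ⟨sigmaChain (e v) (2 * p), sigmaChain_mem_cycles k δ τ (hδ v) (hrot v) p⟩ :
        TotHomology k δ τ (2 * p))) = ⊤ := by
  rw [eq_top_iff]
  rintro ζ -
  obtain ⟨⟨z, hz⟩, rfl⟩ := Submodule.Quotient.mk_surjective _ ζ
  let Z : ∀ q, M q := fun q => if h : q < 2 * p + 1 then z ⟨q, h⟩ else 0
  have hZz : ∀ q : Fin (2 * p + 1), Z q = z q := fun q => dif_pos q.isLt
  have hZ : IsTotCycle k δ τ (2 * p) Z := by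
    intro q c hc
    obtain ⟨m, hm⟩ : ∃ m, 2 * p = m + 1 := ⟨c + q, hc.symm⟩
    have key : ∀ m' (z : Tot M m'), m' = m + 1 → z ∈ cycles k δ τ m' →
        vert k δ τ c q (if h : q + 1 < m' + 1 then z ⟨q + 1, h⟩ else 0) +
          horiz k τ c q (if h : q < m' + 1 then z ⟨q, h⟩ else 0) = 0 := by
      rintro _ z rfl hz
      have h1 : totD k δ τ m z = 0 := hz
      have h2 := congrFun h1 (⟨q, by omega⟩ : Fin (m + 1))
      rw [dif_pos (by omega), dif_pos (by omega)]
      obtain rfl : c = m - q := by omega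
      exact h2
    exact key _ z hm hz
  obtain ⟨c, w, hw⟩ := h0 (Z 0)
  -- The coefficients are read off in row `0`, where `sigmaCoeff 0 = 1`.
  let S : ∀ q, M q := fun q => ∑ v, c v • sigmaCoeff q • e v q
  have hS0 : S 0 = ∑ v, c v • e v 0 := by
    have : sigmaCoeff 0 = 1 := by simp [sigmaCoeff, yCoeff]
    simp [S, this]
  have hS : IsTotCycle k δ τ (2 * p) S := by
    intro q c' hc
    have hodd : Odd (c' + q) := by
      rw [← Nat.not_even_iff_odd]
      intro h
      have : Even (c' + q + 1) := by rw [hc]; simp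
      exact (Nat.even_add_one.1 this) h
    simp only [S, map_sum, map_smul]
    rw [← Finset.sum_add_distrib, Finset.sum_eq_zero]
    intro v _
    rw [← smul_add, sigma_rel k δ τ (hδ v) (hrot v) hodd, smul_zero]
  obtain ⟨y, hy⟩ : IsTotBoundary k δ τ (2 * p) fun q => Z q - S q := by
    -- Row `0` of the difference is `b w`, so `w` in row `1` clears it.
    refine isTotBoundary_of_le k δ τ hτ (r := 0) (fun q c hc => ?_) (Pi.single 1 w)
      (fun q hq => Pi.single_eq_of_ne (by omega) _) (fun q c hq hc => ?_)
      (fun z hz h => isTotBoundary_of_zero k δ τ hτ s hs hb hz (h 0 le_rfl (Nat.zero_le _)))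
    · rw [map_sub, map_sub, sub_add_sub_comm, hZ q c hc, hS q c hc, sub_zero]
    · obtain rfl := Nat.le_zero.1 hq
      obtain rfl : c = 2 * p := hc
      rw [Pi.single_eq_same, Pi.single_eq_of_ne (by omega), map_zero, vert, if_pos (by simp), hw,
        hS0, add_zero, add_sub_cancel_left]
  have hfinal : (Submodule.Quotient.mk ⟨z, hz⟩ : TotHomology k δ τ (2 * p)) =
      ∑ v, c v • (Submodule.Quotient.mk
        ⟨sigmaChain (e v) (2 * p), sigmaChain_mem_cycles k δ τ (hδ v) (hrot v) p⟩ :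
          TotHomology k δ τ (2 * p)) := by
    have e1 : (∑ v, c v • (Submodule.Quotient.mk
        ⟨sigmaChain (e v) (2 * p), sigmaChain_mem_cycles k δ τ (hδ v) (hrot v) p⟩ :
          TotHomology k δ τ (2 * p))) = Submodule.Quotient.mk (∑ v, c v •
        ⟨sigmaChain (e v) (2 * p), sigmaChain_mem_cycles k δ τ (hδ v) (hrot v) p⟩) := by
      rw [← Submodule.mkQ_apply, map_sum]
      rfl
    rw [e1]
    refine (Submodule.Quotient.eq _).2 ⟨fun q => y q, ?_⟩
    ext q
    have h1 := hy q (2 * p - q) (by omega)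
    have h2 : (((∑ v, c v • ⟨sigmaChain (e v) (2 * p),
        sigmaChain_mem_cycles k δ τ (hδ v) (hrot v) p⟩ : cycles k δ τ (2 * p)) :
          Tot M (2 * p)) q) = S q := by
      rw [Submodule.coe_sum, Finset.sum_apply]
      rfl
    change _ = z q - (((∑ v, c v • ⟨sigmaChain (e v) (2 * p),
        sigmaChain_mem_cycles k δ τ (hδ v) (hrot v) p⟩ : cycles k δ τ (2 * p)) :
          Tot M (2 * p)) q)
    rw [h2, ← hZz]
    exact h1
  rw [hfinal]
  exact Submodule.sum_mem _ fun v _ =>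
    Submodule.smul_mem _ _ (Submodule.subset_span ⟨v, rfl⟩)

end Generic

/-! ### Acyclicity of the odd columns -/

section Algebra

variable (k : Type*) [CommRing k] (A : Type*) [Ring A] [Algebra k A]

/-- The map `a₀ ⊗ ⋯ ⊗ aₙ ↦ 1 ⊗ a₀ ⊗ ⋯ ⊗ aₙ`. -/
def consOne (n : ℕ) : Chains k A n →ₗ[k] Chains k A (n + 1) :=
  PiTensorProduct.lift ((PiTensorProduct.tprod k (s := fun _ : Fin (n + 2) => A)).curryLeft 1)

variable {A}

theorem consOne_pure {n : ℕ} (a : Fin (n + 1) → A) :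
    consOne k A n (pure k A a) = pure k A (Fin.cons 1 a) := by
  rw [consOne, pure, PiTensorProduct.lift.tprod]
  rfl

/-- The usual extra degeneracy: the zeroth face undoes the insertion of `1`, and face `i + 1`
commutes with it as face `i`, with the opposite sign. -/
theorem bMap'_consOne (q : ℕ) (x : Chains k A (q + 1)) :
    bMap' k (face0 k A) (rot k A) (q + 1) (consOne k A (q + 1) x) +
      consOne k A q (bMap' k (face0 k A) (rot k A) q x) = x := by
  have h0 : face k (face0 k A) (rot k A) (q + 1) 0 ∘ₗ consOne k A (q + 1) = LinearMap.id := by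
    refine PiTensorProduct.ext (MultilinearMap.ext fun a => ?_)
    change face k (face0 k A) (rot k A) (q + 1) 0 (consOne k A (q + 1) (pure k A a)) = pure k A a
    rw [consOne_pure]
    refine (face_pure k (Fin.cons 1 a : Fin (q + 3) → A) 0).trans ?_
    congr 1; ext j
    refine Fin.cases ?_ (fun j => ?_) j
    · simp
    · simp
  have h1 : ∀ i < q + 1, face k (face0 k A) (rot k A) (q + 1) (i + 1) ∘ₗ consOne k A (q + 1) =
      consOne k A q ∘ₗ face k (face0 k A) (rot k A) q i := by
    intro i hi
    refine PiTensorProduct.ext (MultilinearMap.ext fun a => ?_)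
    change face k (face0 k A) (rot k A) (q + 1) (i + 1) (consOne k A (q + 1) (pure k A a)) =
      consOne k A q (face k (face0 k A) (rot k A) q i (pure k A a))
    rw [consOne_pure]
    refine (face_pure k (Fin.cons 1 a : Fin (q + 3) → A) (Fin.succ ⟨i, hi⟩)).trans ?_
    refine Eq.trans ?_ (congrArg (consOne k A q) (face_pure k a ⟨i, hi⟩)).symm
    rw [consOne_pure]
    congr 1; ext j
    refine Fin.cases ?_ (fun j => ?_) j
    · simp
    · rw [Fin.cons_succ]
      simp only [Fin.succ_lt_succ_iff, Fin.succ_inj, Fin.castSucc_succ, Fin.cons_succ]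
  have h0' := fun x => LinearMap.congr_fun h0 x
  have h1' := fun i hi x => LinearMap.congr_fun (h1 i hi) x
  simp only [LinearMap.comp_apply, LinearMap.id_apply] at h0' h1'
  simp only [bMap', LinearMap.sum_apply, LinearMap.smul_apply, map_sum, map_smul]
  rw [Finset.sum_range_succ', h0', pow_zero, one_smul, add_right_comm,
    ← Finset.sum_add_distrib, Finset.sum_eq_zero, zero_add]
  intro i hi
  rw [h1' i (Finset.mem_range.1 hi), pow_succ]
  simp

theorem span_sigmaClass_eq_top {p : ℕ}
    (hb : ∀ j < p, ∀ z : Chains k A (2 * j + 2),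
      bMap k (face0 k A) (rot k A) (2 * j + 1) z = 0 →
      ∃ (y : Chains k A (2 * j + 2)) (w : Chains k A (2 * j + 3)) (x : Chains k A (2 * j + 1)),
        (1 - tMap k (rot k A) (2 * j + 2)) y + bMap k (face0 k A) (rot k A) (2 * j + 2) w = z ∧
        bMap' k (face0 k A) (rot k A) (2 * j + 1) y = normMap k (rot k A) (2 * j + 1) x ∧
        bMap k (face0 k A) (rot k A) (2 * j) x = 0)
    {V : Type*} [Fintype V] (e : V → A) (he : ∀ v, IsIdempotentElem (e v))
    (h0 : ∀ z : Chains k A 0, ∃ (c : V → k) (w : Chains k A 1),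
      z = ∑ v, c v • pure k A (fun _ => e v) + bMap k (face0 k A) (rot k A) 0 w) :
    Submodule.span k (Set.range fun v => sigmaClass k p (e v) (he v)) = ⊤ :=
  span_sigmaChain_eq_top k (face0 k A) (rot k A) (rot_period k) (consOne k A) (bMap'_consOne k) hb
    (fun v _ => pure k A fun _ => e v) (fun v => face0_const k (he v)) (fun v => rot_const k (e v))
    h0

end Algebra

/-! ### The Chern character of the modules `A e` -/

section KTheory

universe u

variable {A : Type u} [Ring A]

/-- The module `A e` is the image of the `1 × 1` matrix with entry `e`. -/
def principalEquiv (e : A) (he : IsIdempotentElem e)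
    (h : IsIdempotentElem (Matrix.of fun _ _ : Unit => e)) :
    principal e he ≃ₗ[A] idemModule (Matrix.of fun _ _ : Unit => e) h :=
  ((LinearEquiv.funUnique Unit A A).symm.submoduleMap
    (LinearMap.range (LinearMap.toSpanSingleton A A e))).trans <| LinearEquiv.ofEq _ _ (by
      ext v
      constructor
      · rintro ⟨_, ⟨a, rfl⟩, rfl⟩
        refine ⟨fun _ => a, ?_⟩
        ext
        simp [Matrix.vecMul, dotProduct]
      · rintro ⟨w, rfl⟩
        refine ⟨_, ⟨w (), rfl⟩, ?_⟩
        ext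
        simp [Matrix.vecMul, dotProduct])

/-- For the `1 × 1` matrix with entry `e`, the sum over families of indices in the generalized trace
has a single term. -/
theorem chernCharacter_principal (k : Type*) [CommRing k] [Algebra k A] (p : ℕ) (e : A)
    (he : IsIdempotentElem e) :
    chernCharacter k p (K0.mk (principal e he)) = sigmaClass k p e he := by
  have h : IsIdempotentElem (Matrix.of fun _ _ : Unit => e) := by
    ext
    simp [Matrix.mul_apply, he.eq]
  have h1 : chernCharacter k p (K0.mk (principal e he)) = chernIdem k p _ h :=
    (FreeAbelianGroup.lift_apply_of _ _).trans
      (chernModule_eq k p _ _ h (principalEquiv e he h))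
  obtain ⟨h2, e2⟩ := chernIdem_eq k p _ h
  rw [h1, e2, sigmaClass]
  congr 2
  refine congrArg (fun x => sigmaChain (M := Chains k A) x (2 * p)) (funext fun q => ?_)
  rw [trace_pure]
  exact Fintype.sum_unique _

theorem chernCharacterLinear_surjective (k : Type*) [CommRing k] [Algebra k A] {p : ℕ}
    {V : Type*} (e : V → A) (he : ∀ v, IsIdempotentElem (e v))
    (h : Submodule.span k (Set.range fun v => sigmaClass k p (e v) (he v)) = ⊤) :
    Function.Surjective (chernCharacterLinear (A := A) k p) := by
  rw [← LinearMap.range_eq_top, eq_top_iff, ← h, Submodule.span_le]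
  rintro _ ⟨v, rfl⟩
  refine ⟨1 ⊗ₜ K0.mk (principal (e v) (he v)), ?_⟩
  rw [chernCharacterLinear, LinearMap.liftBaseChange_tmul, one_smul]
  exact chernCharacter_principal k p _ _

end KTheory

/-! ### Multiplicative bases and duality -/

section MultiplicativeBasis

variable {S : Type*} [SemigroupWithZero S]

/-- A family of elements of an algebra indexed by a semigroup with zero which is multiplicative and
whose nonzero part is a basis. -/
structure IsMultiplicativeBasis (k : Type*) [CommRing k] {A : Type*} [Ring A] [Algebra k A]
    (β : S → A) : Prop where
  map_mul : ∀ s t, β (s * t) = β s * β t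
  map_zero : β 0 = 0
  linearIndependent : LinearIndependent k fun s : {s : S // s ≠ 0} => β s
  span_eq_top : Submodule.span k (Set.range β) = ⊤

variable {A : Type*} [Ring A]

section CommRing

variable {k : Type*} [CommRing k] [Algebra k A] {β : S → A}

theorem IsMultiplicativeBasis.span_nonzero (h : IsMultiplicativeBasis k β) :
    Submodule.span k (Set.range fun s : {s : S // s ≠ 0} => β s) = ⊤ := by
  rw [eq_top_iff, ← h.span_eq_top, Submodule.span_le]
  rintro _ ⟨s, rfl⟩
  by_cases hs : s = 0
  · rw [hs, h.map_zero]
    exact Submodule.zero_mem _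
  · exact Submodule.subset_span ⟨⟨s, hs⟩, rfl⟩

/-- The basis formed by the nonzero elements. -/
def IsMultiplicativeBasis.basis (h : IsMultiplicativeBasis k β) :
    Module.Basis {s : S // s ≠ 0} k A :=
  Module.Basis.mk h.linearIndependent h.span_nonzero.ge

theorem IsMultiplicativeBasis.basis_apply (h : IsMultiplicativeBasis k β) (s : {s : S // s ≠ 0}) :
    h.basis s = β s := by
  rw [basis, Module.Basis.mk_apply]

variable (S k) in
/-- The functions on `S` which vanish at zero. -/
def zeroFun : Submodule k (S → k) := LinearMap.ker (LinearMap.proj 0)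

theorem mem_zeroFun {f : S → k} : f ∈ zeroFun S k ↔ f 0 = 0 := Iff.rfl

variable (k) in
/-- The action `(s f) t = f (t s)` of `S` on the functions on `S` which vanish at zero. -/
def rightTranslate (s : S) : Module.End k (zeroFun S k) :=
  (LinearMap.funLeft k k (· * s)).restrict fun f hf => by
    change f (0 * s) = 0
    rw [zero_mul]
    exact hf

theorem rightTranslate_apply (s : S) (f : zeroFun S k) (t : S) :
    (rightTranslate k s f : S → k) t = (f : S → k) (t * s) := rfl

/-- Right multiplication in the argument of a function is a left action, so the order of the factors
is kept. -/
theorem rightTranslate_mul (s t : S) : rightTranslate k (s * t) = rightTranslate k s * rightTranslate k t := by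
  ext f u
  change (f : S → k) (u * (s * t)) = (f : S → k) (u * s * t)
  rw [mul_assoc]

theorem rightTranslate_zero : rightTranslate k (0 : S) = 0 := by
  ext f u
  change (f : S → k) (u * 0) = 0
  rw [mul_zero]
  exact f.2

/-- At each nonzero argument exactly one summand survives, that of the idempotent at its target. -/
theorem sum_rightTranslate_eq_one {V : Type*} [Fintype V] (e : V → S)
    (h : ∀ t : S, t ≠ 0 → ∃ v, t * e v = t ∧ ∀ w, w ≠ v → t * e w = 0) :
    ∑ v, rightTranslate k (e v) = 1 := by
  ext f t
  rw [LinearMap.sum_apply, Submodule.coe_sum, Finset.sum_apply]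
  simp only [rightTranslate_apply]
  by_cases ht : t = 0
  · simp only [ht, zero_mul, mem_zeroFun.1 f.2, Finset.sum_const_zero, Module.End.one_apply]
  · obtain ⟨v, h1, h2⟩ := h t ht
    rw [Finset.sum_eq_single v (fun w _ hw => by rw [h2 w hw]; exact f.2) (by simp), h1]
    rfl

/-- Elements which act by right translations are linearly independent, if `S` has enough
idempotents. -/
theorem linearIndependent_of_rightTranslate (π : A →ₐ[k] Module.End k (zeroFun S k))
    (hπ : ∀ s, π (β s) = rightTranslate k s)
    (h : ∀ s : S, s ≠ 0 → ∃ v, v * s = s ∧ ∀ t, v * t = t ∨ v * t = 0) :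
    LinearIndependent k fun s : {s : S // s ≠ 0} => β s := by
  classical
  rw [linearIndependent_iff']
  intro I c hc s hs
  obtain ⟨v, h1, h2⟩ := h s s.2
  -- The relation is applied to the delta function at `s` and evaluated at `v`. As `v * t` is `t` or
  -- zero, only the coefficient of `s` remains.
  let f : zeroFun S k := ⟨Pi.single s.1 1, mem_zeroFun.2 (Pi.single_eq_of_ne s.2.symm _)⟩
  have h3 := congrArg (fun T : Module.End k (zeroFun S k) => (T f : S → k) v) (congrArg π hc)
  simp only [map_sum, map_smul, hπ, LinearMap.sum_apply, LinearMap.smul_apply, Submodule.coe_sum,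
    Finset.sum_apply, Submodule.coe_smul, Pi.smul_apply, rightTranslate_apply, map_zero] at h3
  rw [Finset.sum_eq_single s] at h3
  · simpa [f, h1] using h3
  · intro t _ hts
    have : (Pi.single s.1 1 : S → k) (v * t) = 0 := by
      rcases h2 t with h | h
      · rw [h]
        exact Pi.single_eq_of_ne (fun h => hts (Subtype.ext h)) _
      · rw [h]
        exact Pi.single_eq_of_ne s.2.symm _
    change c t • (Pi.single s.1 1 : S → k) (v * t) = 0
    rw [this, smul_zero]
  · exact fun h => absurd hs h

/-- The chains of degree zero modulo boundaries are spanned by some idempotents. -/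
theorem exists_eq_sum_add_bMap (hβ : IsMultiplicativeBasis k β) {V : Type*} [Fintype V] (e : V → A)
    (h : ∀ s : S, s ≠ 0 → (∃ v, β s = e v) ∨ ∃ t, t * s = s ∧ s * t = 0) (z : Chains k A 0) :
    ∃ (c : V → k) (w : Chains k A 1),
      z = ∑ v, c v • pure k A (fun _ => e v) + bMap k (face0 k A) (rot k A) 0 w := by
  let T : Submodule k (Chains k A 0) := Submodule.span k (Set.range fun v => pure k A fun _ => e v) ⊔
    LinearMap.range (bMap k (face0 k A) (rot k A) 0)
  suffices H : z ∈ T by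
    obtain ⟨x, hx, _, ⟨w, rfl⟩, rfl⟩ := Submodule.mem_sup.1 H
    obtain ⟨c, rfl⟩ := (Submodule.mem_span_range_iff_exists_fun k).1 hx
    exact ⟨c, w, rfl⟩
  let θ : A ≃ₗ[k] Chains k A 0 :=
    (PiTensorProduct.subsingletonEquiv (R := k) (s := fun _ : Fin 1 => A) 0).symm
  have hθ : ∀ a, θ a = pure k A fun _ => a := fun a =>
    PiTensorProduct.subsingletonEquiv_symm_apply' (R := k) (0 : Fin 1) a
  obtain ⟨a, rfl⟩ : ∃ a, θ a = z := θ.surjective z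
  have : Submodule.span k (Set.range β) ≤ T.comap θ.toLinearMap := by
    rw [Submodule.span_le]
    rintro _ ⟨s, rfl⟩
    change θ (β s) ∈ T
    by_cases hs : s = 0
    · rw [hs, hβ.map_zero, map_zero]
      exact T.zero_mem
    rcases h s hs with ⟨v, hv⟩ | ⟨t, h1, h2⟩
    · rw [hv, hθ]
      exact Submodule.mem_sup_left (Submodule.subset_span ⟨v, rfl⟩)
    -- Here `b (t ⊗ s) = t s - s t = s`.
    · refine Submodule.mem_sup_right ⟨pure k A (wordTuple β 2 [t, s]), ?_⟩
      rw [bMap, LinearMap.sum_apply, Finset.sum_range_succ, Finset.sum_range_one]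
      have e1 := face_wordTuple (k := k) hβ.map_mul (q := 0) (l := [t, s]) rfl (i := 0) one_pos
      have e2 := face_last_wordTuple (k := k) hβ.map_mul (q := 0) (x := t) (l := [s]) rfl (by simp)
      have e3 : face k (face0 k A) (rot k A) 0 1 (pure k A (wordTuple β 2 [t, s])) = θ 0 := by
        refine e2.trans ?_
        rw [hθ]
        congr 1; ext j
        obtain rfl : j = 0 := Subsingleton.elim (α := Fin 1) _ _
        simp [wordTuple, h2, hβ.map_zero]
      rw [LinearMap.smul_apply, LinearMap.smul_apply, e3, map_zero, smul_zero, add_zero, pow_zero,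
        one_smul]
      refine e1.trans ?_
      rw [hθ]
      congr 1; ext j
      obtain rfl : j = 0 := Subsingleton.elim (α := Fin 1) _ _
      simp [wordTuple, mergeAt, h1]
  rw [hβ.span_eq_top] at this
  exact this Submodule.mem_top

end CommRing

section Field

variable {k : Type*} [Field k] [Algebra k A] {β : S → A}

/-- Hochschild cycles are boundaries up to elements of a subspace `W`, if the cocycles which vanish
on `W` are coboundaries. -/
theorem ker_bMap_le (hβ : IsMultiplicativeBasis k β) {q : ℕ} (W : Submodule k (Chains k A (q + 1)))
    (H : ∀ Φ : Chains k A (q + 1) →ₗ[k] k, W ≤ LinearMap.ker Φ →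
      (∀ x l, l.length = q + 2 → hochschildCoboundary (cochainOf β (q + 1) Φ) x l = 0) →
      ∃ g, Contracted g ∧
        ∀ x l, l.length = q + 1 → cochainOf β (q + 1) Φ x l = hochschildCoboundary g x l) :
    LinearMap.ker (bMap k (face0 k A) (rot k A) q) ≤
      LinearMap.range (bMap k (face0 k A) (rot k A) (q + 1)) ⊔ W := by
  intro z hz
  by_contra hz'
  -- A functional separating `z` from the sum is a cocycle vanishing on `W`, hence factors through
  -- `b`, and so vanishes at the cycle `z` after all.
  obtain ⟨Φ, h1, h2⟩ := Submodule.exists_le_ker_of_notMem hz'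
  obtain ⟨g, h3, h4⟩ := H Φ (le_sup_right.trans h2) fun x l hl => by
    rw [coboundary_cochainOf hβ.map_mul Φ x hl]
    exact h2 (Submodule.mem_sup_left ⟨_, rfl⟩)
  obtain ⟨ψ, h5⟩ := exists_functional (k := k) (q := q) hβ.map_zero hβ.basis hβ.basis_apply h3
  have h6 : Φ = ψ ∘ₗ bMap k (face0 k A) (rot k A) q := by
    refine functional_ext hβ.basis hβ.basis_apply fun x l hl => ?_
    have e1 : cochainOf β (q + 1) (ψ ∘ₗ bMap k (face0 k A) (rot k A) q) x l =
        ψ (bMap k (face0 k A) (rot k A) q (pure k A (wordTuple β (q + 2) (x :: l)))) :=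
      if_pos hl
    rw [h4 x l hl, e1, ← coboundary_cochainOf hβ.map_mul ψ x hl]
    exact (coboundary_congr h5 x hl).symm
  apply h1
  rw [h6, LinearMap.comp_apply, LinearMap.mem_ker.1 hz, map_zero]

end Field

end MultiplicativeBasis

end CyclicHomology

namespace QuiverAlgebra

/-! ### Relations, spanning sets and representations of bound quiver algebras -/

section BoundQuiverAlgebra

variable (k : Type*) [CommRing k] {V E : Type*} [Fintype V] (s t : E → V)
  (R : FreeAlgebra k (V ⊕ E) → Prop)

/-- The projection from the free algebra on the vertices and the arrows. -/
def quotientMap : FreeAlgebra k (V ⊕ E) →ₐ[k] BoundQuiverAlgebra k s t R :=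
  RingQuot.mkAlgHom k (Relation k s t R)

/-- The element of the algebra attached to an arrow. -/
def arrow (a : E) : BoundQuiverAlgebra k s t R :=
  quotientMap k s t R (arr k a)

theorem sum_vertex : ∑ v, vertex k s t R v = 1 := by
  have h := RingQuot.mkAlgHom_rel k (Relation.sum_vertices (k := k) (s := s) (t := t) (R := R))
  rw [map_sum, map_one] at h
  exact h

theorem vertex_mul_vertex {v w : V} (hvw : v ≠ w) : vertex k s t R v * vertex k s t R w = 0 := by
  have h := RingQuot.mkAlgHom_rel k (Relation.vertex_orth (s := s) (t := t) (R := R) v w hvw)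
  rw [map_mul, map_zero] at h
  exact h

theorem source_mul_arrow (a : E) : vertex k s t R (s a) * arrow k s t R a = arrow k s t R a := by
  have h := RingQuot.mkAlgHom_rel k (Relation.source (s := s) (t := t) (R := R) a)
  rw [map_mul] at h
  exact h

theorem arrow_mul_target (a : E) : arrow k s t R a * vertex k s t R (t a) = arrow k s t R a := by
  have h := RingQuot.mkAlgHom_rel k (Relation.target (s := s) (t := t) (R := R) a)
  rw [map_mul] at h
  exact h

theorem quotientMap_eq_zero {x : FreeAlgebra k (V ⊕ E)} (hx : R x) :
    quotientMap k s t R x = 0 :=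
  (RingQuot.mkAlgHom_rel k (Relation.rel (s := s) (t := t) x hx)).trans (map_zero _)

/-- A subspace which contains the vertices and the arrows and which is closed under products is the
whole algebra. -/
theorem eq_top_of_mul_mem (T : Submodule k (BoundQuiverAlgebra k s t R))
    (hv : ∀ v, vertex k s t R v ∈ T) (ha : ∀ a, arrow k s t R a ∈ T)
    (hT : ∀ x ∈ T, ∀ y ∈ T, x * y ∈ T) : T = ⊤ := by
  have h1 : (1 : BoundQuiverAlgebra k s t R) ∈ T := by
    rw [← sum_vertex k s t R]
    exact Submodule.sum_mem _ fun v _ => hv v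
  rw [eq_top_iff]
  rintro x -
  obtain ⟨y, rfl⟩ := RingQuot.mkAlgHom_surjective k (Relation k s t R) x
  change RingQuot.mkAlgHom k (Relation k s t R) y ∈ T
  induction y using FreeAlgebra.induction with
  | grade0 r =>
    rw [AlgHom.commutes, Algebra.algebraMap_eq_smul_one]
    exact T.smul_mem r h1
  | grade1 x =>
    rcases x with v | a
    · exact hv v
    · exact ha a
  | mul a b ha hb =>
    rw [map_mul]
    exact hT _ ha _ hb
  | add a b ha hb =>
    rw [map_add]
    exact T.add_mem ha hb

theorem span_range_eq_top {S : Type*} [Mul S] {β : S → BoundQuiverAlgebra k s t R}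
    (hβ : ∀ x y, β (x * y) = β x * β y)
    (hv : ∀ v, vertex k s t R v ∈ Submodule.span k (Set.range β))
    (ha : ∀ a, arrow k s t R a ∈ Submodule.span k (Set.range β)) :
    Submodule.span k (Set.range β) = ⊤ := by
  refine eq_top_of_mul_mem k s t R _ hv ha fun x hx y hy => ?_
  induction hx, hy using Submodule.span_induction₂ with
  | mem_mem x y hx hy =>
    obtain ⟨x, rfl⟩ := hx
    obtain ⟨y, rfl⟩ := hy
    exact Submodule.subset_span ⟨x * y, hβ x y⟩
  | zero_left y hy => rw [zero_mul]; exact Submodule.zero_mem _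
  | zero_right x hx => rw [mul_zero]; exact Submodule.zero_mem _
  | add_left x y z _ _ _ h1 h2 => rw [add_mul]; exact Submodule.add_mem _ h1 h2
  | add_right x y z _ _ _ h1 h2 => rw [mul_add]; exact Submodule.add_mem _ h1 h2
  | smul_left r x y _ _ h => rw [smul_mul_assoc]; exact Submodule.smul_mem _ _ h
  | smul_right r x y _ _ h => rw [mul_smul_comm]; exact Submodule.smul_mem _ _ h

/-- The representation given by the images of the vertices and of the arrows. -/
def liftRep {B : Type*} [Ring B] [Algebra k B] (f : V ⊕ E → B)
    (hf : ∀ ⦃x y⦄, Relation k s t R x y → FreeAlgebra.lift k f x = FreeAlgebra.lift k f y) :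
    BoundQuiverAlgebra k s t R →ₐ[k] B :=
  RingQuot.liftAlgHom k ⟨FreeAlgebra.lift k f, hf⟩

variable {B : Type*} [Ring B] [Algebra k B] (f : V ⊕ E → B)
    (hf : ∀ ⦃x y⦄, Relation k s t R x y → FreeAlgebra.lift k f x = FreeAlgebra.lift k f y)

theorem liftRep_vertex (v : V) : liftRep k s t R f hf (vertex k s t R v) = f (Sum.inl v) := by
  refine (RingQuot.liftAlgHom_mkAlgHom_apply _ _ _ _).trans ?_
  rw [FreeAlgebra.lift_ι_apply]

theorem liftRep_arrow (a : E) : liftRep k s t R f hf (arrow k s t R a) = f (Sum.inr a) := by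
  refine (RingQuot.liftAlgHom_mkAlgHom_apply _ _ _ _).trans ?_
  rw [FreeAlgebra.lift_ι_apply]

end BoundQuiverAlgebra

end QuiverAlgebra

namespace CyclicHomology

/-! ### Alternating words in two letters with zero products -/

section Alternating

variable {S : Type*}

/-- The word `x y x y ⋯ x y` of length `2 m`. -/
def alternating (x y : S) : ℕ → List S
  | 0 => []
  | m + 1 => x :: y :: alternating x y m

theorem length_alternating (x y : S) (m : ℕ) : (alternating x y m).length = 2 * m := by
  induction m with
  | zero => rfl
  | succ m ih => simp [alternating, ih]; ring

theorem alternating_append (x y : S) (m : ℕ) :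
    alternating x y m ++ [x] = x :: alternating y x m := by
  induction m with
  | zero => rfl
  | succ m ih => simp [alternating, ih]

theorem getLast_cons_alternating (x y : S) (m : ℕ) :
    (y :: alternating x y m).getLast (by simp) = y := by
  induction m with
  | zero => rfl
  | succ m ih => simpa [alternating] using ih

end Alternating

section Words

variable (k : Type*) [CommRing k] {A : Type*} [Ring A] [Algebra k A] {S : Type*} [SemigroupWithZero S]

/-- The chain attached to a word. -/
abbrev wordChain (β : S → A) (q : ℕ) (l : List S) : Chains k A q :=
  pure k A (wordTuple β (q + 1) l)

variable {β : S → A}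

theorem rot_wordChain {q : ℕ} {l : List S} (hl : l.length = q) (a : S) :
    rot k A q (wordChain k β q (l ++ [a])) = wordChain k β q (a :: l) := by
  rw [rot_pure]
  congr 1; ext j
  refine Fin.cases ?_ (fun j => ?_) j
  · rw [show (0 - 1 : Fin (q + 1)) = Fin.last q by rw [sub_eq_iff_eq_add]; simp]
    simp [wordTuple, ← hl]
  · rw [show (j.succ - 1 : Fin (q + 1)) = j.castSucc by rw [sub_eq_iff_eq_add]; simp]
    have hj : (j : ℕ) < l.length := by omega
    simp [wordTuple, List.getElem?_append_left hj]

theorem zero_mem_mergeAt {l : List S} (h : l.IsChain fun a b => a * b = 0) {i : ℕ}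
    (hi : i + 1 < l.length) : 0 ∈ mergeAt i l := by
  induction i generalizing l with
  | zero =>
    match l, h with
    | a :: b :: l, h =>
      rw [List.isChain_cons_cons] at h
      simp [mergeAt, h.1]
  | succ i ih =>
    match l, h with
    | a :: l, h => exact List.mem_cons_of_mem _ (ih h.tail (by simpa using hi))

theorem face_wordChain_eq_zero (h0 : β 0 = 0) (hβ : ∀ s t, β (s * t) = β s * β t)
    {q : ℕ} {l : List S} (hl : l.length = q + 2)
    (h : l.IsChain fun a b => a * b = 0) {i : ℕ} (hi : i < q + 1) :
    face k (face0 k A) (rot k A) q i (wordChain k β (q + 1) l) = 0 := by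
  refine (face_wordTuple hβ hl hi).trans (pure_wordTuple_eq_zero h0 ?_ ?_)
  · have := length_mergeAt i l (by omega)
    omega
  · exact zero_mem_mergeAt h (by omega)

/-- Every inner face other than the zeroth contains a zero product. -/
theorem bMap'_wordChain_cons (h0 : β 0 = 0) (hβ : ∀ s t, β (s * t) = β s * β t)
    {q : ℕ} {e x : S} {l : List S} (hl : l.length = q + 1)
    (h : (x :: l).IsChain fun a b => a * b = 0) (he : e * x = x) :
    bMap' k (face0 k A) (rot k A) (q + 1) (wordChain k β (q + 2) (e :: x :: l)) =
      wordChain k β (q + 1) (x :: l) := by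
  rw [bMap', LinearMap.sum_apply, Finset.sum_eq_single 0]
  · rw [pow_zero, one_smul]
    refine (face_wordTuple hβ (by simp [hl]) (by omega)).trans ?_
    rw [mergeAt, he]
  · intro i hi hi0
    obtain ⟨i, rfl⟩ := Nat.exists_eq_succ_of_ne_zero hi0
    rw [Finset.mem_range] at hi
    rw [LinearMap.smul_apply]
    refine (congrArg _ ((face_wordTuple hβ (by simp [hl]) (by omega)).trans
      (pure_wordTuple_eq_zero h0 ?_ ?_))).trans (smul_zero _)
    · have := length_mergeAt (i + 1) (e :: x :: l) (by simp [hl]; omega)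
      rw [Nat.succ_eq_add_one]
      simp only [List.length_cons] at this
      omega
    · exact List.mem_cons_of_mem _ (zero_mem_mergeAt h (by simp [hl]; omega))
  · simp

theorem bMap_wordChain_eq_zero (h0 : β 0 = 0) (hβ : ∀ s t, β (s * t) = β s * β t)
    {q : ℕ} {x : S} {l : List S} (hl : l.length = q + 1)
    (hn : l ≠ []) (h : (x :: l).IsChain fun a b => a * b = 0) (h1 : l.getLast hn * x = 0) :
    bMap k (face0 k A) (rot k A) q (wordChain k β (q + 1) (x :: l)) = 0 := by
  rw [bMap, LinearMap.sum_apply, Finset.sum_range_succ, Finset.sum_eq_zero, zero_add,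
    LinearMap.smul_apply]
  · refine (congrArg _ ((face_last_wordTuple hβ hl hn).trans
      (pure_wordTuple_eq_zero h0 ?_ ?_))).trans (smul_zero _)
    · simp [hl]
    · simp [h1]
  · intro i hi
    rw [LinearMap.smul_apply, face_wordChain_eq_zero k h0 hβ (by simp [hl]) h
      (Finset.mem_range.1 hi), smul_zero]

theorem isChain_cons_alternating {x y : S} (hxy : x * y = 0) (hyx : y * x = 0) (m : ℕ) :
    (y :: alternating x y m).IsChain fun a b => a * b = 0 := by
  induction m with
  | zero => exact .singleton _
  | succ m ih => exact .cons_cons hyx (.cons_cons hxy ih)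

/-- Rotation exchanges the roles of the two letters, and the sign is negative in odd degree. -/
theorem tMap_alternating (x y : S) (m : ℕ) :
    tMap k (rot k A) (2 * m + 1) (wordChain k β (2 * m + 1) (alternating x y (m + 1))) =
      - wordChain k β (2 * m + 1) (alternating y x (m + 1)) := by
  have h1 : alternating x y (m + 1) = (x :: alternating y x m) ++ [y] := by
    rw [List.cons_append, alternating_append]; rfl
  rw [tMap, LinearMap.smul_apply, h1,
    (odd_two_mul_add_one m).neg_one_pow, neg_one_smul]
  congr 1
  exact rot_wordChain k (by simp [length_alternating]) y

/-- The square of `t` fixes the word, so the `2 m + 2` powers of `t` group into `m + 1` equal pairs.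
This factor is where the characteristic enters. -/
theorem normMap_alternating (x y : S) (m : ℕ) :
    normMap k (rot k A) (2 * m + 1) (wordChain k β (2 * m + 1) (alternating x y (m + 1))) =
      ((m + 1 : ℕ) : k) • (wordChain k β (2 * m + 1) (alternating x y (m + 1)) -
        wordChain k β (2 * m + 1) (alternating y x (m + 1))) := by
  have h : ∀ i, (tMap k (rot k A) (2 * m + 1) ^ (2 * i))
      (wordChain k β (2 * m + 1) (alternating x y (m + 1))) =
        wordChain k β (2 * m + 1) (alternating x y (m + 1)) := by
    intro i
    induction i with
    | zero => rfl
    | succ i ih =>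
      rw [mul_add, mul_one, pow_add, pow_two, Module.End.mul_apply, Module.End.mul_apply,
        tMap_alternating, map_neg, tMap_alternating, neg_neg, ih]
  have h2 : ∀ c, ∑ i ∈ Finset.range (2 * c), (tMap k (rot k A) (2 * m + 1) ^ i)
      (wordChain k β (2 * m + 1) (alternating x y (m + 1))) =
      (c : k) • (wordChain k β (2 * m + 1) (alternating x y (m + 1)) -
        wordChain k β (2 * m + 1) (alternating y x (m + 1))) := by
    intro c
    induction c with
    | zero => simp
    | succ c ih =>
      rw [mul_add, mul_one, Finset.sum_range_succ, Finset.sum_range_succ, ih, h, pow_succ',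
        Module.End.mul_apply, h, tMap_alternating, Nat.cast_succ, add_smul, one_smul]
      abel
  rw [normMap, LinearMap.sum_apply]
  exact h2 (m + 1)

theorem tMap_cons_alternating (e x y : S) (m : ℕ) :
    tMap k (rot k A) (2 * m + 2) (wordChain k β (2 * m + 2) (e :: alternating x y (m + 1))) =
      wordChain k β (2 * m + 2) (y :: e :: x :: alternating y x m) := by
  have h1 : e :: alternating x y (m + 1) = (e :: x :: alternating y x m) ++ [y] := by
    rw [List.cons_append, List.cons_append, alternating_append]; rfl
  rw [tMap, LinearMap.smul_apply, h1, (show Even (2 * m + 2) from even_two_mul (m + 1)).neg_one_pow, one_smul]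
  exact rot_wordChain k (by simp [length_alternating]) y

end Words

end CyclicHomology

namespace QuiverAlgebra

open CyclicHomology

namespace CyclePath

variable {n : ℕ}

theorem exists_mul_target {x : CyclePath n} (hx : x ≠ 0) :
    ∃ v, x * mk v 0 = x ∧ ∀ w, w ≠ v → x * mk w 0 = 0 := by
  obtain ⟨i, l, _, rfl⟩ := (eq_zero_or_mk x).resolve_left hx
  exact ⟨i + l, mk_mul_mk_of_eq _ rfl, fun w hw => mk_mul_mk_of_ne _ hw⟩

theorem exists_source_mul {x : CyclePath n} (hx : x ≠ 0) :
    ∃ v, v * x = x ∧ ∀ t, v * t = t ∨ v * t = 0 := by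
  obtain ⟨i, l, _, rfl⟩ := (eq_zero_or_mk x).resolve_left hx
  refine ⟨mk i 0, by rw [mk_mul_mk_of_eq _ (by simp), zero_add], fun t => ?_⟩
  rcases eq_zero_or_mk t with rfl | ⟨j, m, _, rfl⟩
  · exact Or.inl (mul_zero _)
  rw [mk_mul_mk]
  split_ifs with h
  · left
    rw [h, zero_add, Nat.cast_zero, add_zero]
  · exact Or.inr rfl

theorem mk_pred_mul_mk (i : ZMod n) : mk (i - 1) 1 * mk i (n - 1) = 0 := by
  rw [mk_mul_mk_of_eq _ (by simp), mk_eq_zero (by omega)]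

/-- Each pair `x y` overflows to the identity at `e`. -/
theorem cap_iterate_alternating {k : Type*} [CommRing k]
    {f : CyclePath n → List (CyclePath n) → k}
    {e x y : CyclePath n} (h : e * overflow x y = e) (c : ℕ) :
    cap^[c] f e (alternating x y c) = f e [] := by
  induction c with
  | zero => rfl
  | succ c ih =>
    rw [Function.iterate_succ_apply', alternating, cap, h, ih]

end CyclePath

/-! ### The Taft algebra has the basis of short paths -/

section TaftBasis

variable (k : Type*) [CommRing k] (n : ℕ) [NeZero n]

/-- The arrow `i → i + 1` of the Taft algebra. -/
abbrev taftArrow (i : ZMod n) : TaftAlgebra k n := arrow k _ _ _ i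

/-- The path of length `l` with source `i`. -/
def taftPath (i : ZMod n) : ℕ → TaftAlgebra k n
  | 0 => taftVertex k n i
  | l + 1 => taftPath i l * taftArrow k n (i + l)

theorem taftVertex_mul_taftPath (i : ZMod n) (l : ℕ) :
    taftVertex k n i * taftPath k n i l = taftPath k n i l := by
  induction l with
  | zero => exact vertex_idempotent k _ _ _ i
  | succ l ih => rw [taftPath, ← mul_assoc, ih]

theorem taftPath_mul_taftVertex (i : ZMod n) (l : ℕ) :
    taftPath k n i l * taftVertex k n (i + l) = taftPath k n i l := by
  cases l with
  | zero => rw [Nat.cast_zero, add_zero]; exact vertex_idempotent k _ _ _ i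
  | succ l =>
    have := arrow_mul_target k (fun i => i) (fun i => i + 1) (taftRelation k n) (i + l)
    rw [taftPath, mul_assoc, Nat.cast_succ, ← add_assoc]
    exact congrArg _ this

theorem taftPath_mul_taftPath (i j : ZMod n) (l m : ℕ) :
    taftPath k n i l * taftPath k n j m = if j = i + l then taftPath k n i (l + m) else 0 := by
  split_ifs with h
  · subst h
    induction m with
    | zero => exact taftPath_mul_taftVertex k n i l
    | succ m ih => rw [taftPath, ← mul_assoc, ih, ← add_assoc, taftPath, Nat.cast_add, add_assoc]
  · rw [← taftPath_mul_taftVertex, ← taftVertex_mul_taftPath k n j, mul_assoc,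
      ← mul_assoc (taftVertex k n (i + l)), vertex_mul_vertex k _ _ _ (Ne.symm h), zero_mul,
      mul_zero]

/-- Compares the recursive paths with the products occurring in the relations. The vertex factor
accounts for length zero, where the product is `1`. -/
theorem taftPath_eq (i : ZMod n) (l : ℕ) : taftPath k n i l = taftVertex k n i *
    quotientMap k (fun i => i) (fun i => i + 1) (taftRelation k n)
      (List.ofFn fun j : Fin l => (arr k (i + (j : ℕ)) : FreeAlgebra k (ZMod n ⊕ ZMod n))).prod := by
  induction l with
  | zero =>
    rw [List.ofFn_zero, List.prod_nil, map_one]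
    exact (mul_one _).symm
  | succ l ih =>
    rw [taftPath, ih, List.ofFn_succ', List.concat_eq_append, List.prod_append, List.prod_singleton,
      map_mul]
    exact mul_assoc _ _ _

theorem taftPath_eq_zero (i : ZMod n) {l : ℕ} (h : n ≤ l) : taftPath k n i l = 0 := by
  have h0 := quotientMap_eq_zero k (fun i => i) (fun i => i + 1) (taftRelation k n) ⟨i, l, h, rfl⟩
  rw [taftPath_eq]
  exact (congrArg (taftVertex k n i * ·) h0).trans (mul_zero _)

/-- The multiplicative basis of the Taft algebra. -/
def taftBasis : CyclePath n → TaftAlgebra k n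
  | .zero => 0
  | .path i l _ => taftPath k n i l

theorem taftBasis_mk (i : ZMod n) (l : ℕ) : taftBasis k n (.mk i l) = taftPath k n i l := by
  by_cases h : l < n
  · rw [← CyclePath.path_eq_mk i l h]; rfl
  · rw [CyclePath.mk_eq_zero (not_lt.1 h), taftPath_eq_zero k n i (not_lt.1 h)]; rfl

theorem taftBasis_mul (x y : CyclePath n) :
    taftBasis k n (x * y) = taftBasis k n x * taftBasis k n y := by
  rcases CyclePath.eq_zero_or_mk x with rfl | ⟨i, l, _, rfl⟩
  · rw [zero_mul]; exact (zero_mul _).symm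
  rcases CyclePath.eq_zero_or_mk y with rfl | ⟨j, m, _, rfl⟩
  · rw [mul_zero]; exact (mul_zero _).symm
  rw [CyclePath.mk_mul_mk, apply_ite (taftBasis k n), taftBasis_mk, taftBasis_mk, taftBasis_mk,
    taftPath_mul_taftPath]
  rfl

/-- The images of the vertices and of the arrows in the algebra of the translations. -/
def taftTranslate : ZMod n ⊕ ZMod n → Module.End k (zeroFun (CyclePath n) k)
  | .inl v => rightTranslate k (.mk v 0)
  | .inr a => rightTranslate k (.mk a 1)

/-- The translations satisfy the defining relations and so represent the algebra; this
representation separates the short paths. -/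
theorem taftTranslate_relation ⦃x y : FreeAlgebra k (ZMod n ⊕ ZMod n)⦄
    (h : Relation k (fun i => i) (fun i => i + 1) (taftRelation k n) x y) :
    FreeAlgebra.lift k (taftTranslate k n) x = FreeAlgebra.lift k (taftTranslate k n) y := by
  cases h with
  | sum_vertices =>
    simp only [map_sum, FreeAlgebra.lift_ι_apply, map_one, taftTranslate]
    exact sum_rightTranslate_eq_one _ fun _ => CyclePath.exists_mul_target
  | vertex_idem v =>
    simp only [map_mul, FreeAlgebra.lift_ι_apply, taftTranslate, ← rightTranslate_mul]
    rw [CyclePath.mk_mul_mk_of_eq _ (by simp)]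
  | vertex_orth v w h =>
    simp only [map_mul, FreeAlgebra.lift_ι_apply, taftTranslate, ← rightTranslate_mul, map_zero]
    rw [CyclePath.mk_mul_mk_of_ne _ (by simpa using h.symm), rightTranslate_zero]
  | source a =>
    simp only [map_mul, FreeAlgebra.lift_ι_apply, taftTranslate, ← rightTranslate_mul]
    rw [CyclePath.mk_mul_mk_of_eq _ (by simp)]
  | target a =>
    simp only [map_mul, FreeAlgebra.lift_ι_apply, taftTranslate, ← rightTranslate_mul]
    rw [CyclePath.mk_mul_mk_of_eq _ (by simp)]
  | rel x hx =>
    obtain ⟨i, m, hm, rfl⟩ := hx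
    -- Positive length only: the empty product is the identity, not a translation by one vertex. The
    -- relations have length at least `n > 0`.
    have key : ∀ m : ℕ, (List.ofFn fun j : Fin (m + 1) =>
        rightTranslate k (.mk (i + ((j : ℕ) : ZMod n)) 1 : CyclePath n)).prod =
          rightTranslate k (.mk i (m + 1)) := by
      intro m
      induction m with
      | zero => simp
      | succ m ih =>
        rw [List.ofFn_succ', List.concat_eq_append, List.prod_append, List.prod_singleton]
        refine (congrArg (· * _) ih).trans ?_
        rw [← rightTranslate_mul, CyclePath.mk_mul_mk_of_eq _ (by simp)]
    obtain ⟨m, rfl⟩ : ∃ m', m = m' + 1 :=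
      Nat.exists_eq_succ_of_ne_zero (by have := NeZero.ne n; omega)
    rw [map_list_prod, List.map_ofFn, map_zero]
    simp only [Function.comp_def, FreeAlgebra.lift_ι_apply, taftTranslate]
    rw [key, CyclePath.mk_eq_zero hm, rightTranslate_zero]

theorem isMultiplicativeBasis_taftBasis : IsMultiplicativeBasis k (taftBasis k n) where
  map_mul := taftBasis_mul k n
  map_zero := rfl
  linearIndependent := by
    let π := liftRep k (fun i => i) (fun i => i + 1) (taftRelation k n) (taftTranslate k n)
      (taftTranslate_relation k n)
    refine linearIndependent_of_rightTranslate π (fun s => ?_) fun _ => CyclePath.exists_source_mul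
    rcases CyclePath.eq_zero_or_mk s with rfl | ⟨i, l, _, rfl⟩
    · rw [rightTranslate_zero]; exact map_zero π
    rw [taftBasis_mk]
    induction l with
    | zero => exact liftRep_vertex k _ _ _ (taftTranslate k n) (taftTranslate_relation k n) i
    | succ l ih =>
      rw [taftPath, map_mul, ih (by omega),
        liftRep_arrow k _ _ _ (taftTranslate k n) (taftTranslate_relation k n) (i + l)]
      change rightTranslate k (CyclePath.mk i l) * rightTranslate k (CyclePath.mk (i + (l : ZMod n)) 1) = _
      rw [← rightTranslate_mul, CyclePath.mk_mul_mk_of_eq _ rfl]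
  span_eq_top := by
    refine span_range_eq_top k _ _ _ (taftBasis_mul k n) (fun v => ?_) fun a => ?_
    · exact Submodule.subset_span ⟨.mk v 0, taftBasis_mk k n v 0⟩
    · refine Submodule.subset_span ⟨.mk a 1, (taftBasis_mk k n a 1).trans ?_⟩
      rw [taftPath, taftPath, Nat.cast_zero, add_zero]
      exact source_mul_arrow k (fun i => i) (fun i => i + 1) (taftRelation k n) a

end TaftBasis

/-! ### Even Hochschild cycles of the Taft algebra -/

section TaftHomology

variable (k : Type*) [Field k] {n : ℕ} [NeZero n]

/-- The chain `e ⊗ x ⊗ y ⊗ x ⊗ y ⊗ ⋯ - e' ⊗ y ⊗ x ⊗ y ⊗ x ⊗ ⋯` of degree `2 j + 2`, where `x` is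
the path of length `n - 1` with source `i`, `y` is the arrow with target `i`, and `e`, `e'` are the
sources of `x`, `y`. -/
def loopChain (i : ZMod n) (j : ℕ) : Chains k (TaftAlgebra k n) (2 * j + 2) :=
  wordChain k (taftBasis k n) (2 * j + 2)
      (.mk i 0 :: alternating (.mk i (n - 1)) (.mk (i - 1) 1) (j + 1)) -
    wordChain k (taftBasis k n) (2 * j + 2)
      (.mk (i - 1) 0 :: alternating (.mk (i - 1) 1) (.mk i (n - 1)) (j + 1))

theorem CyclePath.mk_mul_mk_pred (i : ZMod n) : mk i (n - 1) * mk (i - 1) 1 = 0 := by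
  have h : 1 ≤ n := NeZero.one_le
  rw [mk_mul_mk_of_eq _ (by rw [Nat.cast_sub h]; simp [sub_eq_add_neg]), mk_eq_zero (by omega)]

theorem bMap'_loopChain (i : ZMod n) (j : ℕ) :
    bMap' k (face0 k _) (rot k _) (2 * j + 1) (loopChain k i j) =
      wordChain k (taftBasis k n) (2 * j + 1)
          (alternating (.mk i (n - 1)) (.mk (i - 1) 1) (j + 1)) -
        wordChain k (taftBasis k n) (2 * j + 1)
          (alternating (.mk (i - 1) 1) (.mk i (n - 1)) (j + 1)) := by
  have hm := isMultiplicativeBasis_taftBasis k n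
  have h1 := CyclePath.mk_mul_mk_pred i
  have h2 := CyclePath.mk_pred_mul_mk i
  rw [loopChain, map_sub]
  congr 1
  · refine bMap'_wordChain_cons k hm.map_zero hm.map_mul (q := 2 * j) (by simp [length_alternating])
      (isChain_cons_alternating h1 h2 (j + 1)).tail ?_
    rw [CyclePath.mk_mul_mk_of_eq _ (by simp), zero_add]
  · refine bMap'_wordChain_cons k hm.map_zero hm.map_mul (q := 2 * j) (by simp [length_alternating])
      (isChain_cons_alternating h2 h1 (j + 1)).tail ?_
    rw [CyclePath.mk_mul_mk_of_eq _ (by simp), zero_add]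

/-- Since `b (1 - t) = (1 - t) b'`, and `b'` gives the difference of two words which `t` exchanges
up to the sign `-1`, the contributions cancel. -/
theorem bMap_one_sub_loopChain (i : ZMod n) (j : ℕ) :
    bMap k (face0 k _) (rot k _) (2 * j + 1) ((1 - tMap k (rot k _) (2 * j + 2)) (loopChain k i j)) =
      0 := by
  refine (bMap_one_sub k _ _ (rot_period k) (2 * j + 1) _).trans ?_
  rw [bMap'_loopChain, LinearMap.sub_apply, Module.End.one_apply, map_sub, tMap_alternating,
    tMap_alternating]
  abel

/-- A cocycle of even positive degree which vanishes on the chains `(1 - t) loopChain` is a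
coboundary. -/
theorem exists_coboundary_of_loopChain (hn : 2 ≤ n) {j : ℕ}
    {Φ : Chains k (TaftAlgebra k n) (2 * j + 2) →ₗ[k] k}
    (h0 : ∀ i, Φ ((1 - tMap k (rot k _) (2 * j + 2)) (loopChain k i j)) = 0)
    (hΦ : ∀ x l, l.length = 2 * j + 3 →
      hochschildCoboundary (cochainOf (taftBasis k n) (2 * j + 2) Φ) x l = 0) :
    ∃ g, Contracted g ∧ ∀ x l, l.length = 2 * j + 2 →
      cochainOf (taftBasis k n) (2 * j + 2) Φ x l = hochschildCoboundary g x l := by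
  have hm := isMultiplicativeBasis_taftBasis k n
  obtain ⟨f, g, hf, hg, hfc, hfg⟩ := CyclePath.exists_cap_iterate (j + 1)
    (contracted_cochainOf hm.map_zero Φ) hΦ
  obtain ⟨F, hF⟩ := exists_functional (q := 2 * j + 2) hm.map_zero hm.basis hm.basis_apply
    (CyclePath.contracted_cap_iterate hf (j + 1))
  obtain ⟨ψ, hψ⟩ := exists_functional (q := 2 * j + 1) hm.map_zero hm.basis hm.basis_apply hg
  have hΦF : Φ = F + ψ ∘ₗ bMap k (face0 k _) (rot k _) (2 * j + 1) := by
    refine functional_ext hm.basis hm.basis_apply fun x l hl => ?_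
    have e1 := cochainOf_apply (taftBasis k n)
      (F + ψ ∘ₗ bMap k (face0 k _) (rot k _) (2 * j + 1)) x hl
    rw [e1, LinearMap.add_apply, ← cochainOf_apply _ _ _ hl, hF x l hl, LinearMap.comp_apply,
      ← coboundary_cochainOf hm.map_mul ψ x hl, hfg x l hl]
    exact congrArg _ (coboundary_congr hψ x hl).symm
  have hval : ∀ x l, l.length = 2 * j + 2 →
      F (wordChain k (taftBasis k n) (2 * j + 2) (x :: l)) = CyclePath.cap^[j + 1] f x l :=
    fun x l hl => (cochainOf_apply _ _ _ hl).symm.trans (hF x l hl)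
  -- On `(1 - t) loopChain` the coboundary part of `Φ` vanishes. The alternating words evaluate to
  -- the trace at `i` and at `i - 1`; in their rotations a vertex is followed by a path, which does
  -- not overflow.
  have hstep : ∀ i, f (.mk i 0) [] = f (.mk (i - 1) 0) [] := by
    intro i
    have h1 := h0 i
    rw [hΦF, LinearMap.add_apply, LinearMap.comp_apply, bMap_one_sub_loopChain, map_zero, add_zero,
      LinearMap.sub_apply, Module.End.one_apply, loopChain] at h1
    simp only [map_sub, tMap_cons_alternating] at h1
    have hl : ∀ x y : CyclePath n, (alternating x y (j + 1)).length = 2 * j + 2 := by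
      intro x y; rw [length_alternating]; ring
    rw [hval _ _ (hl _ _), hval _ _ (hl _ _),
      hval _ _ (by simp [length_alternating]), hval _ _ (by simp [length_alternating])] at h1
    have o1 : CyclePath.overflow (.mk i (n - 1)) (.mk (i - 1) 1) = .mk i 0 := by
      rw [CyclePath.overflow_mk _ _ (by omega) (by omega), if_pos, show n - 1 + 1 - n = 0 by omega]
      exact ⟨by rw [Nat.cast_sub (by omega)]; simp [sub_eq_add_neg], by omega⟩
    have o2 : CyclePath.overflow (.mk (i - 1) 1) (.mk i (n - 1)) = .mk (i - 1) 0 := by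
      rw [CyclePath.overflow_mk _ _ (by omega) (by omega), if_pos, show 1 + (n - 1) - n = 0 by omega]
      exact ⟨by simp, by omega⟩
    have o3 : ∀ (i i' : ZMod n) (l : ℕ), l < n → CyclePath.overflow (.mk i 0) (.mk i' l) = 0 := by
      intro i i' l hl
      rw [CyclePath.overflow_mk _ _ (by omega) hl, if_neg (by omega)]
    have z0 : ∀ x l, CyclePath.cap^[j] f (x * 0) l = 0 := fun x l =>
      CyclePath.contracted_cap_iterate hf j _ _ (Or.inl (mul_zero x))
    rw [CyclePath.cap_iterate_alternating (by rw [o1, CyclePath.mk_mul_mk_of_eq _ (by simp)]),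
      CyclePath.cap_iterate_alternating (by rw [o2, CyclePath.mk_mul_mk_of_eq _ (by simp)]),
      Function.iterate_succ_apply', CyclePath.cap, CyclePath.cap, o3 _ _ _ (by omega),
      o3 _ _ _ (by omega), z0, z0, sub_self, sub_zero, sub_eq_zero] at h1
    exact h1
  have hconst : ∀ i, f (.mk i 0) [] = f (.mk 0 0) [] := by
    intro i
    rw [← ZMod.natCast_zmod_val i]
    induction i.val with
    | zero => rw [Nat.cast_zero]
    | succ m ih => rw [hstep, Nat.cast_succ, add_sub_cancel_right, ih]
  obtain ⟨g', hg', h2⟩ := CyclePath.cap_iterate_trace hf hfc hconst j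
  refine ⟨fun x l => g' x l + g x l, fun x l h => ?_, fun x l hl => ?_⟩
  · exact (congrArg₂ (· + ·) (hg' x l h) (hg x l h)).trans (add_zero _)
  · rw [hfg x l hl, h2 x l hl, hochschildCoboundary, hochschildCoboundary, hochschildCoboundary,
      coboundary_add]

/-- By duality a cycle is a boundary plus a combination of the `(1 - t) loopChain`. The image under
`b'` of a `loopChain` is the norm of an alternating word divided by `j + 1`, and the word itself is
a cycle, all its cyclic products being zero. -/
theorem exists_of_bMap_eq_zero_taft (hn : 2 ≤ n) {j : ℕ} (hj : ((j + 1 : ℕ) : k) ≠ 0)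
    {z : Chains k (TaftAlgebra k n) (2 * j + 2)}
    (hz : bMap k (face0 k _) (rot k _) (2 * j + 1) z = 0) :
    ∃ (y : Chains k (TaftAlgebra k n) (2 * j + 2)) (w : Chains k (TaftAlgebra k n) (2 * j + 3))
      (x : Chains k (TaftAlgebra k n) (2 * j + 1)),
        (1 - tMap k (rot k _) (2 * j + 2)) y + bMap k (face0 k _) (rot k _) (2 * j + 2) w = z ∧
        bMap' k (face0 k _) (rot k _) (2 * j + 1) y = normMap k (rot k _) (2 * j + 1) x ∧
        bMap k (face0 k _) (rot k _) (2 * j) x = 0 := by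
  have hm := isMultiplicativeBasis_taftBasis k n
  let v : ZMod n → Chains k (TaftAlgebra k n) (2 * j + 2) := fun i =>
    (1 - tMap k (rot k _) (2 * j + 2)) (loopChain k i j)
  have h1 := ker_bMap_le hm (q := 2 * j + 1) (Submodule.span k (Set.range v)) fun Φ hW hΦ =>
    exists_coboundary_of_loopChain k hn
      (fun i => hW (Submodule.subset_span ⟨i, rfl⟩)) hΦ
  obtain ⟨_, ⟨w, rfl⟩, y, hy, hwy⟩ := Submodule.mem_sup.1 (h1 hz)
  obtain ⟨c, rfl⟩ := (Submodule.mem_span_range_iff_exists_fun k).1 hy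
  let u : ZMod n → Chains k (TaftAlgebra k n) (2 * j + 1) := fun i =>
    wordChain k (taftBasis k n) (2 * j + 1) (alternating (.mk i (n - 1)) (.mk (i - 1) 1) (j + 1))
  refine ⟨∑ i, c i • loopChain k i j, w, ∑ i, (c i * ((j + 1 : ℕ) : k)⁻¹) • u i, ?_, ?_, ?_⟩
  · rw [← hwy]
    refine (add_comm _ _).trans (congrArg _ ?_)
    rw [map_sum]
    simp only [map_smul]
    rfl
  · rw [map_sum, map_sum]
    refine Finset.sum_congr rfl fun i _ => ?_
    rw [map_smul, map_smul, bMap'_loopChain, normMap_alternating, smul_smul, mul_assoc,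
      inv_mul_cancel₀ hj, mul_one]
  · rw [map_sum]
    refine Finset.sum_eq_zero fun i _ => ?_
    have h2 := CyclePath.mk_mul_mk_pred i
    have h3 := CyclePath.mk_pred_mul_mk i
    rw [map_smul]
    refine (congrArg _ (bMap_wordChain_eq_zero k hm.map_zero hm.map_mul (q := 2 * j)
      (by simp [length_alternating]) (by simp)
      (isChain_cons_alternating h2 h3 (j + 1)).tail ?_)).trans (smul_zero _)
    rw [getLast_cons_alternating]
    exact h3

theorem span_taftSigma_eq_top (hn : 2 ≤ n) {p : ℕ} (hp : (p.factorial : k) ≠ 0) :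
    Submodule.span k (Set.range fun j : ZMod n => taftSigma k n p j) = ⊤ := by
  refine span_sigmaClass_eq_top k (fun j hj z hz => exists_of_bMap_eq_zero_taft k hn ?_ hz) _ _
    fun z => exists_eq_sum_add_bMap (isMultiplicativeBasis_taftBasis k n) (taftVertex k n) ?_ z
  · intro h
    -- For `j < p` the factor `j + 1` divides `p!`.
    obtain ⟨d, hd⟩ := Nat.dvd_factorial (Nat.succ_pos j) (Nat.succ_le_of_lt hj)
    exact hp (by rw [hd, Nat.cast_mul, h, zero_mul])
  · intro s hs
    obtain ⟨i, l, hl, rfl⟩ := (CyclePath.eq_zero_or_mk s).resolve_left hs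
    rcases Nat.eq_zero_or_pos l with rfl | hl0
    · exact Or.inl ⟨i, taftBasis_mk k n i 0⟩
    -- A path of positive length less than `n` is not closed, so its product with its source on the
    -- right vanishes.
    · refine Or.inr ⟨.mk i 0, by rw [CyclePath.mk_mul_mk_of_eq _ (by simp), zero_add],
        CyclePath.mk_mul_mk_of_ne _ fun h => ?_⟩
      rw [left_eq_add, ZMod.natCast_eq_zero_iff] at h
      exact absurd (Nat.le_of_dvd hl0 h) (not_le.2 hl)

end TaftHomology

/-! ### Total parametrization of the mesh paths -/

namespace MeshPath

variable {n : ℕ}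

/-- The path with source `(i, i + d)` and target `(i + r, i + m)`, or zero. -/
def mk (i : ZMod n) (d m r : ℕ) : MeshPath n :=
  if h : d ≤ m ∧ m < n ∧ r ≤ m then path i d m r h.1 h.2.1 h.2.2 else 0

theorem path_eq_mk (i : ZMod n) (d m r : ℕ) (hd : d ≤ m) (hm : m < n) (hr : r ≤ m) :
    path i d m r hd hm hr = mk i d m r := by
  rw [mk, dif_pos ⟨hd, hm, hr⟩]

theorem mk_eq_zero {i : ZMod n} {d m r : ℕ} (h : n ≤ m) : mk i d m r = 0 :=
  dif_neg (by omega)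

theorem eq_zero_or_mk (x : MeshPath n) :
    x = 0 ∨ ∃ i d m r, d ≤ m ∧ m < n ∧ r ≤ m ∧ x = mk i d m r := by
  rcases x with _ | ⟨i, d, m, r, hd, hm, hr⟩
  · exact Or.inl rfl
  · exact Or.inr ⟨i, d, m, r, hd, hm, hr, path_eq_mk ..⟩

/-- No bound by `n` is assumed: if one of the factors is zero because its level is too large, then
so is the product, as `r + m'` is at least `m` and `m'`. -/
theorem mk_mul_mk_of_eq {i i' : ZMod n} {d m r d' m' r' : ℕ} (hd : d ≤ m) (hr : r ≤ m)
    (hd' : d' ≤ m') (hr' : r' ≤ m') (h1 : i' = i + r) (h2 : d' + r = m) :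
    mk i d m r * mk i' d' m' r' = mk i d (r + m') (r + r') := by
  by_cases hm' : r + m' < n
  · rw [← path_eq_mk i d m r hd (by omega) hr, ← path_eq_mk i' d' m' r' hd' (by omega) hr',
      path_mul_path, dif_pos ⟨h1, h2, hm'⟩, path_eq_mk]
  · rw [mk_eq_zero (m := r + m') (by omega)]
    by_cases hm : m < n
    · by_cases hm'' : m' < n
      · rw [← path_eq_mk i d m r hd hm hr, ← path_eq_mk i' d' m' r' hd' hm'' hr', path_mul_path,
          dif_neg (by omega)]
      · rw [mk_eq_zero (m := m') (by omega), mul_zero]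
    · rw [mk_eq_zero (by omega), zero_mul]

theorem mk_mul_mk_of_ne {i i' : ZMod n} {d m r d' m' r' : ℕ} (h : ¬ (i' = i + r ∧ d' + r = m)) :
    mk i d m r * mk i' d' m' r' = 0 := by
  by_cases h1 : d ≤ m ∧ m < n ∧ r ≤ m
  · by_cases h2 : d' ≤ m' ∧ m' < n ∧ r' ≤ m'
    · rw [← path_eq_mk i d m r h1.1 h1.2.1 h1.2.2, ← path_eq_mk i' d' m' r' h2.1 h2.2.1 h2.2.2,
        path_mul_path, dif_neg (by tauto)]
    · rw [show mk i' d' m' r' = 0 from dif_neg h2, mul_zero]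
  · rw [show mk i d m r = 0 from dif_neg h1, zero_mul]

theorem exists_source_mul {x : MeshPath n} (hx : x ≠ 0) :
    ∃ v, v * x = x ∧ ∀ t, v * t = t ∨ v * t = 0 := by
  obtain ⟨i, d, m, r, hd, hm, hr, rfl⟩ := (eq_zero_or_mk x).resolve_left hx
  refine ⟨mk i d d 0, ?_, fun t => ?_⟩
  · rw [mk_mul_mk_of_eq le_rfl (Nat.zero_le _) hd hr (by simp) (by omega), zero_add, zero_add]
  rcases eq_zero_or_mk t with rfl | ⟨i', d', m', r', hd', hm', hr', rfl⟩
  · exact Or.inl (mul_zero _)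
  by_cases h : i' = i + (0 : ℕ) ∧ d' + 0 = d
  · left
    rw [mk_mul_mk_of_eq le_rfl (Nat.zero_le _) hd' hr' h.1 h.2, zero_add, zero_add]
    obtain ⟨rfl, rfl⟩ := h
    simp
  · exact Or.inr (mk_mul_mk_of_ne h)

end MeshPath

/-! ### The representation of the Auslander algebra by translations -/

section AuslanderTranslate

variable (k : Type*) [CommRing k] (n : ℕ)

/-- The images of the vertices and of the arrows in the algebra of the right translations. -/
def auslanderTranslate :
    (ZMod n × ZMod n) ⊕ AuslanderArrow n → Module.End k (zeroFun (MeshPath n) k)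
  | .inl v => rightTranslate k (.mk v.1 (v.2 - v.1).val (v.2 - v.1).val 0)
  | .inr (.a i u _) => (-1 : k) ^ (u - (i - 1)).val •
      rightTranslate k (.mk (i - 1) (u - (i - 1)).val (u - (i - 1)).val 1)
  | .inr (.b i u _) => rightTranslate k (.mk i (u - 1 - i).val ((u - 1 - i).val + 1) 0)

theorem auslanderTranslate_vertex {i u : ZMod n} {d : ℕ} (hd : d < n) (h : u = i + d) :
    auslanderTranslate k n (.inl (i, u)) = rightTranslate k (.mk i d d 0) := by
  have : (u - i).val = d := by rw [h, add_sub_cancel_left, ZMod.val_natCast_of_lt hd]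
  rw [auslanderTranslate, this]

/-- The sign depends on the distance `d` of the coordinates at the source of the arrow. An arrow `b`
changes `d` by one, so commuting translations yield anticommuting squares. -/
theorem auslanderTranslate_a {i j u : ZMod n} (hu : u ≠ i - 1) {d : ℕ} (hd : d < n) (hj : i - 1 = j)
    (h : u = j + d) : auslanderTranslate k n (.inr (.a i u hu)) =
      (-1 : k) ^ d • rightTranslate k (.mk j d d 1) := by
  have : (u - (i - 1)).val = d := by rw [h, hj, add_sub_cancel_left, ZMod.val_natCast_of_lt hd]
  rw [auslanderTranslate, this, hj]

theorem auslanderTranslate_b {i u : ZMod n} (hu : u ≠ i) {d : ℕ} (hd : d < n)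
    (h : u = i + (d + 1 : ℕ)) : auslanderTranslate k n (.inr (.b i u hu)) =
      rightTranslate k (.mk i d (d + 1) 0) := by
  have : (u - 1 - i).val = d := by
    rw [h, show i + ((d + 1 : ℕ) : ZMod n) - 1 - i = d by push_cast; ring, ZMod.val_natCast_of_lt hd]
  rw [auslanderTranslate, this]

end AuslanderTranslate

/-! ### The multiplicative basis of the Auslander algebra -/

section AuslanderBasis

variable (k : Type*) [CommRing k] (n : ℕ) [NeZero n]

/-- The arrow `(i - 1, u) → (i, u)`, or zero. -/
def auslanderA (i u : ZMod n) : AuslanderAlgebra k n :=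
  if h : u ≠ i - 1 then arrow k _ _ _ (.a i u h) else 0

/-- The arrow `(i, u - 1) → (i, u)`, or zero. -/
def auslanderB (i u : ZMod n) : AuslanderAlgebra k n :=
  if h : u ≠ i then arrow k _ _ _ (.b i u h) else 0

theorem auslanderA_mul_vertex (i u : ZMod n) :
    auslanderA k n i u * auslanderVertex k n i u = auslanderA k n i u := by
  unfold auslanderA
  split_ifs with h
  · exact arrow_mul_target k AuslanderArrow.source AuslanderArrow.target (auslanderRelation k n) _
  · exact zero_mul _

theorem vertex_mul_auslanderA (i u : ZMod n) :
    auslanderVertex k n (i - 1) u * auslanderA k n i u = auslanderA k n i u := by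
  unfold auslanderA
  split_ifs with h
  · exact source_mul_arrow k AuslanderArrow.source AuslanderArrow.target (auslanderRelation k n)
      (.a i u h)
  · exact mul_zero _

theorem auslanderB_mul_vertex (i u : ZMod n) :
    auslanderB k n i u * auslanderVertex k n i u = auslanderB k n i u := by
  unfold auslanderB
  split_ifs with h
  · exact arrow_mul_target k AuslanderArrow.source AuslanderArrow.target (auslanderRelation k n) _
  · exact zero_mul _

theorem vertex_mul_auslanderB (i u : ZMod n) :
    auslanderVertex k n i (u - 1) * auslanderB k n i u = auslanderB k n i u := by
  unfold auslanderB
  split_ifs with h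
  · exact source_mul_arrow k AuslanderArrow.source AuslanderArrow.target (auslanderRelation k n)
      (.b i u h)
  · exact mul_zero _

/-- With missing arrows read as zero, the triangle relation becomes the degenerate case `u = i - 1`
of the square relation. -/
theorem auslanderA_mul_auslanderB {i u : ZMod n} (h : u ≠ i) :
    auslanderA k n i (u - 1) * auslanderB k n i u =
      -(auslanderB k n (i - 1) u * auslanderA k n i u) := by
  have h1 : u - 1 ≠ i - 1 := fun h' => h (sub_left_injective h')
  by_cases h3 : u = i - 1
  · subst h3
    rw [auslanderB, auslanderB, dif_neg (not_not.2 rfl), zero_mul, neg_zero,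
      show i - 1 - 1 = i - 2 by ring, dif_pos h]
    rw [show i - 1 - 1 = i - 2 by ring] at h1
    rw [auslanderA, dif_pos h1]
    have := quotientMap_eq_zero k AuslanderArrow.source AuslanderArrow.target _
      (auslanderRelation.triangle (k := k) i h1 h)
    rw [map_mul] at this
    exact this
  · have := quotientMap_eq_zero k AuslanderArrow.source AuslanderArrow.target _
      (auslanderRelation.square (k := k) i u h1 h h3)
    rw [map_add, map_mul, map_mul] at this
    rw [auslanderA, auslanderA, auslanderB, auslanderB, dif_pos h1, dif_pos h, dif_pos h3,
      dif_pos h3]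
    exact eq_neg_of_add_eq_zero_left this

/-- The path with `l` arrows `b` and source `(i, i + d)`. -/
def auslanderBPath (i : ZMod n) (d : ℕ) : ℕ → AuslanderAlgebra k n
  | 0 => auslanderVertex k n i (i + d)
  | l + 1 => auslanderBPath i d l * auslanderB k n i (i + ((d + l + 1 : ℕ) : ZMod n))

/-- The path with source `(i, i + d)` which consists of `l` arrows `b` and of `r` arrows `a`, up to
a sign. -/
def auslanderPath (i : ZMod n) (d l : ℕ) : ℕ → AuslanderAlgebra k n
  | 0 => auslanderBPath k n i d l
  | r + 1 => (-1 : k) ^ (d + l + r) • (auslanderPath i d l r *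
      auslanderA k n (i + ((r + 1 : ℕ) : ZMod n)) (i + ((d + l : ℕ) : ZMod n)))

theorem auslanderPath_mul_vertex (i : ZMod n) (d l r : ℕ) :
    auslanderPath k n i d l r * auslanderVertex k n (i + r) (i + ((d + l : ℕ) : ZMod n)) =
      auslanderPath k n i d l r := by
  cases r with
  | zero =>
    rw [Nat.cast_zero, add_zero]
    cases l with
    | zero => exact vertex_idempotent k _ _ _ _
    | succ l => exact (mul_assoc _ _ _).trans (congrArg _ (auslanderB_mul_vertex k n _ _))
  | succ r => rw [auslanderPath, smul_mul_assoc, mul_assoc, auslanderA_mul_vertex]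

theorem vertex_mul_auslanderPath (i : ZMod n) (d l r : ℕ) :
    auslanderVertex k n i (i + d) * auslanderPath k n i d l r = auslanderPath k n i d l r := by
  induction r with
  | zero =>
    rw [auslanderPath]
    induction l with
    | zero => exact vertex_idempotent k _ _ _ _
    | succ l ih => rw [auslanderBPath, ← mul_assoc, ih]
  | succ r ih => rw [auslanderPath, mul_smul_comm, ← mul_assoc, ih]

/-- As `d < n ≤ d + l`, the arrows `b` would have to pass from distance `n - 1` to `n`, where there
is no arrow. -/
theorem auslanderPath_eq_zero (i : ZMod n) {d l : ℕ} (r : ℕ) (hd : d < n) (h : n ≤ d + l) :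
    auslanderPath k n i d l r = 0 := by
  induction r with
  | zero =>
    rw [auslanderPath]
    induction l with
    | zero => omega
    | succ l ih =>
      rw [auslanderBPath]
      by_cases h1 : n ≤ d + l
      · rw [ih h1, zero_mul]
      · rw [show d + l + 1 = n by omega, auslanderB, dif_neg (by simp), mul_zero]
  | succ r ih => rw [auslanderPath, ih, zero_mul, smul_zero]

/-- The arrow `b` is moved to the left past the arrows `a`. Each exchange gives a sign, which is
absorbed since the distance at that `a` has increased by one. -/
theorem auslanderPath_mul_auslanderB (i : ZMod n) {d l r : ℕ} (hr : r ≤ d + l) (hl : d + l < n) :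
    auslanderPath k n i d l r * auslanderB k n (i + r) (i + ((d + l + 1 : ℕ) : ZMod n)) =
      auslanderPath k n i d (l + 1) r := by
  induction r with
  | zero => rw [Nat.cast_zero, add_zero]; rfl
  | succ r ih =>
    have hne : i + ((d + l + 1 : ℕ) : ZMod n) ≠ i + ((r + 1 : ℕ) : ZMod n) := by
      intro h
      rw [Nat.cast_succ, Nat.cast_succ r, add_right_inj, add_left_inj] at h
      have := congrArg ZMod.val h
      rw [ZMod.val_natCast_of_lt hl, ZMod.val_natCast_of_lt (by omega)] at this
      omega
    have key := auslanderA_mul_auslanderB k n hne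
    rw [show i + ((d + l + 1 : ℕ) : ZMod n) - 1 = i + ((d + l : ℕ) : ZMod n) by push_cast; ring,
      show i + ((r + 1 : ℕ) : ZMod n) - 1 = i + (r : ZMod n) by push_cast; ring] at key
    rw [auslanderPath, smul_mul_assoc, mul_assoc, key, mul_neg, ← mul_assoc, ih (by omega),
      auslanderPath, ← add_assoc d l 1, show d + l + 1 + r = d + l + r + 1 by ring, pow_succ,
      mul_neg_one, neg_smul, smul_neg]

theorem auslanderPath_mul_auslanderPath (i i' : ZMod n) {d l r d' : ℕ} (l' r' : ℕ) (hd : d < n)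
    (hi : i' = i + r) (hd' : d' + r = d + l) :
    auslanderPath k n i d l r * auslanderPath k n i' d' l' r' =
      auslanderPath k n i d (l + l') (r + r') := by
  subst hi
  induction r' with
  | zero =>
    rw [auslanderPath]
    induction l' with
    | zero =>
      have := auslanderPath_mul_vertex k n i d l r
      rwa [← hd', Nat.cast_add, add_comm (d' : ZMod n), ← add_assoc] at this
    | succ l' ih =>
      rw [auslanderBPath, ← mul_assoc, ih]
      by_cases h : d + (l + l') < n
      · have := auslanderPath_mul_auslanderB k n i (d := d) (l := l + l') (r := r) (by omega) h
        rw [show i + (r : ZMod n) + ((d' + l' + 1 : ℕ) : ZMod n) =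
          i + ((d + (l + l') + 1 : ℕ) : ZMod n) by
            rw [show d + (l + l') + 1 = d' + l' + 1 + r by omega]; push_cast; ring]
        exact this
      · rw [auslanderPath_eq_zero k n i _ hd (by omega), auslanderPath_eq_zero k n i _ hd (by omega),
          zero_mul]
  | succ r' ih =>
    rw [auslanderPath, mul_smul_comm, ← mul_assoc, ih, ← add_assoc r, auslanderPath]
    congr 1
    -- The two exponents differ by `2 r`, so the signs agree.
    · rw [show d + (l + l') + (r + r') = d' + l' + r' + 2 * r by omega, pow_add _ _ (2 * r),
        pow_mul (-1 : k) 2 r]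
      simp
    · congr 2
      · push_cast; ring
      · rw [show d + (l + l') = d' + l' + r by omega]; push_cast; ring

/-- The multiplicative basis of the Auslander algebra. -/
def auslanderBasis : MeshPath n → AuslanderAlgebra k n
  | .zero => 0
  | .path i d m r _ _ _ => auslanderPath k n i d (m - d) r

theorem auslanderBasis_mk (i : ZMod n) {d m r : ℕ} (hd : d ≤ m) (hd' : d < n) (hr : r ≤ m) :
    auslanderBasis k n (.mk i d m r) = auslanderPath k n i d (m - d) r := by
  by_cases h : m < n
  · rw [← MeshPath.path_eq_mk i d m r hd h hr]; rfl
  · rw [MeshPath.mk_eq_zero (not_lt.1 h), auslanderPath_eq_zero k n i r hd' (by omega)]; rfl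

theorem auslanderBasis_mul (x y : MeshPath n) :
    auslanderBasis k n (x * y) = auslanderBasis k n x * auslanderBasis k n y := by
  rcases MeshPath.eq_zero_or_mk x with rfl | ⟨i, d, m, r, hd, hm, hr, rfl⟩
  · rw [zero_mul]; exact (zero_mul _).symm
  rcases MeshPath.eq_zero_or_mk y with rfl | ⟨i', d', m', r', hd', hm', hr', rfl⟩
  · rw [mul_zero]; exact (mul_zero _).symm
  rw [auslanderBasis_mk k n i hd (by omega) hr, auslanderBasis_mk k n i' hd' (by omega) hr']
  by_cases h : i' = i + r ∧ d' + r = m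
  · rw [MeshPath.mk_mul_mk_of_eq hd hr hd' hr' h.1 h.2,
      auslanderBasis_mk k n i (by omega) (by omega) (by omega),
      auslanderPath_mul_auslanderPath k n i i' _ _ (by omega) h.1 (by omega)]
    congr 1
    omega
  · rw [MeshPath.mk_mul_mk_of_ne h, ← auslanderPath_mul_vertex, ← vertex_mul_auslanderPath k n i',
      mul_assoc, ← mul_assoc (auslanderVertex k n (i + r) _), vertex_mul_vertex, zero_mul, mul_zero]
    · rfl
    · rintro h1
      obtain ⟨h2, h3⟩ := Prod.mk.inj h1
      refine h ⟨h2.symm, ?_⟩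
      -- Equality of vertices gives `d' = m - r` only modulo `n`; both numbers are less than `n`.
      rw [← h2, add_assoc, add_right_inj, ← Nat.cast_add, show d + (m - d) = m by omega] at h3
      have h4 : ((m - r : ℕ) : ZMod n) = d' := by
        rw [Nat.cast_sub hr, h3]; push_cast; ring
      have h5 := congrArg ZMod.val h4
      rw [ZMod.val_natCast_of_lt (by omega), ZMod.val_natCast_of_lt (by omega)] at h5
      omega

theorem exists_eq_add_natCast (i u : ZMod n) : ∃ d < n, u = i + (d : ZMod n) :=
  ⟨(u - i).val, ZMod.val_lt _, by simp⟩

theorem auslanderTranslate_relation ⦃x y : FreeAlgebra k ((ZMod n × ZMod n) ⊕ AuslanderArrow n)⦄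
    (h : Relation k AuslanderArrow.source AuslanderArrow.target (auslanderRelation k n) x y) :
    FreeAlgebra.lift k (auslanderTranslate k n) x =
      FreeAlgebra.lift k (auslanderTranslate k n) y := by
  cases h with
  | sum_vertices =>
    simp only [map_sum, FreeAlgebra.lift_ι_apply, map_one, auslanderTranslate]
    refine sum_rightTranslate_eq_one _ fun t ht => ?_
    obtain ⟨i, d, m, r, hd, hm, hr, rfl⟩ := (MeshPath.eq_zero_or_mk t).resolve_left ht
    have hv : ((i + (m : ZMod n)) - (i + r)).val = m - r := by
      rw [show (i + (m : ZMod n)) - (i + r) = ((m - r : ℕ) : ZMod n) by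
        rw [Nat.cast_sub hr]; ring, ZMod.val_natCast_of_lt (by omega)]
    refine ⟨(i + r, i + m), ?_, fun w hw => MeshPath.mk_mul_mk_of_ne ?_⟩
    · dsimp only
      rw [hv, MeshPath.mk_mul_mk_of_eq hd hr le_rfl (Nat.zero_le _) rfl (by omega), add_zero,
        show r + (m - r) = m by omega]
    · rintro ⟨h1, h2⟩
      refine hw (Prod.ext h1 ?_)
      have h3 := congrArg (Nat.cast (R := ZMod n)) h2
      rw [Nat.cast_add, ZMod.natCast_zmod_val, h1] at h3
      change w.2 = i + (m : ZMod n)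
      rw [← h3]; ring
  | vertex_idem v =>
    simp only [map_mul, FreeAlgebra.lift_ι_apply, auslanderTranslate, ← rightTranslate_mul]
    rw [MeshPath.mk_mul_mk_of_eq le_rfl (Nat.zero_le _) le_rfl (Nat.zero_le _) (by simp) (by omega),
      zero_add, zero_add]
  | vertex_orth v w h =>
    simp only [map_mul, FreeAlgebra.lift_ι_apply, auslanderTranslate, ← rightTranslate_mul, map_zero]
    rw [MeshPath.mk_mul_mk_of_ne, rightTranslate_zero]
    rintro ⟨h1, h2⟩
    rw [Nat.cast_zero, add_zero] at h1
    have h3 := ZMod.val_injective n h2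
    rw [h1] at h3
    exact h (Prod.ext h1.symm (sub_left_injective h3).symm)
  | source a =>
    rcases a with ⟨i, u, hu⟩ | ⟨i, u, hu⟩
    · obtain ⟨d, hd, h⟩ := exists_eq_add_natCast n (i - 1) u
      have hd0 : d ≠ 0 := by rintro rfl; exact hu (by simpa using h)
      simp only [map_mul, FreeAlgebra.lift_ι_apply, AuslanderArrow.source,
        auslanderTranslate_vertex k n hd h, auslanderTranslate_a k n hu hd rfl h]
      rw [mul_smul_comm, ← rightTranslate_mul, MeshPath.mk_mul_mk_of_eq le_rfl (Nat.zero_le _)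
        le_rfl (by omega) (by simp) (by omega), zero_add, zero_add]
    · obtain ⟨d, hd, h⟩ := exists_eq_add_natCast n i (u - 1)
      have h' : u = i + (d + 1 : ℕ) := by
        rw [← sub_add_cancel u 1, h]; push_cast; ring
      simp only [map_mul, FreeAlgebra.lift_ι_apply, AuslanderArrow.source,
        auslanderTranslate_vertex k n hd h, auslanderTranslate_b k n hu hd h']
      rw [← rightTranslate_mul, MeshPath.mk_mul_mk_of_eq le_rfl (Nat.zero_le _)
        (by omega) (by omega) (by simp) (by omega), zero_add, zero_add]
  | target a =>
    rcases a with ⟨i, u, hu⟩ | ⟨i, u, hu⟩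
    · obtain ⟨d, hd, h⟩ := exists_eq_add_natCast n (i - 1) u
      obtain ⟨d, rfl⟩ : ∃ d', d = d' + 1 := Nat.exists_eq_succ_of_ne_zero (by
        rintro rfl; exact hu (by simpa using h))
      have h' : u = i + d := by rw [h]; push_cast; ring
      simp only [map_mul, FreeAlgebra.lift_ι_apply, AuslanderArrow.target,
        auslanderTranslate_vertex k n (by omega) h', auslanderTranslate_a k n hu hd rfl h]
      rw [smul_mul_assoc, ← rightTranslate_mul, MeshPath.mk_mul_mk_of_eq le_rfl (by omega)
        le_rfl (by omega) (by simp) (by omega), add_zero, add_comm 1 d]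
    · obtain ⟨d, hd, h⟩ := exists_eq_add_natCast n i (u - 1)
      have h' : u = i + (d + 1 : ℕ) := by
        rw [← sub_add_cancel u 1, h]; push_cast; ring
      have hd' : d + 1 < n := by
        rcases Nat.lt_or_ge (d + 1) n with h1 | h1
        · exact h1
        · rw [show d + 1 = n by omega] at h'
          exact absurd (by simpa using h') hu
      simp only [map_mul, FreeAlgebra.lift_ι_apply, AuslanderArrow.target,
        auslanderTranslate_vertex k n hd' h', auslanderTranslate_b k n hu hd h']
      rw [← rightTranslate_mul, MeshPath.mk_mul_mk_of_eq (by omega) (by omega) le_rfl (by omega)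
        (by simp) (by omega), zero_add, zero_add]
  | rel x hx =>
    rw [map_zero]
    cases hx with
    | triangle i h1 h2 =>
      have hn1 : n ≠ 1 := by
        rintro rfl; exact h2 (Subsingleton.elim _ _)
      have hn0 := NeZero.ne n
      have e1 : i - 2 = i - 1 + ((n - 1 : ℕ) : ZMod n) := by
        rw [Nat.cast_sub (by omega)]; simp; ring
      have e2 : i - 1 = i + ((n - 2 + 1 : ℕ) : ZMod n) := by
        rw [show n - 2 + 1 = n - 1 by omega, Nat.cast_sub (by omega)]; simp [sub_eq_add_neg]
      rw [map_mul, FreeAlgebra.lift_ι_apply, FreeAlgebra.lift_ι_apply,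
        auslanderTranslate_a k n h1 (by omega) rfl e1, auslanderTranslate_b k n h2 (by omega) e2,
        smul_mul_assoc, ← rightTranslate_mul, MeshPath.mk_mul_mk_of_eq le_rfl (by omega) (by omega)
          (by omega) (by simp) (by omega), MeshPath.mk_eq_zero (by omega), rightTranslate_zero,
        smul_zero]
    | square i u h1 h2 h3 =>
      obtain ⟨d, hd, h⟩ := exists_eq_add_natCast n i u
      obtain ⟨d, rfl⟩ : ∃ d', d = d' + 1 := Nat.exists_eq_succ_of_ne_zero (by
        rintro rfl; exact h2 (by simpa using h))
      -- The condition `u ≠ i - 1` excludes the distance `n - 1`.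
      have hd' : d + 1 + 1 < n := by
        rcases Nat.lt_or_ge (d + 1 + 1) n with h4 | h4
        · exact h4
        · refine absurd ?_ h3
          rw [h, show d + 1 = n - 1 by omega, Nat.cast_sub (by omega)]
          simp [sub_eq_add_neg]
      rw [map_add, map_mul, map_mul, FreeAlgebra.lift_ι_apply, FreeAlgebra.lift_ι_apply,
        FreeAlgebra.lift_ι_apply, FreeAlgebra.lift_ι_apply,
        auslanderTranslate_a k n h1 (d := d + 1) hd rfl (by rw [h]; ring),
        auslanderTranslate_b k n h2 (d := d) (by omega) h,
        auslanderTranslate_b k n h3 (d := d + 1) hd (by rw [h]; push_cast; ring),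
        auslanderTranslate_a k n h3 (d := d + 1 + 1) hd' rfl (by rw [h]; push_cast; ring),
        smul_mul_assoc, mul_smul_comm, ← rightTranslate_mul, ← rightTranslate_mul,
        MeshPath.mk_mul_mk_of_eq le_rfl (by omega) (by omega) (by omega) (by simp) (by omega),
        MeshPath.mk_mul_mk_of_eq (by omega) (by omega) (by omega) (by omega) (by simp) (by omega),
        pow_succ (-1 : k) (d + 1), mul_neg_one, add_comm 1 (d + 1), zero_add, zero_add, add_zero]
      refine (add_smul _ _ _).symm.trans ?_
      rw [add_neg_cancel, zero_smul]

theorem isMultiplicativeBasis_auslanderBasis : IsMultiplicativeBasis k (auslanderBasis k n) where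
  map_mul := auslanderBasis_mul k n
  map_zero := rfl
  linearIndependent := by
    let π := liftRep k AuslanderArrow.source AuslanderArrow.target (auslanderRelation k n)
      (auslanderTranslate k n) (auslanderTranslate_relation k n)
    have πv : ∀ v, π (vertex k _ _ _ v) = auslanderTranslate k n (.inl v) :=
      liftRep_vertex k _ _ _ (auslanderTranslate k n) (auslanderTranslate_relation k n)
    have πa : ∀ a, π (arrow k _ _ _ a) = auslanderTranslate k n (.inr a) :=
      liftRep_arrow k _ _ _ (auslanderTranslate k n) (auslanderTranslate_relation k n)
    refine linearIndependent_of_rightTranslate π (fun s => ?_) fun _ => MeshPath.exists_source_mul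
    rcases MeshPath.eq_zero_or_mk s with rfl | ⟨i, d, m, r, hd, hm, hr, rfl⟩
    · rw [rightTranslate_zero]; exact map_zero π
    obtain ⟨l, rfl⟩ := Nat.exists_eq_add_of_le hd
    rw [auslanderBasis_mk k n i hd (by omega) hr, Nat.add_sub_cancel_left]
    induction r with
    | zero =>
      rw [auslanderPath]
      clear hd hr
      induction l with
      | zero => exact (πv _).trans (auslanderTranslate_vertex k n hm rfl)
      | succ l ih =>
        have hne : i + ((d + l + 1 : ℕ) : ZMod n) ≠ i := by
          rw [ne_eq, add_eq_left, ZMod.natCast_eq_zero_iff]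
          exact fun h => absurd (Nat.le_of_dvd (by omega) h) (by omega)
        rw [auslanderBPath, map_mul, ih (by omega), auslanderB, dif_pos hne, πa,
          auslanderTranslate_b k n hne (by omega) rfl, ← rightTranslate_mul,
          MeshPath.mk_mul_mk_of_eq (by omega) (by omega) (by omega) (by omega) (by simp) (by omega),
          zero_add, zero_add, add_assoc]
    | succ r ih =>
      obtain ⟨e, he⟩ := Nat.exists_eq_add_of_le hr
      have e1 : i + ((r + 1 : ℕ) : ZMod n) - 1 = i + (r : ZMod n) := by push_cast; ring
      have e2 : i + ((d + l : ℕ) : ZMod n) = i + (r : ZMod n) + ((e + 1 : ℕ) : ZMod n) := by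
        rw [he]; push_cast; ring
      have hne : i + ((d + l : ℕ) : ZMod n) ≠ i + ((r + 1 : ℕ) : ZMod n) - 1 := by
        rw [e1, e2, ne_eq, add_eq_left, ZMod.natCast_eq_zero_iff]
        exact fun h => absurd (Nat.le_of_dvd (by omega) h) (by omega)
      -- The sign in the definition of the path cancels the sign of the translation, the distance `e
      -- + 1` having the parity of `d + l + r`.
      rw [auslanderPath, map_smul, map_mul, ih (by omega), auslanderA, dif_pos hne, πa,
        auslanderTranslate_a k n hne (by omega) e1 e2, mul_smul_comm, smul_smul, ← pow_add,
        Even.neg_one_pow ⟨r + e + 1, by omega⟩, one_smul, ← rightTranslate_mul,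
        MeshPath.mk_mul_mk_of_eq (by omega) (by omega) le_rfl (by omega) rfl (by omega),
        show r + (e + 1) = d + l by omega]
  span_eq_top := by
    have hs : ∀ x, auslanderBasis k n x ∈ Submodule.span k (Set.range (auslanderBasis k n)) :=
      fun x => Submodule.subset_span ⟨x, rfl⟩
    refine span_range_eq_top k _ _ _ (auslanderBasis_mul k n) ?_ ?_
    · rintro ⟨i, u⟩
      obtain ⟨d, hd, rfl⟩ := exists_eq_add_natCast n i u
      have := hs (.mk i d d 0)
      rwa [auslanderBasis_mk k n i le_rfl hd (Nat.zero_le _), Nat.sub_self] at this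
    · rintro (⟨i, u, hu⟩ | ⟨i, u, hu⟩)
      · obtain ⟨d, hd, h⟩ := exists_eq_add_natCast n (i - 1) u
        have hd0 : d ≠ 0 := by rintro rfl; exact hu (by simpa using h)
        have h1 : arrow k _ _ _ (.a i u hu) = auslanderA k n i u := by
          rw [auslanderA, dif_pos hu]
        have h2 := vertex_mul_auslanderA k n i u
        have h3 := hs (.mk (i - 1) d d 1)
        rw [auslanderBasis_mk k n _ le_rfl hd (by omega), Nat.sub_self, auslanderPath, auslanderPath,
          auslanderBPath, Nat.add_zero, ← h, Nat.cast_add, Nat.cast_zero, Nat.cast_one, zero_add,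
          sub_add_cancel, h2] at h3
        have h4 := Submodule.smul_mem _ ((-1 : k) ^ d) h3
        rw [smul_smul, ← mul_pow, neg_one_mul, neg_neg, one_pow, one_smul] at h4
        rw [h1]
        exact h4
      · obtain ⟨d, hd, h⟩ := exists_eq_add_natCast n i (u - 1)
        have h' : i + (d + 1 : ℕ) = u := by
          rw [← sub_add_cancel u 1, h]; push_cast; ring
        have h1 : arrow k _ _ _ (.b i u hu) = auslanderB k n i u := by
          rw [auslanderB, dif_pos hu]
        have h2 := vertex_mul_auslanderB k n i u
        have h3 := hs (.mk i d (d + 1) 0)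
        rw [auslanderBasis_mk k n _ (by omega) hd (by omega), Nat.add_sub_cancel_left, auslanderPath,
          auslanderBPath, auslanderBPath, add_zero, ← h, h', h2] at h3
        rw [h1]
        exact h3

end AuslanderBasis

/-! ### Even Hochschild homology of the Auslander algebra vanishes in positive degrees -/

section AuslanderHomology

variable (k : Type*) [Field k] (n : ℕ) [NeZero n]

theorem exists_bMap_eq_auslander {j : ℕ} {z : Chains k (AuslanderAlgebra k n) (2 * j + 2)}
    (hz : bMap k (face0 k _) (rot k _) (2 * j + 1) z = 0) :
    ∃ w, bMap k (face0 k _) (rot k _) (2 * j + 2) w = z := by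
  have hm := isMultiplicativeBasis_auslanderBasis k n
  have h := ker_bMap_le hm (q := 2 * j + 1) ⊥ (fun Φ _ hΦ => by
    obtain ⟨g, hg, h⟩ := MeshPath.exists_coboundary_eq (contracted_cochainOf hm.map_zero Φ)
      (q := 2 * j) hΦ
    exact ⟨g, hg, fun x l hl => (h x l hl).symm⟩) hz
  rwa [sup_bot_eq] at h

theorem span_auslanderSigma_eq_top (p : ℕ) :
    Submodule.span k (Set.range fun q : ZMod n × ZMod n => auslanderSigma k n p q.1 q.2) = ⊤ := by
  have hm := isMultiplicativeBasis_auslanderBasis k n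
  refine span_sigmaClass_eq_top k (fun j _ z hz => ?_)
    (fun q : ZMod n × ZMod n => auslanderVertex k n q.1 q.2) (fun q => vertex_idempotent k _ _ _ q)
    (exists_eq_sum_add_bMap hm _ ?_)
  · obtain ⟨w, hw⟩ := exists_bMap_eq_auslander k n hz
    -- A Hochschild boundary needs no help from the neighbouring columns.
    exact ⟨0, w, 0, by rw [map_zero, zero_add, hw], by rw [map_zero, map_zero], map_zero _⟩
  · intro s hs
    obtain ⟨i, d, m, r, hd, hm, hr, rfl⟩ := (MeshPath.eq_zero_or_mk s).resolve_left hs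
    by_cases h : r = 0 ∧ d = m
    · obtain ⟨rfl, rfl⟩ := h
      refine Or.inl ⟨(i, i + d), ?_⟩
      rw [auslanderBasis_mk k n i le_rfl hm hr, Nat.sub_self]
      rfl
    -- A path other than a vertex is not closed: its target `(i + r, i + m)` with `r < n` and `m <
    -- n` differs from its source.
    · refine Or.inr ⟨.mk i d d 0, ?_, MeshPath.mk_mul_mk_of_ne ?_⟩
      · rw [MeshPath.mk_mul_mk_of_eq le_rfl (Nat.zero_le _) hd hr (by simp) (by omega), zero_add, zero_add]
      · rintro ⟨h1, h2⟩
        rw [left_eq_add, ZMod.natCast_eq_zero_iff] at h1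
        have h3 : r = 0 := Nat.eq_zero_of_dvd_of_lt h1 (by omega)
        exact h ⟨h3, by omega⟩

end AuslanderHomology

end QuiverAlgebra

end

/-! ### The Chern characters of the Taft algebra and of its Auslander algebra -/

open CyclicHomology QuiverAlgebra in
theorem mainTheorem3 {k : Type*} [Field k] [IsAlgClosed k] (n : ℕ) [NeZero n] (hn : 2 ≤ n) (p : ℕ) :
    (∀ j : ZMod n,
        chernCharacter k p (K0.mk (taftProjective k n j)) = taftSigma k n p j) ∧
      (∀ i u : ZMod n,
        chernCharacter k p (K0.mk (auslanderProjective k n i u)) = auslanderSigma k n p i u) ∧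
      ((p.factorial : k) ≠ 0 →
        Submodule.span k (Set.range fun j : ZMod n => taftSigma k n p j) = ⊤ ∧
          Function.Surjective (chernCharacterLinear (A := TaftAlgebra k n) k p)) ∧
      Submodule.span k (Set.range fun q : ZMod n × ZMod n => auslanderSigma k n p q.1 q.2) = ⊤ ∧
      Function.Surjective (chernCharacterLinear (A := AuslanderAlgebra k n) k p) := by
  have hΛ := fun j : ZMod n =>
    vertex_idempotent k (fun i => i) (fun i => i + 1) (taftRelation k n) j
  have hΓ := fun q : ZMod n × ZMod n =>
    vertex_idempotent k AuslanderArrow.source AuslanderArrow.target (auslanderRelation k n) q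
  refine ⟨fun j => chernCharacter_principal k p _ (hΛ j),
    fun i u => chernCharacter_principal k p _ (hΓ (i, u)), fun hp => ⟨span_taftSigma_eq_top k hn hp, ?_⟩,
    span_auslanderSigma_eq_top k n p, ?_⟩
  · exact chernCharacterLinear_surjective k (fun j => taftVertex k n j) hΛ
      (span_taftSigma_eq_top k hn hp)
  · exact chernCharacterLinear_surjective k (fun q : ZMod n × ZMod n => auslanderVertex k n q.1 q.2)
      hΓ (span_auslanderSigma_eq_top k n p)
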